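/- **Notation.** $\mathbb Z_+=\{0,1,2,\dots\}$. For $\alpha=\{\alpha(j)\}_{j\ge0}\subset\mathbb C$, $H(\alpha)=\{\alpha(j+k)\}_{j,k\ge0}$ is the Hankel matrix on $\ell^2(\mathbb Z_+)$. For $\mathbf a\in L^1_{\rm loc}(0,\infty)$, $\mathbf H(\mathbf a)$ is the integral Hankel operator $(\mathbf H(\mathbf a)\mathbf f)(t)=\int_0^\infty \mathbf a(t+s)\mathbf f(s)\,ds$ on $L^2(0,\infty)$; it is called bounded if it extends from continuous $\mathbf f$ with compact support in $(0,\infty)$ to a bounded operator on $L^2(0,\infty)$, which is then also denoted $\mathbf H(\mathbf a)$. For $0<p<\infty$, $T\in\mathbf S_p$ means that $T$ is compact and $\|T\|_{\mathbf S_p}^p=\sum_n s_n(T)^p<\infty$, where $s_n(T)$ are the singular values with multiplicities. $\check{\varphi}(\xi)=\int_{\mathbb R}\varphi(t)e^{2\pi i\xi t}\,dt$ is the inverse Fourier transform in $L^2(\mathbb R)$, and $T_\nu f=f*\nu$, i.e. $(T_\nu f)(t)=\int f(t-s)\,d\nu(s)$. Integrals $\int_0^\infty \mathbf a(t)\varphi_j(t)\,dt$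 are understood as $\lim_{\varepsilon\to0+,\,R\to\infty}\int_0^\infty(\eta(t/R)-\eta(t/\varepsilon))\,\mathbf a(t)\varphi_j(t)\,dt$ for every $\eta\in C_c^\infty(\mathbb R)$ real-valued with $\eta=1$ near $0$; this is the Lebesgue integral whenever the latter converges absolutely. **Theorem.** Let $\nu$ be a positive measure on $[0,\infty)$ with $\nu([0,\infty))\le 1$ and $\nu\ne\delta_0$. Let $\varphi:\mathbb R\to\mathbb C$ be continuous and in $L^2(\mathbb R)$, with $\operatorname{supp}\varphi\subset[0,\infty)$ and, for some constant $C$, $|\check\varphi(\xi)|\le C/(1+\xi^2)$ for almost every $\xi\in\mathbb R$. For $j\ge0$ set $\varphi_j=T_\nu^j\varphi$. Then there exist bounded operators $\Phi_1,\Phi_2:\ell^2(\mathbb Z_+)\to L^2(0,\infty)$ such that for every $\mathbf a\in L^1_{\rm loc}(0,\infty)$ with $\mathbf H(\mathbf a)$ bounded, the integrals $$\alpha(j)=\int_0^\infty \mathbf a(t)\varphi_j(t)\,dt,\qquad j\ge0,$$ exist, $H(\alpha)$ is bounded, and $$\Phi_2^*\,\mathbf H(\mathbf a)\,\Phi_1=H(\alpha).$$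 Consequently, with $A=\|\Phi_1\|\,\|\Phi_2\|$, one has $\|H(\alpha)\|\le A\|\mathbf H(\mathbf a)\|$; and for every $0<p<\infty$, if $\mathbf H(\mathbf a)\in\mathbf S_p$ then $H(\alpha)\in\mathbf S_p$ and $\|H(\alpha)\|_{\mathbf S_p}\le A\|\mathbf H(\mathbf a)\|_{\mathbf S_p}$. **The Laguerre case.** Let $L_n$ be the Laguerre polynomials and $\mathbf u_n(t)=-2i\sqrt\pi\,L_n(4\pi t)e^{-2\pi t}$, $t>0$. There is a unitary operator $U:\ell^2(\mathbb Z_+)\to L^2(0,\infty)$ which maps the standard basis vector $e_n$ to $\mathbf u_n$ for every $n\ge0$. Let $\varphi(t)=-4\pi t e^{-2\pi t}$ for $t\ge0$, $\varphi(t)=0$ for $t<0$, let $\nu$ be the signed measure $\delta_0-4\pi e^{-2\pi s}\mathbf 1_{\{s>0\}}\,ds$ on $[0,\infty)$, and $\varphi_j=T_\nu^j\varphi$. Then for every $\mathbf a\in L^1_{\rm loc}(0,\infty)$ with $\mathbf H(\mathbf a)$ bounded, the integrals $\alpha(j)=\int_0^\infty\mathbf a(t)\varphi_j(t)\,dt$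 exist, $H(\alpha)$ is bounded, and $\Phi_2^*\,\mathbf H(\mathbf a)\,\Phi_1=H(\alpha)$ with $\Phi_1=U$ and $\Phi_2=-U$. -/

import Mathlib

open MeasureTheory Set Filter Topology ContinuousLinearMap
open scoped ENNReal FourierTransform ContDiff

/-- The Hilbert space `ℓ²(ℤ₊)`, `ℤ₊ = {0, 1, 2, …}`. -/
abbrev SeqL2 : Type := lp (fun _ : ℕ => ℂ) 2

/-- The Hilbert space `L²(0, ∞)`. -/
abbrev HalfLineL2 : Type := Lp ℂ 2 ((volume : Measure ℝ).restrict (Ioi 0))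

/-- The bounded operator `T` on `ℓ²(ℤ₊)` is the Hankel matrix `H(α)`:
`(T x)(k) = ∑_j α(j + k) x(j)`. -/
def IsHankelMatrix (α : ℕ → ℂ) (T : SeqL2 →L[ℂ] SeqL2) : Prop :=
  ∀ (x : SeqL2) (k : ℕ), HasSum (fun j : ℕ => α (j + k) * x j) (T x k)

/-- The bounded operator `A` on `L²(0, ∞)` is the integral Hankel operator with kernel function
`a`, that is `(A f)(t) = ∫₀^∞ a(t + s) f(s) ds`. As `a` is merely locally integrable on `(0, ∞)`,
the integral is required for `f` in the dense class of continuous functions with compact support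
in `(0, ∞)`, where it converges absolutely for each `t > 0`; `A` is its bounded extension. -/
def IsIntegralHankel (a : ℝ → ℂ) (A : HalfLineL2 →L[ℂ] HalfLineL2) : Prop :=
  ∀ f : ℝ → ℂ, Continuous f → HasCompactSupport f → tsupport f ⊆ Ioi 0 →
    ∀ g : HalfLineL2, (g =ᵐ[volume.restrict (Ioi 0)] f) →
      A g =ᵐ[volume.restrict (Ioi 0)] fun t => ∫ s in Ioi (0 : ℝ), a (t + s) * f s

/-- `(T_ν f)(t) = (f * ν)(t) = ∫ f(t - s) dν(s)`. -/
noncomputable def convMeasure (ν : Measure ℝ) (f : ℝ → ℂ) : ℝ → ℂ :=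
  fun t => ∫ s, f (t - s) ∂ν

/-- `I = ∫₀^∞ f(t) dt`, where the integral is understood as the limit of
`∫₀^∞ (η(t/R) - η(t/ε)) f(t) dt` as `ε → 0+`, `R → ∞`, for every smooth compactly supported `η`
with `η = 1` near `0`. The factor vanishes near `0` and near `∞` and tends to `1` pointwise, so for
`f` integrable on `(0, ∞)` this is the Lebesgue integral. -/
def HasSmoothIntegral (f : ℝ → ℂ) (I : ℂ) : Prop :=
  ∀ η : ℝ → ℝ, ContDiff ℝ ∞ η → HasCompactSupport η → (∀ᶠ t in 𝓝 (0 : ℝ), η t = 1) →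
    Tendsto (fun q : ℝ × ℝ => ∫ t in Ioi (0 : ℝ), ((η (t / q.2) - η (t / q.1) : ℝ) : ℂ) * f t)
      (𝓝[>] (0 : ℝ) ×ˢ atTop) (𝓝 I)

/-- `α(j) = ∫₀^∞ a(t) φ_j(t) dt` for all `j ≥ 0`. The second clause says explicitly that this is
the Lebesgue integral whenever the latter converges absolutely. -/
def IsRestriction (a : ℝ → ℂ) (φ : ℕ → ℝ → ℂ) (α : ℕ → ℂ) : Prop :=
  ∀ j : ℕ, HasSmoothIntegral (fun t => a t * φ j t) (α j) ∧
    (IntegrableOn (fun t => a t * φ j t) (Ioi 0) → α j = ∫ t in Ioi (0 : ℝ), a t * φ j t)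

section Schatten

variable {E : Type*} [NormedAddCommGroup E] [InnerProductSpace ℂ E] [CompleteSpace E]

/-- The multiplicity of `σ > 0` as a singular value of `T`: the dimension of the eigenspace of
`T* T` for the eigenvalue `σ²` (it is finite if `T` is compact). -/
noncomputable def singularMultiplicity (T : E →L[ℂ] E) (σ : ℝ) : ℕ :=
  Module.finrank ℂ
    (Module.End.eigenspace ((adjoint T ∘L T : E →L[ℂ] E) : E →ₗ[ℂ] E) ((σ : ℂ) ^ 2))

/-- `∑ₙ sₙ(T)^p`, the sum over the positive singular values of `T`, each one counted with its
multiplicity. -/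
noncomputable def schattenSum (p : ℝ) (T : E →L[ℂ] E) : ℝ≥0∞ :=
  ∑' σ : Ioi (0 : ℝ), (singularMultiplicity T σ : ℝ≥0∞) * ENNReal.ofReal ((σ : ℝ) ^ p)

/-- `T ∈ S_p`, for `0 < p < ∞`. -/
def MemSchatten (p : ℝ) (T : E →L[ℂ] E) : Prop :=
  IsCompactOperator T ∧ schattenSum p T ≠ ⊤

/-- `‖T‖_{S_p} = (∑ₙ sₙ(T)^p)^{1/p}`, for `T ∈ S_p`. -/
noncomputable def schattenNorm (p : ℝ) (T : E →L[ℂ] E) : ℝ :=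
  (schattenSum p T).toReal ^ (1 / p)

end Schatten

/-- The Laguerre polynomial `L_n(x) = ∑_{k ≤ n} (n choose k) (-x)^k / k!`. -/
noncomputable def laguerrePoly (n : ℕ) (x : ℝ) : ℝ :=
  ∑ k ∈ Finset.range (n + 1), (n.choose k : ℝ) * (-x) ^ k / (k.factorial : ℝ)

/-- `u_n(t) = -2 i √π L_n(4πt) e^{-2πt}`. -/
noncomputable def laguerreFun (n : ℕ) (t : ℝ) : ℂ :=
  -2 * Complex.I * ((√Real.pi * laguerrePoly n (4 * Real.pi * t) *
    Real.exp (-2 * Real.pi * t) : ℝ) : ℂ)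

/-- The function `-4πt e^{-2πt}` on `t ≥ 0`, extended by zero. -/
noncomputable def laguerreWeight (t : ℝ) : ℂ :=
  if 0 ≤ t then ((-4 * Real.pi * t * Real.exp (-2 * Real.pi * t) : ℝ) : ℂ) else 0

/-- Convolution with the signed measure `δ₀ - 4π e^{-2πs} 1_{s > 0} ds`. -/
noncomputable def laguerreConv (f : ℝ → ℂ) : ℝ → ℂ :=
  fun t => f t - 4 * Real.pi * ∫ s in Ioi (0 : ℝ), (Real.exp (-2 * Real.pi * s) : ℂ) * f (t - s)

/-! ### Singular values of products -/

/-! Write `f` for `exp(-2πt)` on the half-line, `T` for convolution with `ν`, and `B(u, v) = ∫ (A u)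
v` for the bilinear form of the Hankel operator. On functions supported in `[0, ∞)`, `B(u, v)` is
the regularized integral of `a · (u ∗ v)`. A translation by `s ≥ 0` may therefore be moved from `u`
to `v`, and so may `T` (`halfLineForm_convOp`).

The decay of the inverse Fourier transform of `φ` is exactly what allows a factorization `φ = f ∗ g`
with `g = M f`, where `M` is a bounded Fourier multiplier (`exists_factorization`). Then `φ_j = f ∗
T^j g` and `B(T^j f, T^k g) = B(f, T^(j+k) g) = α(j + k)`. This is the matrix entry of `Φ₂* A Φ₁`
when `Φ₁ e_j = T^j f` and `Φ₂ e_k` is the complex conjugate of `T^k g`.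

These operators are bounded. `T` is a contraction and `⟨f, T u⟩ = z ⟨f, u⟩` for `u` supported in
`[0, ∞)`, where `z` is the Laplace transform of `ν` at `2π`. Since `ν ≠ δ₀`, `|z| < 1`, and a
Littlewood-type induction shows that the orbit of `f` is a Bessel sequence (`norm_sum_orbit_sq_le`).
As `M` commutes with `T`, so is the orbit of `g`.

The regularized integrals converge because cut-offs are superpositions of characters, and
multiplying `u ∗ v` by a character amounts to modulating `u` and `v`, which is isometric. The
cut-off forms are thus uniformly bounded (`norm_integral_dilation_le`), and convergence passes from
test functions to their closure.

The Schatten estimate comes from counting singular values above each threshold. In the Laguerre case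
`T` is an isometry with `z = 0`, so the orbit of `f` is orthogonal; its span is dense because its
generating function produces every decaying exponential. Here `g = -4π f`. -/

theorem inner_self_eq_ofReal_norm_sq {E : Type*} [NormedAddCommGroup E] [InnerProductSpace ℂ E]
    (x : E) : inner ℂ x x = (‖x‖ : ℂ) ^ 2 :=
  inner_self_eq_norm_sq_to_K x

section SingularValues

variable {E F : Type*} [NormedAddCommGroup E] [InnerProductSpace ℂ E] [CompleteSpace E]
  [NormedAddCommGroup F] [InnerProductSpace ℂ F] [CompleteSpace F]

/-- The eigenspace of `T* T` whose dimension is the multiplicity of the singular value `σ`. -/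
noncomputable def singularSpace (T : E →L[ℂ] E) (σ : ℝ) : Submodule ℂ E :=
  Module.End.eigenspace ((adjoint T ∘L T : E →L[ℂ] E) : E →ₗ[ℂ] E) ((σ : ℂ) ^ 2)

theorem mem_singularSpace {T : E →L[ℂ] E} {σ : ℝ} {x : E} :
    x ∈ singularSpace T σ ↔ adjoint T (T x) = ((σ : ℂ) ^ 2) • x := by
  simp [singularSpace]

theorem finrank_singularSpace (T : E →L[ℂ] E) (σ : ℝ) :
    Module.finrank ℂ (singularSpace T σ) = singularMultiplicity T σ := rfl

theorem isSymmetric_adjoint_comp_self (T : E →L[ℂ] E) :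
    ((adjoint T ∘L T : E →L[ℂ] E) : E →ₗ[ℂ] E).IsSymmetric := by
  intro x y
  simp [adjoint_inner_left, adjoint_inner_right]

theorem IsCompactOperator.adjoint_comp_self {T : E →L[ℂ] E} (hT : IsCompactOperator T) :
    IsCompactOperator (adjoint T ∘L T) :=
  hT.clm_comp (adjoint T)

theorem finiteDimensional_singularSpace {T : E →L[ℂ] E} (hT : IsCompactOperator T) {σ : ℝ}
    (hσ : σ ≠ 0) : FiniteDimensional ℂ (singularSpace T σ) :=
  ContinuousLinearMap.finite_dimensional_eigenspace hT.adjoint_comp_self _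
    (by simpa using hσ)

/-- On the orthogonal complement of an invariant subspace which contains all singular vectors with
singular values above `r`, a compact operator has norm at most `r`. -/
theorem norm_apply_le_of_mem_orthogonal {T : E →L[ℂ] E} (hT : IsCompactOperator T) {r : ℝ}
    (hr : 0 ≤ r) {W : Submodule ℂ E} (hinv : ∀ x ∈ W, adjoint T (T x) ∈ W)
    (hW : ∀ σ : ℝ, r < σ → singularSpace T σ ≤ W) {x : E} (hx : x ∈ Wᗮ) :
    ‖T x‖ ≤ r * ‖x‖ := by
  set B : E →L[ℂ] E := adjoint T ∘L T with hB
  have hinv' : ∀ y ∈ Wᗮ, B y ∈ Wᗮ := by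
    intro y hy
    rw [Submodule.mem_orthogonal] at hy ⊢
    intro w hw
    have := hy _ (hinv w hw)
    simpa [hB, adjoint_inner_left, adjoint_inner_right] using this
  -- The restriction of `T* T` to `Wᗮ` is compact and self-adjoint, so its norm is the modulus of an
  -- eigenvalue or zero. An eigenvector with `σ > r` would lie in both `W` and `Wᗮ`.
  let S : Wᗮ →L[ℂ] Wᗮ := B.restrict hinv'
  have hSc : IsCompactOperator S := hT.adjoint_comp_self.restrict' hinv'
  have hSs : S.IsSymmetric := (isSymmetric_adjoint_comp_self T).restrict_invariant hinv'
  have hSn : ‖S‖ ≤ r ^ 2 := by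
    rcases subsingleton_or_nontrivial Wᗮ with hsub | hnt
    · have : S = 0 := by ext y; simp [Subsingleton.elim y 0]
      rw [this]; simpa using sq_nonneg r
    obtain ⟨k, hk, hkn⟩ := spectrum.exists_nnnorm_eq_spectralRadius S
    rw [S.spectralRadius_eq_nnnorm hSs.isSelfAdjoint] at hkn
    have hkn' : ‖k‖ = ‖S‖ := by
      have := ENNReal.coe_inj.1 hkn
      exact congrArg NNReal.toReal this
    rw [← hkn']
    by_cases hk0 : k = 0
    · simp [hk0]; positivity
    obtain ⟨v, hv⟩ := ((hSc.hasEigenvalue_iff_mem_spectrum hk0).2 hk).exists_hasEigenvector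
    have hv1 : B (v : E) = k • (v : E) := by
      have := congrArg Subtype.val hv.apply_eq_smul
      simpa [S] using this
    have hv0 : (v : E) ≠ 0 := by simpa using hv.2
    have hq : ((‖T v‖ : ℂ)) ^ 2 = k * (‖(v : E)‖ : ℂ) ^ 2 := by
      have h1 : inner ℂ (v : E) (B v) = k * inner ℂ (v : E) (v : E) := by
        rw [hv1, inner_smul_right]
      have h2 : inner ℂ (v : E) (B v) = inner ℂ (T v) (T v) := by
        simp [hB, adjoint_inner_right]
      rw [h2] at h1
      simpa only [inner_self_eq_ofReal_norm_sq] using h1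
    have hvn : (0 : ℝ) < ‖(v : E)‖ := norm_pos_iff.2 hv0
    set σ : ℝ := ‖T v‖ / ‖(v : E)‖ with hσ
    have hkσ : k = (σ : ℂ) ^ 2 := by
      have : (‖(v : E)‖ : ℂ) ≠ 0 := by exact_mod_cast hvn.ne'
      rw [hσ]; push_cast
      field_simp
      exact hq.symm
    have hσ0 : 0 ≤ σ := by positivity
    have hσr : σ ≤ r := by
      by_contra! hlt
      have hmem : (v : E) ∈ W := hW σ hlt (mem_singularSpace.2 (by rw [← hkσ]; exact hv1))
      exact hv0 (by
        have := (Submodule.mem_orthogonal _ _).1 v.2 v hmem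
        simpa using this)
    rw [hkσ, norm_pow, Complex.norm_real, Real.norm_of_nonneg hσ0]
    gcongr
  have h3 : ‖T x‖ ^ 2 ≤ (r * ‖x‖) ^ 2 := by
    have h1 : ‖T x‖ ^ 2 = (inner ℂ (B x) x).re := by
      rw [hB, comp_apply, adjoint_inner_left]
      have := @inner_self_eq_norm_sq ℂ E _ _ _ (T x)
      simpa using this.symm
    rw [h1]
    calc (inner ℂ (B x) x).re ≤ ‖inner ℂ (B x) x‖ := Complex.re_le_norm _
      _ ≤ ‖B x‖ * ‖x‖ := norm_inner_le_norm _ _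
      _ = ‖S ⟨x, hx⟩‖ * ‖x‖ := by rfl
      _ ≤ (‖S‖ * ‖x‖) * ‖x‖ := by gcongr; exact S.le_opNorm _
      _ ≤ (r ^ 2 * ‖x‖) * ‖x‖ := by gcongr
      _ = _ := by ring
  exact le_of_sq_le_sq h3 (by positivity) 

/-- The sum map from the product of finitely many singular spaces. -/
noncomputable def singularSum (T : E →L[ℂ] E) (G : Finset ℝ) :
    ((σ : G) → singularSpace T σ) →ₗ[ℂ] E :=
  ∑ σ : G, (singularSpace T (σ : ℝ)).subtype ∘ₗ LinearMap.proj σ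

theorem singularSum_apply (T : E →L[ℂ] E) (G : Finset ℝ) (x : (σ : G) → singularSpace T σ) :
    singularSum T G x = ∑ σ : G, (x σ : E) := by
  simp [singularSum]

theorem inner_singularSpace {T : E →L[ℂ] E} {σ τ : ℝ} (hσ : 0 < σ) (hτ : 0 < τ) (h : σ ≠ τ)
    {x y : E} (hx : x ∈ singularSpace T σ) (hy : y ∈ singularSpace T τ) : inner ℂ x y = 0 := by
  have hne : ((σ : ℂ) ^ 2) ≠ (τ : ℂ) ^ 2 := by
    norm_cast
    intro h'
    exact h ((sq_eq_sq₀ hσ.le hτ.le).1 h')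
  exact (isSymmetric_adjoint_comp_self T).orthogonalFamily_eigenspaces hne ⟨x, hx⟩ ⟨y, hy⟩

theorem norm_singularSum_sq (T : E →L[ℂ] E) {G : Finset ℝ} (hG : ∀ σ ∈ G, 0 < σ)
    (x : (σ : G) → singularSpace T σ) :
    ‖singularSum T G x‖ ^ 2 = ∑ σ : G, ‖(x σ : E)‖ ^ 2 := by
  have h : ((‖singularSum T G x‖ : ℂ)) ^ 2 = ∑ σ : G, (‖(x σ : E)‖ : ℂ) ^ 2 := by
    have h0 : inner ℂ (singularSum T G x) (singularSum T G x)
        = ∑ σ : G, inner ℂ (x σ : E) (x σ : E) := by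
      rw [singularSum_apply, sum_inner]
      refine Finset.sum_congr rfl fun σ _ => ?_
      rw [inner_sum, Finset.sum_eq_single σ]
      · intro τ _ hτ
        exact inner_singularSpace (hG _ σ.2) (hG _ τ.2) (fun h => hτ (Subtype.ext h.symm))
          (x σ).2 (x τ).2
      · simp
    simpa only [inner_self_eq_ofReal_norm_sq] using h0
  exact_mod_cast h

/-- Since `⟨T x, T y⟩ = ⟨x, T* T y⟩`, the images of distinct singular spaces remain orthogonal, and
Pythagoras applies after `T` as well. -/
theorem norm_apply_singularSum_sq (T : E →L[ℂ] E) {G : Finset ℝ} (hG : ∀ σ ∈ G, 0 < σ)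
    (x : (σ : G) → singularSpace T σ) :
    ‖T (singularSum T G x)‖ ^ 2 = ∑ σ : G, (σ : ℝ) ^ 2 * ‖(x σ : E)‖ ^ 2 := by
  have h : ((‖T (singularSum T G x)‖ : ℂ)) ^ 2
      = ∑ σ : G, ((σ : ℝ) : ℂ) ^ 2 * (‖(x σ : E)‖ : ℂ) ^ 2 := by
    have h0 : inner ℂ (T (singularSum T G x)) (T (singularSum T G x))
        = ∑ σ : G, (((σ : ℝ) : ℂ) ^ 2) * inner ℂ (x σ : E) (x σ : E) := by
      rw [← adjoint_inner_right, singularSum_apply, map_sum, map_sum, sum_inner]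
      refine Finset.sum_congr rfl fun σ _ => ?_
      rw [inner_sum, Finset.sum_eq_single σ]
      · rw [mem_singularSpace.1 (x σ).2, inner_smul_right]
      · intro τ _ hτ
        rw [mem_singularSpace.1 (x τ).2, inner_smul_right,
          inner_singularSpace (hG _ σ.2) (hG _ τ.2) (fun h => hτ (Subtype.ext h.symm))
          (x σ).2 (x τ).2, mul_zero]
      · simp
    simpa only [inner_self_eq_ofReal_norm_sq] using h0
  exact_mod_cast h

/-- The strictness is what yields injectivity in the dimension count of
`sum_singularMultiplicity_le`. -/
theorem mul_norm_lt_norm_apply_singularSum {T : E →L[ℂ] E} {G : Finset ℝ} {r : ℝ} (hr : 0 ≤ r)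
    (hG : ∀ σ ∈ G, r < σ) {x : (σ : G) → singularSpace T σ} (hx : x ≠ 0) :
    r * ‖singularSum T G x‖ < ‖T (singularSum T G x)‖ := by
  have hG0 : ∀ σ ∈ G, 0 < σ := fun σ h => hr.trans_lt (hG σ h)
  refine lt_of_pow_lt_pow_left₀ 2 (norm_nonneg _) ?_
  rw [mul_pow, norm_singularSum_sq T hG0, norm_apply_singularSum_sq T hG0, Finset.mul_sum]
  obtain ⟨σ, hσ⟩ := Function.ne_iff.1 hx
  refine Finset.sum_lt_sum (fun τ _ => ?_) ⟨σ, Finset.mem_univ _, ?_⟩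
  · have := hG τ τ.2
    gcongr
  · have := hG σ σ.2
    have h2 : 0 < ‖(x σ : E)‖ := norm_pos_iff.2 (by simpa using hσ)
    gcongr

theorem sum_singularMultiplicity (T : E →L[ℂ] E) (G : Finset ℝ)
    (hfin : ∀ σ : G, FiniteDimensional ℂ (singularSpace T σ)) :
    Module.finrank ℂ ((σ : G) → singularSpace T σ) = ∑ σ ∈ G, singularMultiplicity T σ := by
  rw [Module.finrank_pi_fintype, ← Finset.sum_coe_sort G]
  rfl

/-- Weyl type comparison of the numbers of singular values above a threshold. -/
theorem sum_singularMultiplicity_le {A : F →L[ℂ] F} (hA : IsCompactOperator A)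
    (X : F →L[ℂ] E) (Y : E →L[ℂ] F) {t : ℝ} (ht : 0 ≤ t) (hXY : 0 < ‖X‖ * ‖Y‖)
    {G : Finset ℝ} (hG : ∀ σ ∈ G, t < σ)
    {H : Finset ℝ} (hH : ∀ σ ∈ H, 0 < σ)
    (hH' : ∀ σ : ℝ, t < ‖X‖ * ‖Y‖ * σ → σ ∉ H → singularMultiplicity A σ = 0) :
    ∑ σ ∈ G, singularMultiplicity (X ∘L A ∘L Y) σ ≤ ∑ σ ∈ H, singularMultiplicity A σ := by
  set T := X ∘L A ∘L Y with hT
  set c := ‖X‖ * ‖Y‖ with hc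
  have hTc : IsCompactOperator T := (hA.comp_clm Y).clm_comp X
  have hfT : ∀ σ : G, FiniteDimensional ℂ (singularSpace T σ) := fun σ =>
    finiteDimensional_singularSpace hTc (ht.trans_lt (hG _ σ.2)).ne'
  have hfA : ∀ σ : H, FiniteDimensional ℂ (singularSpace A σ) := fun σ =>
    finiteDimensional_singularSpace hA (hH _ σ.2).ne'
  rw [← sum_singularMultiplicity T G hfT, ← sum_singularMultiplicity A H hfA]
  set W : Submodule ℂ F := LinearMap.range (singularSum A H) with hWdef
  have hsub : ∀ σ : H, singularSpace A σ ≤ W := by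
    intro σ x hx
    refine ⟨Pi.single σ ⟨x, hx⟩, ?_⟩
    rw [singularSum_apply, Finset.sum_eq_single σ]
    · simp
    · intro τ _ hτ; simp [Pi.single_eq_of_ne hτ]
    · simp
  have hWinv : ∀ x ∈ W, adjoint A (A x) ∈ W := by
    rintro _ ⟨x, rfl⟩
    rw [singularSum_apply, map_sum, map_sum]
    refine Submodule.sum_mem _ fun σ _ => ?_
    rw [mem_singularSpace.1 (x σ).2]
    exact W.smul_mem _ (hsub σ (x σ).2)
  have hWall : ∀ σ : ℝ, t / c < σ → singularSpace A σ ≤ W := by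
    intro σ hσ
    by_cases hm : σ ∈ H
    · exact hsub ⟨σ, hm⟩
    have h0 : 0 < σ := (div_nonneg ht hXY.le).trans_lt hσ
    have h1 := hH' σ (by rw [div_lt_iff₀ hXY] at hσ; linarith) hm
    have := finiteDimensional_singularSpace hA h0.ne'
    rw [← finrank_singularSpace, Submodule.finrank_eq_zero] at h1
    rw [h1]; exact bot_le
  refine le_trans ?_ (LinearMap.finrank_range_le (singularSum A H))
  -- If `P x = 0`, then `Y` sends the vector into `Wᗮ`, where `A` has norm at most `t / c`. Hence
  -- `T` expands it by at most `t`, against the strict lower bound on the span of the singular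
  -- vectors above `t`. So `P` is injective.
  let P : ((σ : G) → singularSpace T σ) →ₗ[ℂ] W :=
    (W.orthogonalProjectionOnto : F →L[ℂ] W).toLinearMap ∘ₗ Y.toLinearMap ∘ₗ singularSum T G
  refine LinearMap.finrank_le_finrank_of_injective (f := P) ?_
  rw [injective_iff_map_eq_zero]
  intro x hx
  by_contra hx0
  have h1 := mul_norm_lt_norm_apply_singularSum ht hG hx0
  have h2 : Y (singularSum T G x) ∈ Wᗮ := Submodule.orthogonalProjectionOnto_eq_zero_iff.1 hx
  have h3 := norm_apply_le_of_mem_orthogonal hA (div_nonneg ht hXY.le) hWinv hWall h2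
  have h4 : ‖T (singularSum T G x)‖ ≤ t * ‖singularSum T G x‖ := by
    calc ‖T (singularSum T G x)‖ ≤ ‖X‖ * ‖A (Y (singularSum T G x))‖ := X.le_opNorm _
      _ ≤ ‖X‖ * (t / c * (‖Y‖ * ‖singularSum T G x‖)) := by
          gcongr
          exact h3.trans (mul_le_mul_of_nonneg_left (Y.le_opNorm _) (div_nonneg ht hXY.le))
      _ = c * (t / c) * ‖singularSum T G x‖ := by rw [hc]; ring
      _ = _ := by rw [mul_div_cancel₀ _ hXY.ne']
  linarith

/-! ### Distribution functions of singular values and Schatten sums. -/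

/-- The measure counting the positive singular values with their multiplicities. -/
noncomputable def singularMeasure (T : E →L[ℂ] E) : Measure (Ioi (0 : ℝ)) :=
  Measure.sum fun σ : Ioi (0 : ℝ) => (singularMultiplicity T σ : ℝ≥0∞) • Measure.dirac σ

theorem schattenSum_eq_lintegral (p : ℝ) (T : E →L[ℂ] E) :
    schattenSum p T = ∫⁻ σ, ENNReal.ofReal ((σ : ℝ) ^ p) ∂(singularMeasure T) := by
  simp [schattenSum, singularMeasure, lintegral_sum_measure, lintegral_smul_measure]

theorem singularMeasure_apply (T : E →L[ℂ] E) {s : Set (Ioi (0 : ℝ))} (hs : MeasurableSet s) :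
    singularMeasure T s = ∑' σ : Ioi (0 : ℝ), (singularMultiplicity T σ : ℝ≥0∞) * s.indicator 1 σ := by
  simp [singularMeasure, Measure.sum_apply _ hs, Measure.dirac_apply' _ hs]

theorem singularMeasure_le {A : F →L[ℂ] F} (hA : IsCompactOperator A)
    (X : F →L[ℂ] E) (Y : E →L[ℂ] F) {t : ℝ} (ht : 0 ≤ t) (hXY : 0 < ‖X‖ * ‖Y‖) :
    singularMeasure (X ∘L A ∘L Y) {σ | t < (σ : ℝ)} ≤
      singularMeasure A {σ | t < ‖X‖ * ‖Y‖ * (σ : ℝ)} := by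
  have hm1 : MeasurableSet {σ : Ioi (0 : ℝ) | t < (σ : ℝ)} :=
    measurableSet_lt measurable_const measurable_subtype_coe
  have hm2 : MeasurableSet {σ : Ioi (0 : ℝ) | t < ‖X‖ * ‖Y‖ * (σ : ℝ)} :=
    measurableSet_lt measurable_const (measurable_subtype_coe.const_mul _)
  rw [singularMeasure_apply _ hm1, singularMeasure_apply _ hm2]
  set f : Ioi (0 : ℝ) → ℝ≥0∞ := fun σ => (singularMultiplicity A σ : ℝ≥0∞) *
    {σ : Ioi (0 : ℝ) | t < ‖X‖ * ‖Y‖ * (σ : ℝ)}.indicator 1 σ with hf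
  by_cases htop : ∑' σ, f σ = ⊤
  · rw [htop]; exact le_top
  -- Multiplicities are integers, so each term of the sum is `0` or at least `1`. A finite sum
  -- leaves only finitely many singular values above the threshold, and these form the set `H`.
  have hfin : {σ | 1 ≤ f σ}.Finite := ENNReal.finite_const_le_of_tsum_ne_top htop one_ne_zero
  classical
  have hsupp : ∀ σ : Ioi (0 : ℝ), σ ∉ hfin.toFinset → t < ‖X‖ * ‖Y‖ * (σ : ℝ) →
      singularMultiplicity A σ = 0 := by
    intro σ hσ hlt
    by_contra hne
    refine hσ (hfin.mem_toFinset.2 ?_)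
    simp only [mem_ofPred_eq, hf]
    rw [indicator_of_mem (by exact hlt)]
    simpa [Nat.one_le_iff_ne_zero] using hne
  refine ENNReal.summable.tsum_le_of_sum_le fun G : Finset (Ioi (0 : ℝ)) => ?_
  set G' : Finset ℝ := (G.filter fun σ : Ioi (0 : ℝ) => t < (σ : ℝ)).image Subtype.val with hG'
  set H : Finset ℝ := hfin.toFinset.image Subtype.val with hH
  have key := sum_singularMultiplicity_le hA X Y ht hXY (G := G') (H := H)
    (by
      intro σ hσ
      simp only [hG', Finset.mem_image, Finset.mem_filter] at hσ
      obtain ⟨a, ha, rfl⟩ := hσ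
      exact ha.2)
    (by
      intro σ hσ
      simp only [hH, Finset.mem_image] at hσ
      obtain ⟨a, _, rfl⟩ := hσ
      exact a.2)
    (by
      intro σ hlt hσ
      have h0 : 0 < σ := by
        by_contra! h
        have := mul_nonpos_of_nonneg_of_nonpos hXY.le h
        linarith
      refine hsupp ⟨σ, h0⟩ (fun hmem => hσ ?_) hlt
      exact Finset.mem_image.2 ⟨_, hmem, rfl⟩)
  rw [hG', hH, Finset.sum_image (Subtype.val_injective.injOn),
    Finset.sum_image (Subtype.val_injective.injOn)] at key
  calc ∑ σ ∈ G, (singularMultiplicity (X ∘L A ∘L Y) σ : ℝ≥0∞) *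
        {σ : Ioi (0 : ℝ) | t < (σ : ℝ)}.indicator 1 σ
      = ((∑ σ ∈ G.filter fun σ : Ioi (0 : ℝ) => t < (σ : ℝ), singularMultiplicity (X ∘L A ∘L Y) σ : ℕ) :
          ℝ≥0∞) := by
        push_cast
        rw [Finset.sum_filter]
        refine Finset.sum_congr rfl fun σ _ => ?_
        simp [indicator_apply]
    _ ≤ ((∑ σ ∈ hfin.toFinset, singularMultiplicity A σ : ℕ) : ℝ≥0∞) := by exact_mod_cast key
    _ = ∑ σ ∈ hfin.toFinset, f σ := by
        push_cast
        refine Finset.sum_congr rfl fun σ hσ => ?_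
        have h1 : 1 ≤ f σ := by simpa using hσ
        simp only [hf] at h1 ⊢
        by_cases hlt : t < ‖X‖ * ‖Y‖ * (σ : ℝ)
        · rw [indicator_of_mem (by exact hlt)]; simp
        · rw [indicator_of_notMem (by exact hlt)] at h1; simp at h1
    _ ≤ ∑' σ, f σ := ENNReal.sum_le_tsum _

/-- The layer cake formula `∫ σ^p = p ∫ t^(p-1) #{σ > t} dt` reduces the claim to
`singularMeasure_le`, uniformly in `p > 0`. -/
theorem schattenSum_comp_le {A : F →L[ℂ] F} (hA : IsCompactOperator A)
    (X : F →L[ℂ] E) (Y : E →L[ℂ] F) {p : ℝ} (hp : 0 < p) :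
    schattenSum p (X ∘L A ∘L Y) ≤ ENNReal.ofReal ((‖X‖ * ‖Y‖) ^ p) * schattenSum p A := by
  -- The counting comparison divides the threshold by `‖X‖ * ‖Y‖`, so the zero product is treated
  -- apart.
  rcases (mul_nonneg (norm_nonneg X) (norm_nonneg Y)).eq_or_lt with h0 | hc
  · have hT : X ∘L A ∘L Y = 0 := by
      rcases mul_eq_zero.1 h0.symm with h | h
      · rw [norm_eq_zero.1 h]; ext; simp
      · rw [norm_eq_zero.1 h]; ext; simp
    have hmul : ∀ σ : Ioi (0 : ℝ), singularMultiplicity (0 : E →L[ℂ] E) σ = 0 := by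
      intro σ
      rw [← finrank_singularSpace]
      have : singularSpace (0 : E →L[ℂ] E) σ = ⊥ := by
        rw [eq_bot_iff]
        intro x hx
        have hx := mem_singularSpace.1 hx
        have h2 : ((σ : ℝ) : ℂ) ^ 2 ≠ 0 := by
          have := (mem_Ioi.1 σ.2).ne'
          simpa using this
        simp only [zero_apply, map_zero] at hx
        simpa [h2] using hx.symm
      rw [this, finrank_bot]
    have : schattenSum p (X ∘L A ∘L Y) = 0 := by
      rw [hT]; simp [schattenSum, hmul]
    rw [this]; exact zero_le
  set c := ‖X‖ * ‖Y‖ with hcdef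
  rw [schattenSum_eq_lintegral, schattenSum_eq_lintegral,
    lintegral_rpow_eq_lintegral_meas_lt_mul (singularMeasure (X ∘L A ∘L Y))
      (f := fun σ : Ioi (0 : ℝ) => (σ : ℝ)) (Eventually.of_forall fun σ => σ.2.le)
      measurable_subtype_coe.aemeasurable hp, ← lintegral_const_mul' (μ := singularMeasure A) _ _ ENNReal.ofReal_ne_top]
  have h1 : ∀ σ : Ioi (0 : ℝ), ENNReal.ofReal (c ^ p) * ENNReal.ofReal ((σ : ℝ) ^ p)
      = ENNReal.ofReal ((c * (σ : ℝ)) ^ p) := by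
    intro σ
    rw [← ENNReal.ofReal_mul (by positivity), Real.mul_rpow hc.le σ.2.le]
  rw [lintegral_congr h1]
  rw [lintegral_rpow_eq_lintegral_meas_lt_mul (singularMeasure A)
      (f := fun σ : Ioi (0 : ℝ) => c * (σ : ℝ))
      (Eventually.of_forall fun σ => mul_nonneg hc.le σ.2.le)
      (measurable_subtype_coe.const_mul _).aemeasurable hp]
  gcongr ENNReal.ofReal p * ?_
  refine setLIntegral_mono' measurableSet_Ioi fun t ht => ?_
  exact mul_le_mul_left (singularMeasure_le hA X Y (le_of_lt ht) hc) _

theorem MemSchatten.comp {A : F →L[ℂ] F} {p : ℝ} (hp : 0 < p) (hA : MemSchatten p A)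
    (X : F →L[ℂ] E) (Y : E →L[ℂ] F) :
    MemSchatten p (X ∘L A ∘L Y) ∧
      schattenNorm p (X ∘L A ∘L Y) ≤ ‖X‖ * ‖Y‖ * schattenNorm p A := by
  have hle := schattenSum_comp_le hA.1 X Y hp
  have hne : ENNReal.ofReal ((‖X‖ * ‖Y‖) ^ p) * schattenSum p A ≠ ⊤ :=
    ENNReal.mul_ne_top ENNReal.ofReal_ne_top hA.2
  refine ⟨⟨(hA.1.comp_clm Y).clm_comp X, ne_top_of_le_ne_top hne hle⟩, ?_⟩
  have h1 := ENNReal.toReal_mono hne hle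
  have hc : 0 ≤ ‖X‖ * ‖Y‖ := by positivity
  rw [ENNReal.toReal_mul, ENNReal.toReal_ofReal (by positivity)] at h1
  calc schattenNorm p (X ∘L A ∘L Y)
      ≤ ((‖X‖ * ‖Y‖) ^ p * (schattenSum p A).toReal) ^ (1 / p) :=
        Real.rpow_le_rpow ENNReal.toReal_nonneg h1 (by positivity)
    _ = _ := by
        rw [Real.mul_rpow (by positivity) ENNReal.toReal_nonneg, ← Real.rpow_mul hc,
          mul_one_div_cancel hp.ne', Real.rpow_one, schattenNorm]

end SingularValues

/-! ### Bilinear pairing, translations and convolutions on `L²(ℝ)` -/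

section Pairing

variable {X : Type*} [MeasurableSpace X] {μ : Measure X}

/-- The bilinear pairing `∫ u v` on `L²(μ)`. -/
noncomputable def lpPair (μ : Measure X) : Lp ℂ 2 μ →L[ℂ] Lp ℂ 2 μ →L[ℂ] ℂ :=
  (ContinuousLinearMap.mul ℂ ℂ).lpPairing μ 2 2

theorem lpPair_apply (u v : Lp ℂ 2 μ) : lpPair μ u v = ∫ x, u x * v x ∂μ := by
  simp [lpPair, lpPairing_eq_integral]

theorem lpPair_comm (u v : Lp ℂ 2 μ) : lpPair μ u v = lpPair μ v u := by
  simp [lpPair_apply, mul_comm]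

/-- Convolution and the Hankel symmetry are bilinear, while adjoints and orthogonality are
sesquilinear. Conjugation passes from one to the other. -/
theorem lpPair_star (u v : Lp ℂ 2 μ) : lpPair μ (star u) v = inner ℂ u v := by
  rw [lpPair_apply, L2.inner_def]
  refine integral_congr_ae ?_
  filter_upwards [Lp.coeFn_star u] with x hx
  rw [hx]
  simp [mul_comm]

theorem inner_star (u v : Lp ℂ 2 μ) : inner ℂ (star u) v = lpPair μ u v := by
  rw [← lpPair_star, star_star]

theorem lp_star_add (u v : Lp ℂ 2 μ) : star (u + v) = star u + star v := by
  apply Lp.ext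
  filter_upwards [Lp.coeFn_star (u + v), Lp.coeFn_star u, Lp.coeFn_star v, Lp.coeFn_add u v,
    Lp.coeFn_add (star u) (star v)] with x h1 h2 h3 h4 h5
  rw [h1, h5, Pi.add_apply, h2, h3, Pi.star_apply, h4, Pi.add_apply, star_add]
  rfl

theorem lp_star_smul (c : ℂ) (u : Lp ℂ 2 μ) : star (c • u) = star c • star u := by
  apply Lp.ext
  filter_upwards [Lp.coeFn_star (c • u), Lp.coeFn_star u, Lp.coeFn_smul c u,
    Lp.coeFn_smul (star c) (star u)] with x h1 h2 h3 h4
  rw [h1, h4, Pi.smul_apply, h2, Pi.star_apply, h3, Pi.smul_apply, smul_eq_mul, smul_eq_mul,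
    star_mul', Pi.star_apply]

theorem lp_norm_star (u : Lp ℂ 2 μ) : ‖star u‖ = ‖u‖ := by
  rw [Lp.norm_def, Lp.norm_def]
  congr 1
  refine eLpNorm_congr_norm_ae ?_
  filter_upwards [Lp.coeFn_star u] with x hx
  simp [hx]

theorem lp_star_sum {ι : Type*} (s : Finset ι) (u : ι → Lp ℂ 2 μ) :
    star (∑ i ∈ s, u i) = ∑ i ∈ s, star (u i) := by
  let f : Lp ℂ 2 μ →+ Lp ℂ 2 μ := AddMonoidHom.mk' star lp_star_add
  exact map_sum f u s

theorem norm_lpPair_le (u v : Lp ℂ 2 μ) : ‖lpPair μ u v‖ ≤ ‖u‖ * ‖v‖ := by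
  rw [← inner_star, ← lp_norm_star u]
  exact norm_inner_le_norm _ _

end Pairing

/-- The Hilbert space `L²(ℝ)`. -/
abbrev LineL2 : Type := Lp ℂ 2 (volume : Measure ℝ)

theorem ae_comp_sub_right {p : ℝ → Prop} (h : ∀ᵐ x : ℝ, p x) (s : ℝ) : ∀ᵐ x : ℝ, p (x - s) :=
  (measurePreserving_sub_right (volume : Measure ℝ) s).quasiMeasurePreserving.ae h

theorem ae_comp_sub_left {p : ℝ → Prop} (h : ∀ᵐ x : ℝ, p x) (s : ℝ) : ∀ᵐ x : ℝ, p (s - x) :=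
  (Measure.measurePreserving_sub_left (volume : Measure ℝ) s).quasiMeasurePreserving.ae h

/-- Translation by `s`. -/
noncomputable def shift (s : ℝ) : LineL2 →ₗᵢ[ℂ] LineL2 :=
  Lp.compMeasurePreservingₗᵢ ℂ (fun x => x - s) (measurePreserving_sub_right volume s)

theorem coeFn_shift (s : ℝ) (u : LineL2) : shift s u =ᵐ[volume] fun x => u (x - s) :=
  Lp.coeFn_compMeasurePreserving u (measurePreserving_sub_right volume s)

/-- Strong continuity of translations gives the measurability behind the Bochner integral in
`convOp`, and makes `lineConv` a continuous function defined at every point. -/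
theorem continuous_shift (u : LineL2) : Continuous fun s => shift s u := by
  have hg : Continuous fun s : ℝ => (⟨fun x => x - s, by fun_prop⟩ : C(ℝ, ℝ)) :=
    ContinuousMap.continuous_of_continuous_uncurry _ (by simp only [Function.uncurry_def]
                                                         exact continuous_snd.sub continuous_fst)
  exact (continuous_const (y := u)).compMeasurePreservingLp hg
    (fun s => measurePreserving_sub_right volume s) ENNReal.ofNat_ne_top

theorem shift_shift (s r : ℝ) (u : LineL2) :
    shift s (shift r u) = shift (s + r) u := by
  apply Lp.ext
  filter_upwards [coeFn_shift s (shift r u), ae_comp_sub_right (coeFn_shift r u) s,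
    coeFn_shift (s + r) u] with x h1 h2 h3
  rw [h1, h2, h3, sub_sub]

theorem lpPair_shift (s : ℝ) (u v : LineL2) :
    lpPair volume (shift s u) v = lpPair volume u (shift (-s) v) := by
  rw [lpPair_apply, lpPair_apply, ← integral_sub_right_eq_self (fun x => u x * shift (-s) v x) s]
  refine integral_congr_ae ?_
  filter_upwards [coeFn_shift s u, ae_comp_sub_right (coeFn_shift (-s) v) s] with x h1 h2
  rw [h1, h2]; congr 2; ring

/-- The reflection `u(x) ↦ u(-x)`. -/
noncomputable def reflect : LineL2 →ₗᵢ[ℂ] LineL2 :=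
  Lp.compMeasurePreservingₗᵢ ℂ (fun x : ℝ => -x) (Measure.measurePreserving_neg volume)

theorem coeFn_reflect (u : LineL2) : reflect u =ᵐ[volume] fun x => u (-x) :=
  Lp.coeFn_compMeasurePreserving u (Measure.measurePreserving_neg volume)

theorem reflect_shift (s : ℝ) (u : LineL2) :
    reflect (shift s u) = shift (-s) (reflect u) := by
  apply Lp.ext
  have h0 : ∀ᵐ x : ℝ, shift s u (-x) = u (-x - s) := by
    simpa using ae_comp_sub_left (coeFn_shift s u) 0
  filter_upwards [coeFn_reflect (shift s u), h0,
    coeFn_shift (-s) (reflect u), ae_comp_sub_right (coeFn_reflect u) (-s)] with x h1 h2 h3 h4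
  rw [h1, h2, h3, h4]; congr 1; ring

/-- The convolution of two functions in `L²(ℝ)`. -/
noncomputable def lineConv (u v : LineL2) (x : ℝ) : ℂ :=
  lpPair volume u (shift x (reflect v))

theorem lineConv_eq_integral (u v : LineL2) (x : ℝ) :
    lineConv u v x = ∫ t, u t * v (x - t) := by
  rw [lineConv, lpPair_apply]
  refine integral_congr_ae ?_
  filter_upwards [coeFn_shift x (reflect v), ae_comp_sub_right (coeFn_reflect v) x]
    with t h1 h2
  rw [h1, h2, neg_sub]

theorem lineConv_comm (u v : LineL2) (x : ℝ) : lineConv u v x = lineConv v u x := by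
  rw [lineConv_eq_integral, lineConv_eq_integral,
    ← integral_sub_left_eq_self (fun t => u t * v (x - t)) volume x]
  simp [mul_comm]

theorem norm_lineConv_le (u v : LineL2) (x : ℝ) : ‖lineConv u v x‖ ≤ ‖u‖ * ‖v‖ := by
  refine (norm_lpPair_le _ _).trans ?_
  rw [LinearIsometry.norm_map, LinearIsometry.norm_map]

theorem lineConv_add_left (u u' v : LineL2) (x : ℝ) :
    lineConv (u + u') v x = lineConv u v x + lineConv u' v x := by simp [lineConv]

theorem lineConv_smul_left (c : ℂ) (u v : LineL2) (x : ℝ) :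
    lineConv (c • u) v x = c * lineConv u v x := by simp [lineConv]

theorem lineConv_add_right (u v v' : LineL2) (x : ℝ) :
    lineConv u (v + v') x = lineConv u v x + lineConv u v' x := by simp [lineConv]

theorem lineConv_smul_right (c : ℂ) (u v : LineL2) (x : ℝ) :
    lineConv u (c • v) x = c * lineConv u v x := by simp [lineConv]

theorem continuous_lineConv (u v : LineL2) : Continuous (lineConv u v) :=
  (lpPair volume u).continuous.comp (continuous_shift _)

theorem lineConv_shift_right (u v : LineL2) (s x : ℝ) :
    lineConv u (shift s v) x = lineConv u v (x - s) := by
  rw [lineConv, reflect_shift, shift_shift, lineConv, sub_eq_add_neg]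

theorem lineConv_shift_left (u v : LineL2) (s x : ℝ) :
    lineConv (shift s u) v x = lineConv u v (x - s) := by
  rw [lineConv_comm, lineConv_shift_right, lineConv_comm]

/-! ### Multiplication operators -/

/-- Multiplication by an essentially bounded function on `L²(ℝ)`. -/
noncomputable def mulOp {m : ℝ → ℂ} (hm : MemLp m ⊤ volume) : LineL2 →L[ℂ] LineL2 :=
  (ContinuousLinearMap.mul ℂ ℂ).holderL volume ⊤ 2 2 (hm.toLp m)

theorem coeFn_mulOp {m : ℝ → ℂ} (hm : MemLp m ⊤ volume) (u : LineL2) :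
    mulOp hm u =ᵐ[volume] fun x => m x * u x := by
  have h : (ContinuousLinearMap.mul ℂ ℂ).holder 2 (hm.toLp m) u =ᵐ[volume] fun x =>
      hm.toLp m x * u x := ContinuousLinearMap.coeFn_holder _ _ _
  refine EventuallyEq.trans h ?_
  filter_upwards [hm.coeFn_toLp] with x hx
  rw [hx]

theorem norm_mulOp_of_norm_eq_one {m : ℝ → ℂ} (hm : MemLp m ⊤ volume)
    (h1 : ∀ᵐ x : ℝ, ‖m x‖ = 1) (u : LineL2) : ‖mulOp hm u‖ = ‖u‖ := by
  rw [Lp.norm_def, Lp.norm_def]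
  congr 1
  refine eLpNorm_congr_norm_ae ?_
  filter_upwards [coeFn_mulOp hm u, h1] with x hx hx1
  rw [hx, norm_mul, hx1, one_mul]

/-! ### Convolution operators -/

section ConvolutionOperator

variable (μ : Measure ℝ) [IsFiniteMeasure μ]

theorem integrable_shift (u : LineL2) : Integrable (fun s => shift s u) μ := by
  refine Integrable.mono' (integrable_const ‖u‖) (continuous_shift u).aestronglyMeasurable ?_
  simp

/-- Convolution with a finite measure as an operator on `L²(ℝ)`. -/
noncomputable def convOp : LineL2 →L[ℂ] LineL2 :=
  LinearMap.mkContinuous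
    { toFun := fun u => ∫ s, shift s u ∂μ
      map_add' := fun u v => by
        simp only [map_add]
        exact integral_add (integrable_shift μ u) (integrable_shift μ v)
      map_smul' := fun c u => by
        simp only [map_smul, RingHom.id_apply]
        exact integral_smul c _ }
    (μ.real univ)
    (fun u => by
      refine (norm_integral_le_integral_norm _).trans ?_
      simp)

theorem norm_convOp_le (u : LineL2) : ‖convOp μ u‖ ≤ μ.real univ * ‖u‖ :=
  LinearMap.mkContinuous_norm_le _ measureReal_nonneg _ |> (convOp μ).le_of_opNorm_le <| u

/-- Bounded operators pass under the Bochner integral. Every later fact about `convOp` is a fact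
about translations integrated in this way. -/
theorem map_convOp {E : Type*} [NormedAddCommGroup E] [NormedSpace ℂ E] [CompleteSpace E]
    (Λ : LineL2 →L[ℂ] E) (u : LineL2) : Λ (convOp μ u) = ∫ s, Λ (shift s u) ∂μ :=
  (Λ.integral_comp_comm (integrable_shift μ u)).symm

theorem commute_convOp {M : LineL2 →L[ℂ] LineL2}
    (hM : ∀ s u, M (shift s u) = shift s (M u)) (u : LineL2) :
    M (convOp μ u) = convOp μ (M u) := by
  exact (map_convOp μ M u).trans (integral_congr_ae (Eventually.of_forall fun s => hM s u))

theorem lineConv_convOp (u v : LineL2) (x : ℝ) :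
    lineConv u (convOp μ v) x = ∫ s, lineConv u v (x - s) ∂μ := by
  have := map_convOp μ (lpPair volume u ∘L (shift x).toContinuousLinearMap ∘L reflect.toContinuousLinearMap) v
  refine this.trans (integral_congr_ae (Eventually.of_forall fun s => ?_))
  exact lineConv_shift_right u v s x

end ConvolutionOperator

/-! ### Functions supported on the half-line -/

/-- The subspace of `L²(ℝ)` of functions supported in `[0, ∞)`. -/
noncomputable def plusSpace : Submodule ℂ LineL2 :=
  LinearMap.ker (LpToLpRestrictCLM ℝ ℂ ℂ volume 2 (Iio 0)).toLinearMap

theorem mem_plusSpace {u : LineL2} : u ∈ plusSpace ↔ ∀ᵐ x : ℝ, x < 0 → u x = 0 := by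
  rw [plusSpace, LinearMap.mem_ker]
  change LpToLpRestrictCLM ℝ ℂ ℂ volume 2 (Iio 0) u = 0 ↔ _
  rw [Lp.eq_zero_iff_ae_eq_zero]
  have h := LpToLpRestrictCLM_coeFn ℂ (p := 2) (Iio (0 : ℝ)) u
  constructor
  · intro h0
    have := (ae_restrict_iff' measurableSet_Iio).1 (h.symm.trans h0)
    filter_upwards [this] with x hx hlt using hx hlt
  · intro h0
    refine h.trans ((ae_restrict_iff' measurableSet_Iio).2 ?_)
    filter_upwards [h0] with x hx hlt using hx hlt

theorem isClosed_plusSpace : IsClosed (plusSpace : Set LineL2) :=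
  (LpToLpRestrictCLM ℝ ℂ ℂ volume 2 (Iio 0)).isClosed_ker

theorem shift_mem_plusSpace {s : ℝ} (hs : 0 ≤ s) {u : LineL2} (hu : u ∈ plusSpace) :
    shift s u ∈ plusSpace := by
  rw [mem_plusSpace] at hu ⊢
  filter_upwards [coeFn_shift s u, ae_comp_sub_right hu s] with x h1 h2 hx
  rw [h1, h2 (by linarith)]

theorem convOp_mem_plusSpace (μ : Measure ℝ) [IsFiniteMeasure μ] (hμ : μ (Iio 0) = 0)
    {u : LineL2} (hu : u ∈ plusSpace) : convOp μ u ∈ plusSpace := by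
  have h := map_convOp μ (LpToLpRestrictCLM ℝ ℂ ℂ volume 2 (Iio 0)) u
  refine LinearMap.mem_ker.2 (h.trans (integral_eq_zero_of_ae ?_))
  have h0 : ∀ᵐ s ∂μ, ¬ s < 0 := by
    rw [ae_iff]; simpa [Iio] using hμ
  filter_upwards [h0] with s hs
  exact LinearMap.mem_ker.1 (shift_mem_plusSpace (not_lt.1 hs) hu)

/-- Restriction of functions from `ℝ` to `(0, ∞)`. -/
noncomputable def restrictPos : LineL2 →L[ℂ] HalfLineL2 :=
  LpToLpRestrictCLM ℝ ℂ ℂ volume 2 (Ioi 0)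

theorem coeFn_restrictPos (u : LineL2) : restrictPos u =ᵐ[volume.restrict (Ioi 0)] u :=
  LpToLpRestrictCLM_coeFn ℂ (p := 2) (Ioi (0 : ℝ)) u

theorem norm_restrictPos_le (u : LineL2) : ‖restrictPos u‖ ≤ ‖u‖ :=
  norm_Lp_toLp_restrict_le (Ioi (0 : ℝ)) u

theorem setIntegral_Ioi_of_mem_plusSpace {u : LineL2} (hu : u ∈ plusSpace) (w : ℝ → ℂ)
    : ∫ x in Ioi (0 : ℝ), w x * u x = ∫ x, w x * u x := by
  rw [← integral_Ici_eq_integral_Ioi]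
  refine setIntegral_eq_integral_of_ae_compl_eq_zero ?_
  filter_upwards [mem_plusSpace.1 hu] with x hx hx'
  rw [hx (by simpa using hx'), mul_zero]

theorem lpPair_restrictPos {u v : LineL2} (hv : v ∈ plusSpace) :
    lpPair (volume.restrict (Ioi 0)) (restrictPos u) (restrictPos v) = lpPair volume u v := by
  rw [lpPair_apply, lpPair_apply, ← setIntegral_Ioi_of_mem_plusSpace hv]
  refine integral_congr_ae ?_
  filter_upwards [coeFn_restrictPos u, coeFn_restrictPos v] with x h1 h2
  rw [h1, h2]

theorem star_restrictPos (u : LineL2) : star (restrictPos u) = restrictPos (star u) := by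
  apply Lp.ext
  filter_upwards [Lp.coeFn_star (restrictPos u), coeFn_restrictPos u, coeFn_restrictPos (star u),
    ae_restrict_of_ae (Lp.coeFn_star u)] with x h1 h2 h3 h4
  simp [h1, h2, h3, h4]

theorem inner_restrictPos {u v : LineL2} (hv : v ∈ plusSpace) :
    inner ℂ (restrictPos u) (restrictPos v) = inner ℂ u v := by
  rw [← lpPair_star, ← lpPair_star, star_restrictPos, lpPair_restrictPos hv]

theorem exists_restrictPos_eq (h : HalfLineL2) : ∃ u ∈ plusSpace, restrictPos u = h := by
  have hm : MemLp ((Ioi (0 : ℝ)).indicator h) 2 volume :=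
    (memLp_indicator_iff_restrict measurableSet_Ioi).2 (Lp.memLp h)
  refine ⟨hm.toLp _, ?_, ?_⟩
  · rw [mem_plusSpace]
    filter_upwards [hm.coeFn_toLp] with x hx h0
    rw [hx, indicator_of_notMem (by simpa using h0.le)]
  · apply Lp.ext
    filter_upwards [coeFn_restrictPos (hm.toLp _), ae_restrict_of_ae hm.coeFn_toLp,
      ae_restrict_mem measurableSet_Ioi] with x h1 h2 h3
    rw [h1, h2, indicator_of_mem h3]

attribute [irreducible] mulOp lpPair shift reflect convOp restrictPos

/-! ### Regularized integrals -/

theorem exists_bound_of_hasCompactSupport {η : ℝ → ℝ} (hη : Continuous η)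
    (hc : HasCompactSupport η) : ∃ M, ∀ t, ‖η t‖ ≤ M :=
  hη.bounded_above_of_compact_support hc

theorem HasCompactSupport.exists_forall_lt_eq_zero {η : ℝ → ℝ} (hc : HasCompactSupport η) :
    ∃ ρ, ∀ t, ρ < t → η t = 0 := by
  obtain ⟨ρ, hρ⟩ := hc.isCompact.isBounded.subset_closedBall (0 : ℝ)
  refine ⟨ρ, fun t ht => ?_⟩
  by_contra hne
  have := hρ (subset_tsupport _ hne)
  rw [mem_closedBall_zero_iff, Real.norm_eq_abs] at this
  linarith [le_abs_self t]

/-- Eventually `x / R` falls where `η = 1` and `x / ε` leaves the support, so the cut-off equals `1`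
exactly. -/
theorem tendsto_cutoff {η : ℝ → ℝ} (hη : HasCompactSupport η) (h1 : ∀ᶠ t in 𝓝 (0 : ℝ), η t = 1)
    {x : ℝ} (hx : 0 < x) :
    ∀ᶠ q : ℝ × ℝ in 𝓝[>] (0 : ℝ) ×ˢ atTop, η (x / q.2) - η (x / q.1) = 1 := by
  have hR : ∀ᶠ q : ℝ × ℝ in 𝓝[>] (0 : ℝ) ×ˢ atTop, η (x / q.2) = 1 := by
    have : Tendsto (fun q : ℝ × ℝ => x / q.2) (𝓝[>] (0 : ℝ) ×ˢ atTop) (𝓝 0) :=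
      (tendsto_const_nhds.div_atTop tendsto_id).comp tendsto_snd
    exact this.eventually h1
  have hE : ∀ᶠ q : ℝ × ℝ in 𝓝[>] (0 : ℝ) ×ˢ atTop, η (x / q.1) = 0 := by
    have h2 : Tendsto (fun q : ℝ × ℝ => x / q.1) (𝓝[>] (0 : ℝ) ×ˢ atTop) atTop := by
      have : Tendsto (fun ε : ℝ => x / ε) (𝓝[>] (0 : ℝ)) atTop := by
        simp only [div_eq_mul_inv]
        exact tendsto_inv_nhdsGT_zero.const_mul_atTop hx
      exact this.comp tendsto_fst
    have h3 : ∀ᶠ t : ℝ in atTop, η t = 0 := by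
      obtain ⟨ρ, hρ⟩ := hη.exists_forall_lt_eq_zero
      filter_upwards [eventually_gt_atTop ρ] with t ht using hρ t ht
    exact h2.eventually h3
  filter_upwards [hR, hE] with q h2 h3
  rw [h2, h3, sub_zero]

theorem hasSmoothIntegral_of_integrableOn {f : ℝ → ℂ} (hf : IntegrableOn f (Ioi 0)) :
    HasSmoothIntegral f (∫ t in Ioi (0 : ℝ), f t) := by
  intro η hη hc h1
  obtain ⟨M, hM⟩ := exists_bound_of_hasCompactSupport hη.continuous hc
  refine tendsto_integral_filter_of_dominated_convergence (fun t => (M + M) * ‖f t‖) ?_ ?_ ?_ ?_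
  · refine Eventually.of_forall fun q => AEStronglyMeasurable.mul ?_ hf.aestronglyMeasurable
    have := hη.continuous
    exact Continuous.aestronglyMeasurable (by fun_prop)
  · refine Eventually.of_forall fun q => Eventually.of_forall fun t => ?_
    rw [norm_mul, Complex.norm_real]
    gcongr
    exact (norm_sub_le _ _).trans (add_le_add (hM _) (hM _))
  · exact hf.norm.const_mul _
  · filter_upwards [ae_restrict_mem measurableSet_Ioi] with t ht
    refine tendsto_nhds_of_eventually_eq ?_
    filter_upwards [tendsto_cutoff hc h1 ht] with q hq
    rw [hq]; simp

/-- The definition quantifies over all cut-offs, so uniqueness rests on the existence of one: a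
smooth bump. -/
theorem HasSmoothIntegral.unique {f : ℝ → ℂ} {I J : ℂ} (hI : HasSmoothIntegral f I)
    (hJ : HasSmoothIntegral f J) : I = J := by
  let η : ContDiffBump (0 : ℝ) := ⟨1, 2, one_pos, one_lt_two⟩
  have h := hI η η.contDiff η.hasCompactSupport η.eventuallyEq_one
  exact tendsto_nhds_unique h (hJ η η.contDiff η.hasCompactSupport η.eventuallyEq_one)

theorem integrableOn_cutoff_mul {a : ℝ → ℂ} (ha : LocallyIntegrableOn a (Ioi 0)) {η : ℝ → ℝ}
    (hη : Continuous η) (hc : HasCompactSupport η) (h1 : ∀ᶠ t in 𝓝 (0 : ℝ), η t = 1)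
    {q : ℝ × ℝ} (hq1 : 0 < q.1) (hq2 : 0 < q.2) :
    IntegrableOn (fun t => ((η (t / q.2) - η (t / q.1) : ℝ) : ℂ) * a t) (Ioi 0) := by
  obtain ⟨δ, hδ, hδ1⟩ := Metric.eventually_nhds_iff.1 h1
  obtain ⟨ρ, hzero⟩ := hc.exists_forall_lt_eq_zero
  -- Below `lo` both dilates of `η` equal `1`, and above `hi` both vanish. The weight therefore
  -- lives on a compact subset of `(0, ∞)`, where `a` is integrable.
  set lo := δ / 2 * min q.1 q.2 with hlo
  set hi := ρ * max q.1 q.2 with hhi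
  have hlo0 : 0 < lo := by positivity
  have hint : IntegrableOn a (Icc lo hi) := by
    refine ha.integrableOn_compact_subset (fun t ht => hlo0.trans_le ht.1) isCompact_Icc
  obtain ⟨M, hM⟩ := exists_bound_of_hasCompactSupport hη hc
  have hint2 : IntegrableOn (fun t => ((η (t / q.2) - η (t / q.1) : ℝ) : ℂ) * a t) (Icc lo hi) := by
    refine Integrable.bdd_mul (c := M + M) hint ?_ ?_
    · exact Continuous.aestronglyMeasurable (by fun_prop)
    · refine Eventually.of_forall fun t => ?_
      rw [Complex.norm_real]
      exact (norm_sub_le _ _).trans (add_le_add (hM _) (hM _))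
  refine hint2.of_forall_sdiff_eq_zero measurableSet_Ioi ?_
  rintro t ⟨ht0, ht⟩
  have ht0 : 0 < t := ht0
  rw [mem_Icc, not_and_or, not_le, not_le] at ht
  rcases ht with ht | ht
  · have h2 : ∀ r : ℝ, 0 < r → min q.1 q.2 ≤ r → η (t / r) = 1 := by
      intro r hr hmin
      apply hδ1
      rw [dist_zero_right, Real.norm_of_nonneg (by positivity), div_lt_iff₀ hr]
      have : δ / 2 * min q.1 q.2 ≤ δ / 2 * r := by gcongr
      nlinarith
    rw [h2 _ hq1 (min_le_left _ _), h2 _ hq2 (min_le_right _ _)]; simp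
  · have h2 : ∀ r : ℝ, 0 < r → r ≤ max q.1 q.2 → η (t / r) = 0 := by
      intro r hr hmax
      rcases le_or_gt 0 ρ with h0 | h0
      · apply hzero
        rw [lt_div_iff₀ hr]
        exact (mul_le_mul_of_nonneg_left hmax h0).trans_lt ht
      · exact hzero _ (h0.trans (by positivity))
    rw [h2 _ hq1 (le_max_left _ _), h2 _ hq2 (le_max_right _ _)]; simp

/-- A smooth compactly supported function is a superposition of characters with an integrable
density. -/
theorem exists_integrable_fourier_density {η : ℝ → ℝ} (hη : ContDiff ℝ ∞ η)
    (hc : HasCompactSupport η) : ∃ h : ℝ → ℂ, Integrable h ∧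
      ∀ x : ℝ, (η x : ℂ) = ∫ ξ, h ξ * Complex.exp (2 * Real.pi * ξ * x * Complex.I) := by
  have hg₁ : HasCompactSupport (Complex.ofRealCLM ∘ η) := hc.comp_left rfl
  have hg₂ : ContDiff ℝ ∞ (Complex.ofRealCLM ∘ η) := by fun_prop
  set ψ : SchwartzMap ℝ ℂ := hg₁.toSchwartzMap hg₂ with hψ
  refine ⟨⇑(𝓕 ψ : SchwartzMap ℝ ℂ), (𝓕 ψ : SchwartzMap ℝ ℂ).integrable, fun x => ?_⟩
  have h1 : (η x : ℂ) = (𝓕⁻ (𝓕 ψ : SchwartzMap ℝ ℂ) : SchwartzMap ℝ ℂ) x := by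
    rw [FourierTransform.fourierInv_fourier_eq]; rfl
  rw [h1, SchwartzMap.fourierInv_coe, Real.fourierInv_eq']
  refine integral_congr_ae (Eventually.of_forall fun ξ => ?_)
  simp only [RCLike.inner_apply, conj_trivial, smul_eq_mul]
  rw [mul_comm]
  congr 2
  push_cast; ring

/-! ### Test functions on the half-line -/

/-- Continuous functions with compact support in `(0, ∞)`. -/
def IsTest (f : ℝ → ℂ) : Prop := Continuous f ∧ HasCompactSupport f ∧ tsupport f ⊆ Ioi 0

theorem IsTest.eq_zero {f : ℝ → ℂ} (hf : IsTest f) {x : ℝ} (hx : x ≤ 0) : f x = 0 := by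
  by_contra h
  exact absurd (hf.2.2 (subset_tsupport _ h)) (not_lt.2 hx)

theorem IsTest.add {f g : ℝ → ℂ} (hf : IsTest f) (hg : IsTest g) : IsTest (f + g) :=
  ⟨hf.1.add hg.1, hf.2.1.add hg.2.1,
    (tsupport_add f g).trans (union_subset hf.2.2 hg.2.2)⟩

theorem IsTest.mul_left {f g : ℝ → ℂ} (hf : IsTest f) (hg : Continuous g) : IsTest (g * f) :=
  ⟨hg.mul hf.1, hf.2.1.mul_left, (tsupport_mul_subset_right).trans hf.2.2⟩

theorem IsTest.comp_sub {f : ℝ → ℂ} (hf : IsTest f) {s : ℝ} (hs : 0 ≤ s) :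
    IsTest fun x => f (x - s) := by
  have h : (fun x => f (x - s)) = f ∘ (Homeomorph.subRight s) := rfl
  refine ⟨hf.1.comp (continuous_id.sub continuous_const), ?_, ?_⟩
  · rw [h]; exact hf.2.1.comp_homeomorph _
  · rw [h, tsupport_comp_eq_preimage]
    intro x hx
    have : 0 < x - s := hf.2.2 hx
    exact mem_Ioi.2 (by linarith)

/-- The classes of test functions in `L²(ℝ)`. -/
def testSpace : Submodule ℂ LineL2 where
  carrier := {u | ∃ f, IsTest f ∧ u =ᵐ[volume] f}
  add_mem' := by
    rintro u v ⟨f, hf, huf⟩ ⟨g, hg, hvg⟩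
    exact ⟨f + g, hf.add hg, (Lp.coeFn_add u v).trans (huf.add hvg)⟩
  zero_mem' := ⟨0, ⟨continuous_const, HasCompactSupport.zero, by simp⟩, Lp.coeFn_zero _ _ _⟩
  smul_mem' := by
    rintro c u ⟨f, hf, huf⟩
    refine ⟨(fun _ => c) * f, hf.mul_left continuous_const, ?_⟩
    filter_upwards [Lp.coeFn_smul c u, huf] with x h1 h2
    simp [h1, h2]

theorem testSpace_le_plusSpace : testSpace ≤ plusSpace := by
  rintro u ⟨f, hf, huf⟩
  rw [mem_plusSpace]
  filter_upwards [huf] with x hx h0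
  rw [hx, hf.eq_zero h0.le]

theorem shift_mem_testSpace {u : LineL2} (hu : u ∈ testSpace) {s : ℝ} (hs : 0 ≤ s) :
    shift s u ∈ testSpace := by
  obtain ⟨f, hf, huf⟩ := hu
  exact ⟨_, hf.comp_sub hs, (coeFn_shift s u).trans (ae_comp_sub_right huf s)⟩

/-- The component of `u` orthogonal to the closure of the test functions integrates to zero against
every smooth test function on `(0, ∞)`, hence vanishes almost everywhere there. It vanishes on the
negative half-line because `u` and its projection do. -/
theorem plusSpace_le_closure : (plusSpace : Set LineL2) ⊆ closure (testSpace : Set LineL2) := by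
  intro u hu
  set K := testSpace.topologicalClosure with hK
  have hKc : IsClosed (K : Set LineL2) := testSpace.isClosed_topologicalClosure
  have : CompleteSpace K := hKc.completeSpace_coe
  have hKp : K ≤ plusSpace := testSpace.topologicalClosure_minimal testSpace_le_plusSpace
    isClosed_plusSpace
  obtain ⟨d, hd, w, hw, rfl⟩ := K.exists_add_mem_mem_orthogonal u
  have hwp : w ∈ plusSpace := by
    have := plusSpace.sub_mem hu (hKp hd)
    rwa [add_sub_cancel_left] at this
  have hw0 : w = 0 := by
    rw [Lp.eq_zero_iff_ae_eq_zero]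
    have hloc : LocallyIntegrable w volume := (Lp.memLp w).locallyIntegrable (by norm_num)
    have h1 : ∀ᵐ x : ℝ, x ∈ Ioi (0 : ℝ) → w x = 0 := by
      refine isOpen_Ioi.ae_eq_zero_of_integral_contDiff_smul_eq_zero (hloc.locallyIntegrableOn _) ?_
      intro g hg hgc hgs
      have hgt : IsTest fun x => (g x : ℂ) := by
        refine ⟨Complex.continuous_ofReal.comp hg.continuous,
          hgc.comp_left (g := fun x : ℝ => (x : ℂ)) Complex.ofReal_zero, ?_⟩
        refine (closure_mono ?_).trans hgs
        intro x hx
        simpa using hx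
      have hm : MemLp (fun x => (g x : ℂ)) 2 volume :=
        hgt.1.memLp_of_hasCompactSupport hgt.2.1
      have h2 : inner ℂ (hm.toLp _) w = 0 :=
        (Submodule.mem_orthogonal _ _).1 hw _
          (testSpace.le_topologicalClosure ⟨_, hgt, hm.coeFn_toLp⟩)
      rw [L2.inner_def] at h2
      rw [← h2]
      refine integral_congr_ae ?_
      filter_upwards [hm.coeFn_toLp] with x hx
      rw [hx]
      simp [mul_comm]
    have h3 : ∀ᵐ x : ℝ, x ≠ 0 := by
      simp [ae_iff]
    filter_upwards [h1, mem_plusSpace.1 hwp, h3] with x hx1 hx2 hx3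
    rcases lt_or_gt_of_ne hx3 with h | h
    · exact hx2 h
    · exact hx1 h
  rw [hw0, add_zero]
  exact hd

/-! ### The bilinear form of an integral Hankel operator -/

/-- The bilinear form `∫₀^∞ (A u)(t) v(t) dt`. -/
noncomputable def halfLineForm (A : HalfLineL2 →L[ℂ] HalfLineL2) : LineL2 →L[ℂ] LineL2 →L[ℂ] ℂ :=
  (lpPair (volume.restrict (Ioi 0))).bilinearComp (A ∘L restrictPos) restrictPos

theorem halfLineForm_apply (A : HalfLineL2 →L[ℂ] HalfLineL2) (u v : LineL2) :
    halfLineForm A u v = lpPair (volume.restrict (Ioi 0)) (A (restrictPos u)) (restrictPos v) := rfl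

theorem norm_halfLineForm_le (A : HalfLineL2 →L[ℂ] HalfLineL2) (u v : LineL2) :
    ‖halfLineForm A u v‖ ≤ ‖A‖ * (‖u‖ * ‖v‖) := by
  rw [halfLineForm_apply, ← mul_assoc]
  refine (norm_lpPair_le _ _).trans ?_
  gcongr
  · exact (A.le_opNorm _).trans (by gcongr; exact norm_restrictPos_le u)
  · exact norm_restrictPos_le v

attribute [irreducible] halfLineForm

section TestFunctions

variable {a : ℝ → ℂ} {A : HalfLineL2 →L[ℂ] HalfLineL2}

theorem lineConv_eq_of_ae {u v : LineL2} {f g : ℝ → ℂ} (hu : u =ᵐ[volume] f)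
    (hv : v =ᵐ[volume] g) (x : ℝ) : lineConv u v x = ∫ t, g t * f (x - t) := by
  rw [lineConv_comm, lineConv_eq_integral]
  refine integral_congr_ae ?_
  filter_upwards [hv, ae_comp_sub_left hu x] with t h1 h2
  rw [h1, h2]

/-- The set `K` is the sum of the two supports. Only the values of `a` on `K` matter, so `a` may be
truncated to an integrable function. -/
theorem exists_compact_support_conv {f g : ℝ → ℂ} (hf : IsTest f) (hg : IsTest g) :
    ∃ K : Set ℝ, IsCompact K ∧ K ⊆ Ioi 0 ∧ ∀ s t, f s ≠ 0 → g t ≠ 0 → t + s ∈ K := by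
  refine ⟨(fun p : ℝ × ℝ => p.1 + p.2) '' (tsupport g ×ˢ tsupport f),
    (hg.2.1.isCompact.prod hf.2.1.isCompact).image (by fun_prop), ?_, ?_⟩
  · rintro _ ⟨p, ⟨h1, h2⟩, rfl⟩
    exact add_pos (mem_Ioi.1 (hg.2.2 h1)) (mem_Ioi.1 (hf.2.2 h2))
  · intro s t hs ht
    exact ⟨(t, s), ⟨subset_tsupport _ ht, subset_tsupport _ hs⟩, rfl⟩

theorem integrableOn_mul_lineConv (ha : LocallyIntegrableOn a (Ioi 0)) {u v : LineL2}
    (hu : u ∈ testSpace) (hv : v ∈ testSpace) :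
    IntegrableOn (fun x => a x * lineConv u v x) (Ioi 0) := by
  obtain ⟨f, hf, huf⟩ := hu
  obtain ⟨g, hg, hvg⟩ := hv
  obtain ⟨K, hK, hK0, hKs⟩ := exists_compact_support_conv hf hg
  have h1 : IntegrableOn (fun x => a x * lineConv u v x) K := by
    refine Integrable.mul_bdd (c := ‖u‖ * ‖v‖) (ha.integrableOn_compact_subset hK0 hK) ?_ ?_
    · exact (continuous_lineConv u v).aestronglyMeasurable
    · exact Eventually.of_forall fun x => norm_lineConv_le u v x
  refine h1.of_forall_sdiff_eq_zero measurableSet_Ioi ?_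
  rintro x ⟨-, hx⟩
  have : lineConv u v x = 0 := by
    rw [lineConv_eq_of_ae huf hvg]
    refine integral_eq_zero_of_ae (Eventually.of_forall fun t => ?_)
    by_contra hne
    have hne' := mul_ne_zero_iff.1 hne
    have := hKs (x - t) t hne'.2 hne'.1
    rw [add_sub_cancel] at this
    exact hx this
  rw [this, mul_zero]

/-- Substitute `x = t + s` in the double integral and apply Fubini. The truncation of `a` to `K`
provides the integrability. -/
theorem halfLineForm_eq_integral (ha : LocallyIntegrableOn a (Ioi 0)) (hA : IsIntegralHankel a A)
    {u v : LineL2} (hu : u ∈ testSpace) (hv : v ∈ testSpace) :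
    halfLineForm A u v = ∫ x in Ioi (0 : ℝ), a x * lineConv u v x := by
  obtain ⟨f, hf, huf⟩ := hu
  obtain ⟨g, hg, hvg⟩ := hv
  obtain ⟨K, hK, hK0, hKs⟩ := exists_compact_support_conv hf hg
  set b : ℝ → ℂ := K.indicator a with hb
  have hbint : Integrable b :=
    (integrable_indicator_iff hK.measurableSet).2 (ha.integrableOn_compact_subset hK0 hK)
  have h1 : halfLineForm A u v
      = ∫ t in Ioi (0 : ℝ), (∫ s in Ioi (0 : ℝ), a (t + s) * f s) * g t := by
    rw [halfLineForm_apply, lpPair_apply]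
    refine integral_congr_ae ?_
    have h2 := hA f hf.1 hf.2.1 hf.2.2 (restrictPos u)
      ((coeFn_restrictPos u).trans (ae_restrict_of_ae huf))
    filter_upwards [h2, coeFn_restrictPos v, ae_restrict_of_ae hvg] with t h3 h4 h5
    rw [h3, h4, h5]
  have h2 : ∀ t, (∫ s in Ioi (0 : ℝ), a (t + s) * f s) * g t
      = ∫ x, b x * f (x - t) * g t := by
    intro t
    rw [integral_mul_const]
    by_cases hgt : g t = 0
    · rw [hgt, mul_zero, mul_zero]
    congr 1
    rw [setIntegral_eq_integral_of_forall_compl_eq_zero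
      (fun s hs => by rw [hf.eq_zero (not_lt.1 hs), mul_zero]),
      ← integral_add_left_eq_self (fun x => b x * f (x - t)) t]
    refine integral_congr_ae (Eventually.of_forall fun s => ?_)
    simp only [add_sub_cancel_left]
    by_cases hfs : f s = 0
    · rw [hfs, mul_zero, mul_zero]
    · rw [hb, indicator_of_mem (hKs s t hfs hgt)]
  have h3 : halfLineForm A u v = ∫ t, ∫ x, b x * f (x - t) * g t := by
    rw [h1, setIntegral_eq_integral_of_forall_compl_eq_zero
      (fun t ht => by rw [hg.eq_zero (not_lt.1 ht), mul_zero])]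
    exact integral_congr_ae (Eventually.of_forall h2)
  obtain ⟨M, hM⟩ := hf.1.bounded_above_of_compact_support hf.2.1
  have hgint : Integrable g := hg.1.integrable_of_hasCompactSupport hg.2.1
  have hI : Integrable (Function.uncurry fun t x => b x * f (x - t) * g t)
      (volume.prod volume) := by
    have h4 : Integrable (fun p : ℝ × ℝ => f (p.2 - p.1) * (g p.1 * b p.2))
        (volume.prod volume) := by
      refine Integrable.bdd_mul (c := M) (hgint.mul_prod hbint) ?_ ?_
      · have := hf.1
        exact Continuous.aestronglyMeasurable (by fun_prop)
      · exact Eventually.of_forall fun p => hM _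
    refine h4.congr (Eventually.of_forall fun p => ?_)
    simp only [Function.uncurry]
    ring
  rw [h3, integral_integral_swap hI]
  have h5 : ∀ x, ∫ t, b x * f (x - t) * g t = b x * lineConv u v x := by
    intro x
    rw [lineConv_eq_of_ae huf hvg, ← integral_const_mul]
    refine integral_congr_ae (Eventually.of_forall fun t => ?_)
    ring
  rw [integral_congr_ae (Eventually.of_forall h5)]
  have h6 : ∀ x, x ∉ K → lineConv u v x = 0 := by
    intro x hx
    rw [lineConv_eq_of_ae huf hvg]
    refine integral_eq_zero_of_ae (Eventually.of_forall fun t => ?_)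
    by_contra hne
    have hne' := mul_ne_zero_iff.1 hne
    have := hKs (x - t) t hne'.2 hne'.1
    rw [add_sub_cancel] at this
    exact hx this
  rw [setIntegral_eq_integral_of_forall_compl_eq_zero
    (fun x hx => by rw [h6 x fun h => hx (hK0 h), mul_zero])]
  refine integral_congr_ae (Eventually.of_forall fun x => ?_)
  by_cases hx : x ∈ K
  · simp only [hb, indicator_of_mem hx]
  · simp only [h6 x hx, mul_zero]

/-- The form depends on `u` and `v` only through `u ∗ v`, which is translated in the same way
whichever factor is shifted. -/
theorem halfLineForm_shift_of_mem_testSpace (ha : LocallyIntegrableOn a (Ioi 0))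
    (hA : IsIntegralHankel a A) {u v : LineL2} (hu : u ∈ testSpace) (hv : v ∈ testSpace)
    {s : ℝ} (hs : 0 ≤ s) : halfLineForm A (shift s u) v = halfLineForm A u (shift s v) := by
  rw [halfLineForm_eq_integral ha hA (shift_mem_testSpace hu hs) hv,
    halfLineForm_eq_integral ha hA hu (shift_mem_testSpace hv hs)]
  simp [lineConv_shift_left, lineConv_shift_right]

theorem eq_bilinear_of_closure {E : Type*} [NormedAddCommGroup E] [NormedSpace ℂ E]
    {B B' : E →L[ℂ] E →L[ℂ] ℂ} {S : Submodule ℂ E} (h : ∀ u ∈ S, ∀ v ∈ S, B u v = B' u v)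
    {u v : E} (hu : u ∈ closure (S : Set E)) (hv : v ∈ closure (S : Set E)) : B u v = B' u v := by
  have hcl : IsClosed {p : E × E | B p.1 p.2 = B' p.1 p.2} :=
    isClosed_eq B.continuous₂ B'.continuous₂
  have hsub : (S : Set E) ×ˢ (S : Set E) ⊆ {p : E × E | B p.1 p.2 = B' p.1 p.2} :=
    fun p hp => h _ hp.1 _ hp.2
  have := hcl.closure_subset_iff.2 hsub
  rw [closure_prod_eq] at this
  exact this (mk_mem_prod hu hv)

/-- The defining symmetry of Hankel operators. -/
theorem halfLineForm_shift (ha : LocallyIntegrableOn a (Ioi 0))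
    (hA : IsIntegralHankel a A) {u v : LineL2} (hu : u ∈ plusSpace) (hv : v ∈ plusSpace)
    {s : ℝ} (hs : 0 ≤ s) : halfLineForm A (shift s u) v = halfLineForm A u (shift s v) := by
  exact eq_bilinear_of_closure (S := testSpace)
    (B := halfLineForm A ∘L (shift s).toContinuousLinearMap)
    (B' := (halfLineForm A).bilinearComp (.id ℂ LineL2) (shift s).toContinuousLinearMap)
    (fun u hu v hv => halfLineForm_shift_of_mem_testSpace ha hA hu hv hs)
    (plusSpace_le_closure hu) (plusSpace_le_closure hv)

theorem halfLineForm_convOp (ha : LocallyIntegrableOn a (Ioi 0))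
    (hA : IsIntegralHankel a A) {u v : LineL2} (hu : u ∈ plusSpace) (hv : v ∈ plusSpace)
    (μ : Measure ℝ) [IsFiniteMeasure μ] (hμ : μ (Iio 0) = 0) :
    halfLineForm A (convOp μ u) v = halfLineForm A u (convOp μ v) := by
  have h1 := map_convOp μ ((halfLineForm A).flip v) u
  have h2 := map_convOp μ (halfLineForm A u) v
  refine h1.trans (Eq.trans (integral_congr_ae ?_) h2.symm)
  have h0 : ∀ᵐ s ∂μ, ¬ s < 0 := by
    rw [ae_iff]; simpa [Iio] using hμ
  filter_upwards [h0] with s hs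
  exact halfLineForm_shift ha hA hu hv (not_lt.1 hs)

/-! ### Modulations, uniform bounds for cut-off forms, and convergence of the regularized integrals.
-/

/-- Multiplication by the character `x ↦ exp(iθx)`. -/
noncomputable def modulation (θ : ℝ) : ℝ → ℂ := fun x => Complex.exp (θ * x * Complex.I)

theorem continuous_modulation (θ : ℝ) : Continuous (modulation θ) := by
  unfold modulation; fun_prop

theorem norm_modulation (θ x : ℝ) : ‖modulation θ x‖ = 1 := by
  rw [modulation, ← Complex.ofReal_mul, Complex.norm_exp_ofReal_mul_I]

theorem memLp_modulation (θ : ℝ) : MemLp (modulation θ) ⊤ volume :=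
  memLp_top_of_bound (continuous_modulation θ).aestronglyMeasurable 1
    (Eventually.of_forall fun x => (norm_modulation θ x).le)

/-- The modulation of a function in `L²(ℝ)`. -/
noncomputable def modulate (θ : ℝ) : LineL2 →L[ℂ] LineL2 := mulOp (memLp_modulation θ)

theorem coeFn_modulate (θ : ℝ) (u : LineL2) :
    modulate θ u =ᵐ[volume] fun x => modulation θ x * u x :=
  coeFn_mulOp _ u

theorem norm_modulate (θ : ℝ) (u : LineL2) : ‖modulate θ u‖ = ‖u‖ :=
  norm_mulOp_of_norm_eq_one _ (Eventually.of_forall (norm_modulation θ)) u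

theorem lineConv_modulate (θ : ℝ) (u v : LineL2) (x : ℝ) :
    lineConv (modulate θ u) (modulate θ v) x = modulation θ x * lineConv u v x := by
  rw [lineConv_eq_integral, lineConv_eq_integral, ← integral_const_mul]
  refine integral_congr_ae ?_
  filter_upwards [coeFn_modulate θ u, ae_comp_sub_left (coeFn_modulate θ v) x] with t h1 h2
  have h3 : modulation θ x = modulation θ t * modulation θ (x - t) := by
    simp only [modulation]
    rw [← Complex.exp_add]; congr 1; push_cast; ring
  rw [h1, h2, h3]; ring

theorem modulate_mem_testSpace (θ : ℝ) {u : LineL2} (hu : u ∈ testSpace) :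
    modulate θ u ∈ testSpace := by
  obtain ⟨f, hf, huf⟩ := hu
  refine ⟨modulation θ * f, hf.mul_left (continuous_modulation θ), ?_⟩
  filter_upwards [coeFn_modulate θ u, huf] with x h1 h2
  rw [h1, h2, Pi.mul_apply]

/-- Expanding `η(x / r)` in characters turns the integral into an average, with density `h`, of the
form evaluated at equally modulated `u` and `v`. Modulation is isometric, so the bound does not
depend on `r`; this uniformity is the whole point. -/
theorem norm_integral_dilation_le (ha : LocallyIntegrableOn a (Ioi 0)) (hA : IsIntegralHankel a A)
    {u v : LineL2} (hu : u ∈ testSpace) (hv : v ∈ testSpace) {η : ℝ → ℝ} {h : ℝ → ℂ}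
    (hh : Integrable h)
    (hηh : ∀ x : ℝ, (η x : ℂ) = ∫ ξ, h ξ * Complex.exp (2 * Real.pi * ξ * x * Complex.I)) (r : ℝ) :
    ‖∫ x in Ioi (0 : ℝ), (η (x / r) : ℂ) * (a x * lineConv u v x)‖
      ≤ (∫ ξ, ‖h ξ‖) * (‖A‖ * (‖u‖ * ‖v‖)) := by
  set c : ℝ → ℂ := fun x => a x * lineConv u v x with hc
  have hci : IntegrableOn c (Ioi 0) := integrableOn_mul_lineConv ha hu hv
  have h1 : ∀ x, (η (x / r) : ℂ) * c x
      = ∫ ξ, h ξ * (modulation (2 * Real.pi * ξ / r) x * c x) := by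
    intro x
    rw [hηh, ← integral_mul_const]
    refine integral_congr_ae (Eventually.of_forall fun ξ => ?_)
    simp only [modulation]
    rw [mul_assoc]
    congr 3
    push_cast; ring
  have hI : Integrable (Function.uncurry fun x ξ =>
      h ξ * (modulation (2 * Real.pi * ξ / r) x * c x)) ((volume.restrict (Ioi 0)).prod volume) := by
    have h4 : Integrable (fun p : ℝ × ℝ => modulation (2 * Real.pi * p.2 / r) p.1 * (c p.1 * h p.2))
        ((volume.restrict (Ioi 0)).prod volume) := by
      refine Integrable.bdd_mul (c := 1) (hci.mul_prod hh) ?_ ?_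
      · unfold modulation
        exact Continuous.aestronglyMeasurable (by fun_prop)
      · exact Eventually.of_forall fun p => (norm_modulation _ _).le
    refine h4.congr (Eventually.of_forall fun p => ?_)
    simp only [Function.uncurry]
    ring
  rw [integral_congr_ae (Eventually.of_forall h1), integral_integral_swap hI]
  have h5 : ∀ ξ, ∫ x in Ioi (0 : ℝ), h ξ * (modulation (2 * Real.pi * ξ / r) x * c x)
      = h ξ * halfLineForm A (modulate (2 * Real.pi * ξ / r) u)
        (modulate (2 * Real.pi * ξ / r) v) := by
    intro ξ
    rw [integral_const_mul, halfLineForm_eq_integral ha hA (modulate_mem_testSpace _ hu)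
      (modulate_mem_testSpace _ hv)]
    congr 1
    refine integral_congr_ae (Eventually.of_forall fun x => ?_)
    simp only [lineConv_modulate, hc]
    ring
  rw [integral_congr_ae (Eventually.of_forall h5), ← integral_mul_const]
  refine norm_integral_le_of_norm_le (hh.norm.mul_const _) (Eventually.of_forall fun ξ => ?_)
  rw [norm_mul]
  gcongr
  refine (norm_halfLineForm_le A _ _).trans ?_
  rw [norm_modulate, norm_modulate]

/-- The bilinear form `∫₀^∞ w (u ∗ v)` for an integrable weight `w`. -/
theorem exists_weighted_form {w : ℝ → ℂ} (hw : IntegrableOn w (Ioi 0)) :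
    ∃ G : LineL2 →L[ℂ] LineL2 →L[ℂ] ℂ, ∀ u v,
      G u v = ∫ x in Ioi (0 : ℝ), w x * lineConv u v x := by
  have hI : ∀ u v : LineL2, IntegrableOn (fun x => w x * lineConv u v x) (Ioi 0) := fun u v =>
    Integrable.mul_bdd (c := ‖u‖ * ‖v‖) hw (continuous_lineConv u v).aestronglyMeasurable
      (Eventually.of_forall fun x => norm_lineConv_le u v x)
  refine ⟨LinearMap.mkContinuous₂ (LinearMap.mk₂ ℂ
    (fun u v => ∫ x in Ioi (0 : ℝ), w x * lineConv u v x) ?_ ?_ ?_ ?_)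
    (∫ x in Ioi (0 : ℝ), ‖w x‖) ?_, fun u v => rfl⟩
  · intro u u' v
    rw [← integral_add (hI u v) (hI u' v)]
    simp [lineConv_add_left, mul_add]
  · intro c u v
    rw [smul_eq_mul, ← integral_const_mul]
    simp [lineConv_smul_left, mul_left_comm]
  · intro u v v'
    rw [← integral_add (hI u v) (hI u v')]
    simp [lineConv_add_right, mul_add]
  · intro c u v
    rw [smul_eq_mul, ← integral_const_mul]
    simp [lineConv_smul_right, mul_left_comm]
  · intro u v
    rw [mul_assoc, ← integral_mul_const]
    refine norm_integral_le_of_norm_le (hw.norm.mul_const _) (Eventually.of_forall fun x => ?_)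
    rw [norm_mul]
    gcongr
    exact norm_lineConv_le u v x

/-- Uniformly bounded bilinear forms which converge on a subspace converge on its closure. -/
theorem tendsto_bilinear_of_closure {ι E : Type*} [NormedAddCommGroup E] [NormedSpace ℂ E]
    {l : Filter ι} {F : ι → E → E → ℂ} {B : E →L[ℂ] E →L[ℂ] ℂ} {S : Submodule ℂ E} {K : ℝ}
    (hF : ∀ᶠ i in l, ∃ G : E →L[ℂ] E →L[ℂ] ℂ, (∀ u v, F i u v = G u v) ∧
      ∀ u ∈ S, ∀ v ∈ S, ‖G u v‖ ≤ K * (‖u‖ * ‖v‖))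
    (hS : ∀ u ∈ S, ∀ v ∈ S, Tendsto (fun i => F i u v) l (𝓝 (B u v)))
    {u v : E} (hu : u ∈ closure (S : Set E)) (hv : v ∈ closure (S : Set E)) :
    Tendsto (fun i => F i u v) l (𝓝 (B u v)) := by
  obtain ⟨us, hus, hul⟩ := mem_closure_iff_seq_limit.1 hu
  obtain ⟨vs, hvs, hvl⟩ := mem_closure_iff_seq_limit.1 hv
  -- `L` bounds `G - B` on the closure of `S` for every admissible `G`. One approximation `(us n, vs
  -- n)` thus serves all indices `i` at once.
  set L := |K| + ‖B‖ with hL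
  have hc : Tendsto (fun n => L * (‖u - us n‖ * ‖v‖) + L * (‖us n‖ * ‖v - vs n‖)) atTop (𝓝 0) := by
    have h1 : Tendsto (fun n => ‖u - us n‖) atTop (𝓝 0) := by
      simpa using (tendsto_const_nhds.sub hul).norm (a := u - u)
    have h2 : Tendsto (fun n => ‖v - vs n‖) atTop (𝓝 0) := by
      simpa using (tendsto_const_nhds.sub hvl).norm (a := v - v)
    have := ((h1.mul_const ‖v‖).const_mul L).add (((hul.norm).mul h2).const_mul L)
    simpa using this
  rw [Metric.tendsto_nhds]
  intro ε hε
  obtain ⟨n, hn⟩ := (hc.eventually (gt_mem_nhds (half_pos hε))).exists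
  filter_upwards [hF, Metric.tendsto_nhds.1 (hS _ (hus n) _ (hvs n)) (ε / 2) (half_pos hε)]
    with i ⟨G, hG, hGb⟩ hi
  rw [dist_eq_norm, hG] at hi ⊢
  have hcl : ∀ p ∈ closure (S : Set E) ×ˢ closure (S : Set E),
      ‖G p.1 p.2 - B p.1 p.2‖ ≤ L * (‖p.1‖ * ‖p.2‖) := by
    have hclosed : IsClosed {p : E × E | ‖G p.1 p.2 - B p.1 p.2‖ ≤ L * (‖p.1‖ * ‖p.2‖)} := by
      have h1 := G.continuous₂
      have h2 := B.continuous₂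
      refine isClosed_le ((h1.sub h2).norm) (by fun_prop)
    rw [← closure_prod_eq]
    refine fun p hp => hclosed.closure_subset_iff.2 ?_ hp
    rintro ⟨p, q⟩ ⟨hp, hq⟩
    simp only [mem_ofPred_eq]
    refine (norm_sub_le _ _).trans ?_
    rw [hL, add_mul]
    refine add_le_add ((hGb p hp q hq).trans ?_) ?_
    · gcongr; exact le_abs_self K
    · rw [← mul_assoc]; exact B.le_opNorm₂ p q
  have hSc : (S : Set E) ⊆ closure S := subset_closure
  have hu' : u - us n ∈ closure (S : Set E) :=
    S.topologicalClosure.sub_mem hu (hSc (hus n))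
  have hv' : v - vs n ∈ closure (S : Set E) :=
    S.topologicalClosure.sub_mem hv (hSc (hvs n))
  have e1 := hcl (u - us n, v) ⟨hu', hv⟩
  have e2 := hcl (us n, v - vs n) ⟨hSc (hus n), hv'⟩
  have hdec : G u v - B u v = (G (u - us n) v - B (u - us n) v)
      + (G (us n) (v - vs n) - B (us n) (v - vs n))
      + (G (us n) (vs n) - B (us n) (vs n)) := by
    simp only [map_sub, sub_apply]; ring
  rw [hdec]
  calc _ ≤ ‖G (u - us n) v - B (u - us n) v‖ + ‖G (us n) (v - vs n) - B (us n) (v - vs n)‖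
        + ‖G (us n) (vs n) - B (us n) (vs n)‖ := norm_add₃_le
    _ < ε := by linarith

/-- Continuity of `G` comes from integrability of the cut-off kernel, with a norm that may depend on
`q`. The bound on test functions does not depend on `q`; its factor `2` counts the two dilates of
`η`. -/
theorem exists_cutoff_form (ha : LocallyIntegrableOn a (Ioi 0)) (hA : IsIntegralHankel a A)
    {η : ℝ → ℝ} {h : ℝ → ℂ} (hη : Continuous η) (hc : HasCompactSupport η)
    (h1 : ∀ᶠ t in 𝓝 (0 : ℝ), η t = 1) (hh : Integrable h)
    (hηh : ∀ x : ℝ, (η x : ℂ) = ∫ ξ, h ξ * Complex.exp (2 * Real.pi * ξ * x * Complex.I))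
    {q : ℝ × ℝ} (hq1 : 0 < q.1) (hq2 : 0 < q.2) :
    ∃ G : LineL2 →L[ℂ] LineL2 →L[ℂ] ℂ,
      (∀ u v, ∫ t in Ioi (0 : ℝ), ((η (t / q.2) - η (t / q.1) : ℝ) : ℂ) *
        (a t * lineConv u v t) = G u v) ∧
      ∀ u ∈ testSpace, ∀ v ∈ testSpace, ‖G u v‖ ≤ 2 * (∫ ξ, ‖h ξ‖) * ‖A‖ * (‖u‖ * ‖v‖) := by
  obtain ⟨G, hG⟩ := exists_weighted_form (integrableOn_cutoff_mul ha hη hc h1 hq1 hq2)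
  refine ⟨G, fun u v => ?_, fun u hu v hv => ?_⟩
  · rw [hG]; simp only [mul_assoc]
  · have hci := integrableOn_mul_lineConv ha hu hv
    obtain ⟨M, hM⟩ := exists_bound_of_hasCompactSupport hη hc
    have hint : ∀ r : ℝ, IntegrableOn (fun t => (η (t / r) : ℂ) * (a t * lineConv u v t))
        (Ioi 0) := by
      intro r
      refine Integrable.bdd_mul (c := M) hci ?_ (Eventually.of_forall fun t => ?_)
      · exact Continuous.aestronglyMeasurable (by fun_prop)
      · rw [Complex.norm_real]; exact hM _
    have hsplit : G u v = (∫ t in Ioi (0 : ℝ), (η (t / q.2) : ℂ) * (a t * lineConv u v t))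
        - ∫ t in Ioi (0 : ℝ), (η (t / q.1) : ℂ) * (a t * lineConv u v t) := by
      rw [hG, ← integral_sub (hint _) (hint _)]
      refine integral_congr_ae (Eventually.of_forall fun t => ?_)
      push_cast; ring
    rw [hsplit]
    refine (norm_sub_le _ _).trans ?_
    have e1 := norm_integral_dilation_le ha hA hu hv hh hηh q.2
    have e2 := norm_integral_dilation_le ha hA hu hv hh hηh q.1
    linarith

/-- The form of an integral Hankel operator is `∫₀^∞ a (u ∗ v)`. -/
theorem hasSmoothIntegral_lineConv (ha : LocallyIntegrableOn a (Ioi 0))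
    (hA : IsIntegralHankel a A) {u v : LineL2} (hu : u ∈ plusSpace) (hv : v ∈ plusSpace) :
    HasSmoothIntegral (fun x => a x * lineConv u v x) (halfLineForm A u v) := by
  intro η hη hc h1
  obtain ⟨h, hh, hηh⟩ := exists_integrable_fourier_density hη hc
  have hpos : ∀ᶠ q : ℝ × ℝ in 𝓝[>] (0 : ℝ) ×ˢ atTop, 0 < q.1 ∧ 0 < q.2 :=
    (eventually_mem_nhdsWithin.prod_inl _).and ((eventually_gt_atTop 0).prod_inr _)
  have hF := hpos.mono fun q hq =>
    exists_cutoff_form ha hA hη.continuous hc h1 hh hηh hq.1 hq.2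
  have hS : ∀ u ∈ testSpace, ∀ v ∈ testSpace, Tendsto (fun q : ℝ × ℝ =>
      ∫ t in Ioi (0 : ℝ), ((η (t / q.2) - η (t / q.1) : ℝ) : ℂ) * (a t * lineConv u v t))
      (𝓝[>] (0 : ℝ) ×ˢ atTop) (𝓝 (halfLineForm A u v)) := by
    intro u hu v hv
    rw [halfLineForm_eq_integral ha hA hu hv]
    exact hasSmoothIntegral_of_integrableOn (integrableOn_mul_lineConv ha hu hv) η hη hc h1
  exact tendsto_bilinear_of_closure hF hS (plusSpace_le_closure hu) (plusSpace_le_closure hv)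

end TestFunctions

/-! ### The Fourier transform on `L²(ℝ)` -/

theorem integral_fourier_mul_eq {f g : ℝ → ℂ} (hf : Integrable f) (hg : Integrable g) :
    ∫ x, 𝓕 f x * g x = ∫ x, f x * 𝓕 g x := by
  have := VectorFourier.integral_fourierIntegral_smul_eq_flip (μ := volume) (ν := volume)
    (L := innerₗ ℝ) Real.continuous_fourierChar (by exact continuous_inner) hf hg
  rw [flip_innerₗ] at this
  exact this

theorem integral_fourierInv_mul_eq {f g : ℝ → ℂ} (hf : Integrable f) (hg : Integrable g) :
    ∫ x, 𝓕⁻ f x * g x = ∫ x, f x * 𝓕⁻ g x := by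
  have h1 : ∀ h : ℝ → ℂ, 𝓕⁻ h = 𝓕 (fun x => h (-x)) := Real.fourierInv_eq_fourier_comp_neg
  have h2 : ∀ x, 𝓕⁻ g x = 𝓕 g (-x) := Real.fourierInv_eq_fourier_neg g
  rw [h1, integral_fourier_mul_eq hf.comp_neg hg, ← integral_neg_eq_self]
  simp [h2]

theorem continuous_fourier {f : ℝ → ℂ} (hf : Integrable f) : Continuous (𝓕 f) :=
  VectorFourier.fourierIntegral_continuous Real.continuous_fourierChar
    (by exact continuous_inner) hf

theorem continuous_fourierInv {f : ℝ → ℂ} (hf : Integrable f) : Continuous (𝓕⁻ f) := by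
  rw [Real.fourierInv_eq_fourier_comp_neg]
  exact continuous_fourier hf.comp_neg

/-- The abstract `L²` transform and the integral formula agree as tempered distributions. Testing
against smooth compactly supported functions turns this into equality almost everywhere. -/
theorem coeFn_fourier {u : LineL2} (hu : Integrable u) :
    (𝓕 u : LineL2) =ᵐ[volume] 𝓕 (⇑u) := by
  refine ae_eq_of_integral_contDiff_smul_eq ((Lp.memLp _).locallyIntegrable (by norm_num))
    (continuous_fourier hu).locallyIntegrable fun g hg hgc => ?_
  have hg₁ : HasCompactSupport (Complex.ofRealCLM ∘ g) := hgc.comp_left rfl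
  have hg₂ : ContDiff ℝ ∞ (Complex.ofRealCLM ∘ g) := by fun_prop
  set ψ : SchwartzMap ℝ ℂ := hg₁.toSchwartzMap hg₂ with hψ
  have h1 := DFunLike.congr_fun (Lp.fourier_toTemperedDistribution_eq u) ψ
  rw [TemperedDistribution.fourier_apply, Lp.toTemperedDistribution_apply,
    Lp.toTemperedDistribution_apply] at h1
  have h2 := integral_fourier_mul_eq ψ.integrable hu
  have h3 : ∀ x, ψ x = (g x : ℂ) := fun x => rfl
  simp only [smul_eq_mul, h3, Complex.real_smul] at h1 h2 ⊢
  rw [← h1, ← h2]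
  rfl

theorem coeFn_fourierInv {u : LineL2} (hu : Integrable u) :
    (𝓕⁻ u : LineL2) =ᵐ[volume] 𝓕⁻ (⇑u) := by
  refine ae_eq_of_integral_contDiff_smul_eq ((Lp.memLp _).locallyIntegrable (by norm_num))
    (continuous_fourierInv hu).locallyIntegrable fun g hg hgc => ?_
  have hg₁ : HasCompactSupport (Complex.ofRealCLM ∘ g) := hgc.comp_left rfl
  have hg₂ : ContDiff ℝ ∞ (Complex.ofRealCLM ∘ g) := by fun_prop
  set ψ : SchwartzMap ℝ ℂ := hg₁.toSchwartzMap hg₂ with hψ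
  have h1 := DFunLike.congr_fun (Lp.fourierInv_toTemperedDistribution_eq u) ψ
  rw [TemperedDistribution.fourierInv_apply, Lp.toTemperedDistribution_apply,
    Lp.toTemperedDistribution_apply] at h1
  have h2 := integral_fourierInv_mul_eq ψ.integrable hu
  have h3 : ∀ x, ψ x = (g x : ℂ) := fun x => rfl
  simp only [smul_eq_mul, h3, Complex.real_smul, SchwartzMap.fourierInv_coe] at h1 h2 ⊢
  rw [← h1, ← h2]

/-- The inverse Fourier transform as a linear isometric equivalence. -/
noncomputable def fourierInvL2 : LineL2 ≃ₗᵢ[ℂ] LineL2 := (Lp.fourierTransformₗᵢ ℝ ℂ).symm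

theorem fourierInvL2_apply (u : LineL2) : fourierInvL2 u = 𝓕⁻ u := rfl

theorem coeFn_fourierInvL2 {u : LineL2} (hu : Integrable u) :
    fourierInvL2 u =ᵐ[volume] 𝓕⁻ (⇑u) := coeFn_fourierInv hu

theorem coeFn_fourierInvL2_symm {u : LineL2} (hu : Integrable u) :
    fourierInvL2.symm u =ᵐ[volume] 𝓕 (⇑u) := coeFn_fourier hu

attribute [irreducible] fourierInvL2

theorem fourierInv_eq_modulation (f : ℝ → ℂ) (ξ : ℝ) :
    𝓕⁻ f ξ = ∫ t, modulation (2 * Real.pi * ξ) t * f t := by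
  rw [Real.fourierInv_eq']
  refine integral_congr_ae (Eventually.of_forall fun t => ?_)
  simp only [RCLike.inner_apply, conj_trivial, smul_eq_mul, modulation]
  congr 2
  push_cast; ring

theorem modulation_add_right (θ x y : ℝ) :
    modulation θ (x + y) = modulation θ x * modulation θ y := by
  simp only [modulation]
  rw [← Complex.exp_add]; congr 1; push_cast; ring

theorem star_modulation (θ x : ℝ) : star (modulation θ x) = modulation θ (-x) := by
  simp [modulation, ← Complex.exp_conj]

theorem modulation_comm (θ x y : ℝ) : modulation (θ * x) y = modulation (θ * y) x := by
  simp only [modulation]; congr 1; push_cast; ring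

theorem dense_integrable : Dense {u : LineL2 | Integrable u} := by
  refine (SchwartzMap.denseRange_toLpCLM (E := ℝ) (F := ℂ) (p := 2) (μ := volume)
    ENNReal.ofNat_ne_top).mono ?_
  rintro _ ⟨ψ, rfl⟩
  exact (ψ.integrable (μ := volume)).congr (ψ.coeFn_toLp 2 volume).symm

theorem fourierInvL2_shift (s : ℝ) (u : LineL2) :
    fourierInvL2 (shift s u) = modulate (2 * Real.pi * s) (fourierInvL2 u) := by
  refine dense_integrable.induction (P := fun u => fourierInvL2 (shift s u)
    = modulate (2 * Real.pi * s) (fourierInvL2 u)) (fun u hu => ?_) ?_ u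
  · have hu : Integrable u := hu
    have hs : Integrable (shift s u) := (hu.comp_sub_right s).congr (coeFn_shift s u).symm
    apply Lp.ext
    filter_upwards [coeFn_fourierInvL2 hs, coeFn_modulate (2 * Real.pi * s) (fourierInvL2 u),
      coeFn_fourierInvL2 hu] with ξ h1 h2 h3
    rw [h1, h2, h3, Real.fourierInv_congr_ae (coeFn_shift s u), fourierInv_eq_modulation,
      fourierInv_eq_modulation, ← integral_const_mul,
      ← integral_add_right_eq_self (fun t => modulation (2 * Real.pi * ξ) t * u (t - s)) s]
    refine integral_congr_ae (Eventually.of_forall fun t => ?_)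
    simp only [modulation_add_right, add_sub_cancel_right, modulation_comm _ s ξ]
    ring
  · refine isClosed_eq ?_ ?_
    · exact fourierInvL2.continuous.comp (shift s).continuous
    · exact (modulate _).continuous.comp fourierInvL2.continuous

/-- The Fourier multiplier with symbol `m`. -/
noncomputable def multiplier {m : ℝ → ℂ} (hm : MemLp m ⊤ volume) : LineL2 →L[ℂ] LineL2 :=
  fourierInvL2.symm.toContinuousLinearEquiv.toContinuousLinearMap ∘L mulOp hm ∘L
    fourierInvL2.toContinuousLinearEquiv.toContinuousLinearMap

theorem fourierInvL2_multiplier {m : ℝ → ℂ} (hm : MemLp m ⊤ volume) (u : LineL2) :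
    fourierInvL2 (multiplier hm u) = mulOp hm (fourierInvL2 u) :=
  fourierInvL2.apply_symm_apply _

/-- Commutation with translations, hence with `convOp`, carries the Bessel bound from the orbit of
`f` to that of `M f`. -/
theorem multiplier_shift {m : ℝ → ℂ} (hm : MemLp m ⊤ volume) (s : ℝ) (u : LineL2) :
    multiplier hm (shift s u) = shift s (multiplier hm u) := by
  apply fourierInvL2.injective
  rw [fourierInvL2_multiplier, fourierInvL2_shift, fourierInvL2_shift, fourierInvL2_multiplier]
  apply Lp.ext
  filter_upwards [coeFn_mulOp hm (modulate (2 * Real.pi * s) (fourierInvL2 u)),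
    coeFn_modulate (2 * Real.pi * s) (mulOp hm (fourierInvL2 u)),
    coeFn_modulate (2 * Real.pi * s) (fourierInvL2 u), coeFn_mulOp hm (fourierInvL2 u)]
    with x h1 h2 h3 h4
  rw [h1, h2, h3, h4]; ring

/-- Pairing with an arbitrary `v` replaces the vector-valued integral by a scalar double integral,
to which Fubini applies. -/
theorem fourierInvL2_convOp (μ : Measure ℝ) [IsFiniteMeasure μ] {m : ℝ → ℂ}
    (hm : MemLp m ⊤ volume) (hmμ : ∀ ξ, m ξ = ∫ s, modulation (2 * Real.pi * s) ξ ∂μ)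
    (u : LineL2) : fourierInvL2 (convOp μ u) = mulOp hm (fourierInvL2 u) := by
  set w := fourierInvL2 u with hw
  refine ext_inner_left ℂ fun v => ?_
  have h0 := map_convOp μ (innerSL ℂ v ∘L
    fourierInvL2.toContinuousLinearEquiv.toContinuousLinearMap) u
  have h1 : inner ℂ v (fourierInvL2 (convOp μ u))
      = ∫ s, inner ℂ v (modulate (2 * Real.pi * s) w) ∂μ := by
    refine h0.trans (integral_congr_ae (Eventually.of_forall fun s => ?_))
    change inner ℂ v (fourierInvL2 (shift s u)) = _
    rw [fourierInvL2_shift]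
  have hint : Integrable (fun x => inner ℂ (v x) (w x)) := L2.integrable_inner v w
  have h2 : ∀ s, inner ℂ v (modulate (2 * Real.pi * s) w)
      = ∫ x, modulation (2 * Real.pi * s) x * inner ℂ (v x) (w x) := by
    intro s
    rw [L2.inner_def]
    refine integral_congr_ae ?_
    filter_upwards [coeFn_modulate (2 * Real.pi * s) w] with x hx
    rw [hx, ← smul_eq_mul, inner_smul_right]
  have hI : Integrable (Function.uncurry fun s x =>
      modulation (2 * Real.pi * s) x * inner ℂ (v x) (w x)) (μ.prod volume) := by
    refine Integrable.bdd_mul (c := 1) (hint.comp_snd μ) ?_ ?_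
    · unfold modulation
      exact Continuous.aestronglyMeasurable (by fun_prop)
    · exact Eventually.of_forall fun p => (norm_modulation _ _).le
  rw [h1, integral_congr_ae (Eventually.of_forall h2), integral_integral_swap hI, L2.inner_def]
  refine integral_congr_ae ?_
  filter_upwards [coeFn_mulOp hm w] with x hx
  rw [hx, integral_mul_const, ← hmμ, ← smul_eq_mul (m x) (w x), inner_smul_right]

/-! ### Exponentials -/

/-- The function `exp(-ct)` on `(0, ∞)`, extended by zero. -/
noncomputable def expDecay (c : ℂ) : ℝ → ℂ := (Ioi (0 : ℝ)).indicator fun t => Complex.exp (-c * t)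

theorem integrable_expDecay {c : ℂ} (hc : 0 < c.re) : Integrable (expDecay c) :=
  (integrable_indicator_iff measurableSet_Ioi).2
    (integrableOn_exp_mul_complex_Ioi (by simpa using hc) 0)

theorem memLp_expDecay {c : ℂ} (hc : 0 < c.re) : MemLp (expDecay c) 2 volume := by
  refine (memLp_indicator_iff_restrict measurableSet_Ioi).2 ?_
  rw [memLp_two_iff_integrable_sq_norm (Continuous.aestronglyMeasurable (by fun_prop))]
  have h := integrableOn_exp_mul_Ioi (a := -(2 * c.re)) (by linarith) 0
  refine h.congr (Eventually.of_forall fun t => ?_)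
  simp only [Complex.norm_exp]
  rw [← Real.exp_nat_mul]
  congr 1
  simp; ring

/-- The function `exp(-ct)` on `(0, ∞)` as an element of `L²(ℝ)`. -/
noncomputable def expLp {c : ℂ} (hc : 0 < c.re) : LineL2 := (memLp_expDecay hc).toLp _

theorem coeFn_expLp {c : ℂ} (hc : 0 < c.re) : expLp hc =ᵐ[volume] expDecay c :=
  (memLp_expDecay hc).coeFn_toLp

theorem integrable_expLp {c : ℂ} (hc : 0 < c.re) : Integrable (expLp hc) :=
  (integrable_expDecay hc).congr (coeFn_expLp hc).symm

theorem expLp_mem_plusSpace {c : ℂ} (hc : 0 < c.re) : expLp hc ∈ plusSpace := by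
  rw [mem_plusSpace]
  filter_upwards [coeFn_expLp hc] with x hx h0
  rw [hx, expDecay, indicator_of_notMem (by simpa using h0.le)]

/-- The exponential shifted by `-s` is a multiple of itself on `(0, ∞)` but not on `(-s, 0)`, where
`u` vanishes. The exponential thus behaves as an eigenvector of the adjoint translation. -/
theorem lpPair_expLp_shift {c : ℂ} (hc : 0 < c.re) {s : ℝ} (hs : 0 ≤ s) {u : LineL2}
    (hu : u ∈ plusSpace) :
    lpPair volume (expLp hc) (shift s u) = Complex.exp (-c * s) * lpPair volume (expLp hc) u := by
  rw [lpPair_comm, lpPair_shift, lpPair_comm, lpPair_apply, lpPair_apply, ← integral_const_mul]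
  refine integral_congr_ae ?_
  have h3 : ∀ᵐ x : ℝ, x ≠ 0 := by simp [ae_iff]
  filter_upwards [coeFn_shift (-s) (expLp hc), ae_comp_sub_right (coeFn_expLp hc) (-s),
    coeFn_expLp hc, mem_plusSpace.1 hu, h3] with x h1 h2 h3 h4 h5
  rcases lt_or_gt_of_ne h5 with h | h
  · rw [h4 h]; simp
  · rw [h1, h2, h3, expDecay, indicator_of_mem (mem_Ioi.2 h),
      indicator_of_mem (mem_Ioi.2 (by linarith)), ← mul_assoc, ← Complex.exp_add]
    congr 2
    push_cast; ring

theorem lpPair_expLp_convOp (μ : Measure ℝ) [IsFiniteMeasure μ] (hμ : μ (Iio 0) = 0)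
    {c : ℂ} (hc : 0 < c.re) {u : LineL2} (hu : u ∈ plusSpace) :
    lpPair volume (expLp hc) (convOp μ u)
      = (∫ s : ℝ, Complex.exp (-c * s) ∂μ) * lpPair volume (expLp hc) u := by
  rw [map_convOp, ← integral_mul_const]
  refine integral_congr_ae ?_
  have h0 : ∀ᵐ s ∂μ, ¬ s < 0 := by
    rw [ae_iff]; simpa [Iio] using hμ
  filter_upwards [h0] with s hs
  exact lpPair_expLp_shift hc (not_lt.1 hs) hu

theorem fourierInv_expDecay {c : ℂ} (hc : 0 < c.re) (ξ : ℝ) :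
    𝓕⁻ (expDecay c) ξ = (c - 2 * Real.pi * ξ * Complex.I)⁻¹ := by
  rw [fourierInv_eq_modulation]
  have h1 : ∀ t, modulation (2 * Real.pi * ξ) t * expDecay c t = (Ioi (0 : ℝ)).indicator
      (fun t : ℝ => Complex.exp (-(c - 2 * Real.pi * ξ * Complex.I) * t)) t := by
    intro t
    by_cases ht : t ∈ Ioi (0 : ℝ)
    · rw [expDecay, indicator_of_mem ht, indicator_of_mem ht, modulation, ← Complex.exp_add]
      congr 1; push_cast; ring
    · rw [expDecay, indicator_of_notMem ht, indicator_of_notMem ht, mul_zero]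
  have hre : (-(c - 2 * Real.pi * ξ * Complex.I)).re < 0 := by
    simp; linarith
  rw [integral_congr_ae (Eventually.of_forall h1), integral_indicator measurableSet_Ioi,
    integral_exp_mul_complex_Ioi hre]
  rw [Complex.ofReal_zero, mul_zero, Complex.exp_zero, neg_div_neg_eq, one_div]

theorem two_pi_re_pos : 0 < (2 * Real.pi : ℂ).re := by
  simpa using Real.pi_pos

/-- The function `exp(-2πt)` on `(0, ∞)`. -/
noncomputable def expTwoPi : LineL2 := expLp two_pi_re_pos

theorem coeFn_fourierInvL2_expTwoPi :
    fourierInvL2 expTwoPi =ᵐ[volume] fun ξ => (2 * Real.pi * (1 - ξ * Complex.I))⁻¹ := by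
  filter_upwards [coeFn_fourierInvL2 (integrable_expLp two_pi_re_pos)] with ξ h
  rw [expTwoPi, h, Real.fourierInv_congr_ae (coeFn_expLp two_pi_re_pos),
    fourierInv_expDecay two_pi_re_pos]
  congr 1; ring

/-! ### Factorization of the kernel `φ` -/

theorem star_shift (s : ℝ) (u : LineL2) : star (shift s u) = shift s (star u) := by
  apply Lp.ext
  filter_upwards [Lp.coeFn_star (shift s u), coeFn_shift s u, coeFn_shift s (star u),
    ae_comp_sub_right (Lp.coeFn_star u) s] with x h1 h2 h3 h4
  rw [h1, Pi.star_apply, h2, h3, h4, Pi.star_apply]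

theorem coeFn_fourierInvL2_star_reflect {u : LineL2} (hu : Integrable u) :
    fourierInvL2 (star (reflect u)) =ᵐ[volume] fun ξ => star (fourierInvL2 u ξ) := by
  have h0 : ⇑(star (reflect u)) =ᵐ[volume] fun x => star (u (-x)) := by
    filter_upwards [Lp.coeFn_star (reflect u), coeFn_reflect u] with x h1 h2
    rw [h1, Pi.star_apply, h2]
  have hi : Integrable ⇑(star (reflect u)) := by
    refine Integrable.congr ?_ h0.symm
    exact (Complex.conjCLE.integrable_comp_iff).2 hu.comp_neg
  filter_upwards [coeFn_fourierInvL2 hi, coeFn_fourierInvL2 hu] with ξ h1 h2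
  rw [h1, h2, Real.fourierInv_congr_ae h0, fourierInv_eq_modulation, fourierInv_eq_modulation,
    ← integral_neg_eq_self]
  have h3 := integral_conj (μ := volume) (f := fun t => modulation (2 * Real.pi * ξ) t * u t)
  refine Eq.trans ?_ h3
  refine integral_congr_ae (Eventually.of_forall fun t => ?_)
  simp only [neg_neg, map_mul, ← star_modulation]
  rfl

/-- This is Parseval: `(u ∗ v)(x)` is the inner product of `v` with the translate by `x` of the
conjugated reflection of `u`. -/
theorem lineConv_eq_integral_fourier {u : LineL2} (hu : Integrable u) (v : LineL2) (x : ℝ) :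
    lineConv u v x = ∫ ξ, modulation (-(2 * Real.pi * x)) ξ *
      (fourierInvL2 u ξ * fourierInvL2 v ξ) := by
  rw [lineConv_comm, lineConv, lpPair_comm, ← inner_star, star_shift,
    ← fourierInvL2.inner_map_map, fourierInvL2_shift, L2.inner_def]
  refine integral_congr_ae ?_
  filter_upwards [coeFn_modulate (2 * Real.pi * x) (fourierInvL2 (star (reflect u))),
    coeFn_fourierInvL2_star_reflect hu] with ξ h1 h2
  have h3 : (starRingEnd ℂ) (modulation (2 * Real.pi * x) ξ)
      = modulation (-(2 * Real.pi * x)) ξ := by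
    refine (star_modulation _ _).trans ?_
    simp [modulation]
  rw [h1, h2, RCLike.inner_apply, map_mul, h3]
  simp only [RCLike.star_def, RingHomCompTriple.comp_apply, RingHom.id_apply]
  ring

theorem fourier_eq_modulation (f : ℝ → ℂ) (x : ℝ) :
    𝓕 f x = ∫ ξ, modulation (-(2 * Real.pi * x)) ξ * f ξ := by
  rw [Real.fourier_eq']
  refine integral_congr_ae (Eventually.of_forall fun t => ?_)
  simp only [RCLike.inner_apply, conj_trivial, smul_eq_mul, modulation]
  congr 2
  push_cast; ring

theorem expTwoPi_mem_plusSpace : expTwoPi ∈ plusSpace := expLp_mem_plusSpace _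

theorem integrable_expTwoPi : Integrable expTwoPi := integrable_expLp _

/-- A function in `L²(ℝ)` whose convolution with `exp(-2πt)` vanishes on the negative half-line is
supported on the positive half-line. -/
theorem mem_plusSpace_of_lineConv_eq_zero {g : LineL2}
    (hg : ∀ x < 0, lineConv expTwoPi g x = 0) : g ∈ plusSpace := by
  -- The convolution at `x` is `exp(-2πx) ∫_{t < x} h`. So the primitive of `h` vanishes on the
  -- negative axis, and Lebesgue differentiation gives `h = 0` there.
  set h : ℝ → ℂ := fun t => g t * Complex.exp (2 * Real.pi * t) with hh
  have hloc : LocallyIntegrable h volume := by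
    have h1 : LocallyIntegrable g volume := (Lp.memLp g).locallyIntegrable (by norm_num)
    rw [← locallyIntegrableOn_univ] at h1 ⊢
    exact h1.mul_continuousOn (Continuous.continuousOn (by fun_prop)) isOpen_univ.isLocallyClosed
  have hind : ∀ x t, (Iio x).indicator h t
      = Complex.exp (2 * Real.pi * x) * (g t * expDecay (2 * Real.pi) (x - t)) := by
    intro x t
    by_cases ht : t < x
    · rw [indicator_of_mem (mem_Iio.2 ht), expDecay, indicator_of_mem (by simpa using ht)]
      simp only [hh]
      rw [mul_left_comm, ← Complex.exp_add]
      congr 2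
      push_cast; ring
    · rw [indicator_of_notMem (by simpa using ht), expDecay,
        indicator_of_notMem (by simpa using ht), mul_zero, mul_zero]
  have hint : ∀ x, IntegrableOn h (Iic x) := by
    intro x
    rw [integrableOn_Iic_iff_integrableOn_Iio, ← integrable_indicator_iff measurableSet_Iio]
    have h1 : MemLp (fun t => expDecay (2 * Real.pi) (x - t)) 2 volume :=
      (memLp_expDecay two_pi_re_pos).comp_measurePreserving
        (Measure.measurePreserving_sub_left volume x)
    have h2 := ((Lp.memLp g).integrable_mul h1).const_mul (Complex.exp (2 * Real.pi * x))
    exact h2.congr (Eventually.of_forall fun t => (hind x t).symm)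
  have hzero : ∀ x < 0, ∫ t in Iic x, h t = 0 := by
    intro x hx
    rw [integral_Iic_eq_integral_Iio, ← integral_indicator measurableSet_Iio,
      integral_congr_ae (Eventually.of_forall (hind x)), integral_const_mul]
    rw [← lineConv_eq_of_ae (coeFn_expLp two_pi_re_pos) (EventuallyEq.refl _ g)]
    have := hg x hx
    rw [expTwoPi] at this
    rw [this, mul_zero]
  rw [mem_plusSpace]
  filter_upwards [LocallyIntegrable.ae_hasDerivAt_integral hloc] with x hx hx0
  have h1 := hx (-1)
  have h2 : (fun y => ∫ t in (-1 : ℝ)..y, h t) =ᶠ[𝓝 x] fun _ => 0 := by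
    filter_upwards [Iio_mem_nhds hx0] with y hy
    rw [← intervalIntegral.integral_Iic_sub_Iic (hint _) (hint _), hzero y hy,
      hzero (-1) (by norm_num), sub_zero]
  have h3 := (hasDerivAt_const x (0 : ℂ)).congr_of_eventuallyEq h2
  have h4 := h1.unique h3
  simpa [hh] using h4

/-- On the Fourier side `f ∗ M f` is `m` times the square of `(2π(1 - iξ))⁻¹`, so `m` must be the
transform of `φ` times `(2π(1 - iξ))²`. The modulus of that factor is `4π²(1 + ξ²)`, and the decay
hypothesis makes `m` bounded. Continuity of both sides upgrades equality almost everywhere to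
equality everywhere. -/
theorem exists_factorization {φ : ℝ → ℂ} (hc : Continuous φ) (hs : tsupport φ ⊆ Ici 0)
    (hφ : MemLp φ 2 (volume : Measure ℝ)) {C : ℝ}
    (hC : ∀ᵐ ξ : ℝ, ‖(𝓕⁻ (hφ.toLp φ) : Lp ℂ 2 (volume : Measure ℝ)) ξ‖ ≤ C / (1 + ξ ^ 2)) :
    ∃ (m : ℝ → ℂ) (hm : MemLp m ⊤ volume), multiplier hm expTwoPi ∈ plusSpace ∧
      ∀ x, lineConv expTwoPi (multiplier hm expTwoPi) x = φ x := by
  set P : LineL2 := fourierInvL2 (hφ.toLp φ) with hP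
  have hC : ∀ᵐ ξ : ℝ, ‖P ξ‖ ≤ C / (1 + ξ ^ 2) := by
    rw [hP, fourierInvL2_apply]; exact hC
  have hpos : ∀ ξ : ℝ, 0 < 1 + ξ ^ 2 := fun ξ => by positivity
  set m : ℝ → ℂ := fun ξ => P ξ * (2 * Real.pi * (1 - ξ * Complex.I)) ^ 2 with hmdef
  have hne : ∀ ξ : ℝ, (2 * Real.pi * (1 - ξ * Complex.I) : ℂ) ≠ 0 := by
    intro ξ h
    have := congrArg Complex.re h
    simp [Real.pi_ne_zero] at this
  have hnorm : ∀ ξ : ℝ, ‖(2 * Real.pi * (1 - ξ * Complex.I) : ℂ) ^ 2‖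
      = (2 * Real.pi) ^ 2 * (1 + ξ ^ 2) := by
    intro ξ
    rw [norm_pow, ← Complex.normSq_eq_norm_sq, Complex.normSq_apply]
    simp
    ring
  have hm : MemLp m ⊤ volume := by
    refine memLp_top_of_bound ?_ ((2 * Real.pi) ^ 2 * C) ?_
    · exact (Lp.aestronglyMeasurable P).mul (Continuous.aestronglyMeasurable (by fun_prop))
    · filter_upwards [hC] with ξ h
      rw [le_div_iff₀ (hpos ξ)] at h
      simp only [hmdef]
      rw [norm_mul, hnorm]
      calc _ = (2 * Real.pi) ^ 2 * (‖P ξ‖ * (1 + ξ ^ 2)) := by ring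
        _ ≤ _ := by gcongr
  have hPi : Integrable P := by
    refine (integrable_inv_one_add_sq.const_mul C).mono' (Lp.aestronglyMeasurable P) ?_
    filter_upwards [hC] with ξ h
    rwa [← div_eq_mul_inv]
  have hconv : ∀ x, lineConv expTwoPi (multiplier hm expTwoPi) x = 𝓕 (⇑P) x := by
    intro x
    rw [lineConv_eq_integral_fourier integrable_expTwoPi, fourier_eq_modulation]
    refine integral_congr_ae ?_
    rw [fourierInvL2_multiplier]
    filter_upwards [coeFn_fourierInvL2_expTwoPi, coeFn_mulOp hm (fourierInvL2 expTwoPi)]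
      with ξ h1 h2
    rw [h2, h1]
    congr 1
    simp only [hmdef]
    have := hne ξ
    generalize (2 * Real.pi * (1 - ξ * Complex.I) : ℂ) = z at this
    field_simp
  have hall : ∀ x, lineConv expTwoPi (multiplier hm expTwoPi) x = φ x := by
    have h1 : fourierInvL2.symm P =ᵐ[volume] 𝓕 (⇑P) := coeFn_fourierInvL2_symm hPi
    rw [hP, fourierInvL2.symm_apply_apply] at h1
    have h2 : φ =ᵐ[volume] lineConv expTwoPi (multiplier hm expTwoPi) :=
      (hφ.coeFn_toLp.symm.trans h1).trans (Eventually.of_forall fun x => (hconv x).symm)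
    have h3 := (Continuous.ae_eq_iff_eq volume hc (continuous_lineConv _ _)).1 h2
    exact fun x => (congrFun h3 x).symm
  refine ⟨m, hm, mem_plusSpace_of_lineConv_eq_zero fun x hx => ?_, hall⟩
  rw [hall]
  by_contra hne
  exact absurd (hs (subset_tsupport _ hne)) (not_le.2 hx)

/-! ### Orbits of contractions -/

section Orbit

variable {E : Type*} [NormedAddCommGroup E] [InnerProductSpace ℂ E]

/-- A version of Littlewood's subordination principle: if `f` is an eigenvector of the adjoint of a
contraction `T` with an eigenvalue in the open unit disk, then the orbit of `f` is a Bessel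
sequence. -/
theorem norm_sum_orbit_sq_le {T : E →L[ℂ] E} (hT : ∀ u, ‖T u‖ ≤ ‖u‖) {S : Submodule ℂ E}
    (hS : ∀ u ∈ S, T u ∈ S) {f : E} (hf : f ∈ S) {z : ℂ} (hz : ‖z‖ < 1)
    (hfz : ∀ u ∈ S, inner ℂ f (T u) = z * inner ℂ f u) :
    ∃ K, ∀ (N : ℕ) (x : ℕ → ℂ), ‖∑ j ∈ Finset.range N, x j • (T ^ j) f‖ ^ 2
      ≤ K * ∑ j ∈ Finset.range N, ‖x j‖ ^ 2 := by
  set F : ℝ := ‖f‖ ^ 2 with hF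
  have h1z : 0 < 1 - ‖z‖ ^ 2 := by nlinarith [norm_nonneg z]
  -- The `2` pays for two copies of `|x₀|² F²`, one from each term on the left of `key`. The
  -- quotient is the price of absorbing the cross term by Young's inequality.
  set κ : ℝ := 2 + 4 * ‖z‖ ^ 2 / (1 - ‖z‖ ^ 2) with hκ
  have hmem : ∀ j, (T ^ j) f ∈ S := by
    intro j
    induction j with
    | zero => simpa using hf
    | succ j ih => rw [pow_succ', mul_apply_eq_comp]; exact hS _ ih
  -- The added term `|⟨f, p⟩|²` makes the induction close. In `p = T q + x₀ f`, the old contribution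
  -- `s² = |⟨f, q⟩|²` is damped to `|z|² s²`, and the surplus `(1 - |z|²) s²` absorbs the cross
  -- terms.
  have key : ∀ (N : ℕ) (x : ℕ → ℂ), F * ‖∑ j ∈ Finset.range N, x j • (T ^ j) f‖ ^ 2
      + ‖inner ℂ f (∑ j ∈ Finset.range N, x j • (T ^ j) f)‖ ^ 2
      ≤ κ * F ^ 2 * ∑ j ∈ Finset.range N, ‖x j‖ ^ 2 := by
    intro N
    induction N with
    | zero => intro x; simp
    | succ N ih =>
      intro x
      have ih := ih fun j => x (j + 1)
      set q := ∑ j ∈ Finset.range N, x (j + 1) • (T ^ j) f with hq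
      have hqS : q ∈ S := S.sum_mem fun j _ => S.smul_mem _ (hmem j)
      have hp : ∑ j ∈ Finset.range (N + 1), x j • (T ^ j) f = T q + x 0 • f := by
        rw [Finset.sum_range_succ', hq, map_sum]
        simp [pow_succ']
      rw [hp, Finset.sum_range_succ']
      set s := ‖inner ℂ f q‖ with hs
      set a := ‖x 0‖ with ha
      have e0 : inner ℂ f (T q + x 0 • f) = z * inner ℂ f q + x 0 * (F : ℂ) := by
        rw [inner_add_right, inner_smul_right, hfz q hqS, inner_self_eq_ofReal_norm_sq, hF]
        push_cast; ring
      have e1 : ‖inner ℂ f (T q + x 0 • f)‖ ≤ ‖z‖ * s + a * F := by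
        rw [e0]
        refine (norm_add_le _ _).trans ?_
        rw [norm_mul, norm_mul, Complex.norm_real, Real.norm_of_nonneg (by positivity)]
      have e2 : ‖T q + x 0 • f‖ ^ 2 ≤ ‖q‖ ^ 2 + 2 * (a * (‖z‖ * s)) + a ^ 2 * F := by
        rw [@norm_add_sq ℂ]
        have h1 : ‖T q‖ ^ 2 ≤ ‖q‖ ^ 2 := by gcongr; exact hT q
        have h2 : RCLike.re (inner ℂ (T q) (x 0 • f)) ≤ a * (‖z‖ * s) := by
          refine (RCLike.re_le_norm _).trans ?_
          rw [inner_smul_right, norm_mul, norm_inner_symm, hfz q hqS, norm_mul]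
        have h3 : ‖x 0 • f‖ ^ 2 = a ^ 2 * F := by rw [norm_smul, mul_pow]
        linarith
      have hs0 : 0 ≤ s := norm_nonneg _
      have ha0 : 0 ≤ a := norm_nonneg _
      have hF0 : 0 ≤ F := by positivity
      have hz0 := norm_nonneg z
      have e3 : ‖inner ℂ f (T q + x 0 • f)‖ ^ 2 ≤ (‖z‖ * s + a * F) ^ 2 := by gcongr
      have e4 : 4 * (a * F) * (‖z‖ * s) ≤ (κ - 2) * (a * F) ^ 2 + (1 - ‖z‖ ^ 2) * s ^ 2 := by
        have h1 : (κ - 2) * (a * F) ^ 2 = (2 * ‖z‖ * (a * F)) ^ 2 / (1 - ‖z‖ ^ 2) := by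
          rw [hκ]; field_simp; ring
        have h2 : 0 ≤ (2 * ‖z‖ * (a * F) - (1 - ‖z‖ ^ 2) * s) ^ 2 / (1 - ‖z‖ ^ 2) := by positivity
        have h3 : (2 * ‖z‖ * (a * F) - (1 - ‖z‖ ^ 2) * s) ^ 2 / (1 - ‖z‖ ^ 2)
            = (2 * ‖z‖ * (a * F)) ^ 2 / (1 - ‖z‖ ^ 2) - 4 * (a * F) * (‖z‖ * s)
              + (1 - ‖z‖ ^ 2) * s ^ 2 := by
          field_simp; ring
        linarith
      have e5 : F * ‖T q + x 0 • f‖ ^ 2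
          ≤ F * (‖q‖ ^ 2 + 2 * (a * (‖z‖ * s)) + a ^ 2 * F) := by gcongr
      nlinarith
  refine ⟨κ * F, fun N x => ?_⟩
  rcases eq_or_ne f 0 with h0 | h0
  · simp [hF, h0]
  have hFp : 0 < F := by positivity
  have := key N x
  refine le_of_mul_le_mul_left ?_ hFp
  nlinarith [sq_nonneg ‖inner ℂ f (∑ j ∈ Finset.range N, x j • (T ^ j) f)‖]

variable [CompleteSpace E]

/-- The synthesis operator of a Bessel sequence. -/
theorem exists_synthesis {w : ℕ → E} {K : ℝ} (hw : ∀ (N : ℕ) (x : ℕ → ℂ),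
    ‖∑ j ∈ Finset.range N, x j • w j‖ ^ 2 ≤ K * ∑ j ∈ Finset.range N, ‖x j‖ ^ 2) :
    ∃ Φ : SeqL2 →L[ℂ] E, ∀ j, Φ (lp.single 2 j (1 : ℂ)) = w j := by
  -- By duality, choosing the coefficients `x j = ⟨w j, h⟩` gives `S² ≤ ‖p‖² ‖h‖² ≤ |K| S ‖h‖²`. The
  -- synthesis operator is then the adjoint of the bounded analysis operator.
  have hb : ∀ (h : E) (N : ℕ), ∑ j ∈ Finset.range N, ‖inner ℂ (w j) h‖ ^ 2 ≤ |K| * ‖h‖ ^ 2 := by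
    intro h N
    set S := ∑ j ∈ Finset.range N, ‖inner ℂ (w j) h‖ ^ 2 with hS
    set p := ∑ j ∈ Finset.range N, inner ℂ (w j) h • w j with hp
    have hS0 : 0 ≤ S := Finset.sum_nonneg fun _ _ => by positivity
    have h1 : (S : ℂ) = inner ℂ p h := by
      rw [hp, sum_inner, hS]
      push_cast
      refine Finset.sum_congr rfl fun j _ => ?_
      rw [inner_smul_left, mul_comm, RCLike.mul_conj]
      rfl
    have h2 : S ≤ ‖p‖ * ‖h‖ := by
      have := norm_inner_le_norm (𝕜 := ℂ) p h
      rwa [← h1, Complex.norm_real, Real.norm_of_nonneg hS0] at this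
    have h3 : ‖p‖ ^ 2 ≤ |K| * S := (hw N _).trans (by gcongr; exact le_abs_self K)
    rcases hS0.eq_or_lt with h0 | h0
    · rw [← h0]; positivity
    refine le_of_mul_le_mul_left ?_ h0
    calc S * S ≤ (‖p‖ * ‖h‖) ^ 2 := by rw [sq]; gcongr
      _ = ‖p‖ ^ 2 * ‖h‖ ^ 2 := by ring
      _ ≤ (|K| * S) * ‖h‖ ^ 2 := by gcongr
      _ = _ := by ring
  have hmem : ∀ h : E, Memℓp (fun j : ℕ => (inner ℂ (w j) h : ℂ)) 2 := by
    intro h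
    refine memℓp_gen ?_
    simp only [ENNReal.toReal_ofNat, Real.rpow_two]
    exact summable_of_sum_range_le (fun _ => by positivity) (hb h)
  let L : E →ₗ[ℂ] SeqL2 :=
    { toFun := fun h => ⟨_, hmem h⟩
      map_add' := fun h h' => Subtype.ext (funext fun j => inner_add_right _ _ _)
      map_smul' := fun c h => Subtype.ext (funext fun j => inner_smul_right _ _ _) }
  have hL : ∀ h, ‖L h‖ ≤ √|K| * ‖h‖ := by
    intro h
    have h1 : ‖L h‖ ^ 2 = ∑' j, ‖(inner ℂ (w j) h : ℂ)‖ ^ 2 := by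
      have : ‖L h‖ ^ 2 = ∑' j, ‖L h j‖ ^ 2 := by
        simpa using lp.norm_rpow_eq_tsum (p := 2) (by norm_num) (L h)
      exact this
    have h2 : ‖L h‖ ^ 2 ≤ (√|K| * ‖h‖) ^ 2 := by
      rw [h1, mul_pow, Real.sq_sqrt (abs_nonneg K)]
      exact Real.tsum_le_of_sum_range_le (fun _ => by positivity) (hb h)
    exact le_of_sq_le_sq h2 (by positivity)
  refine ⟨adjoint (L.mkContinuous _ hL), fun j => ext_inner_right ℂ fun h => ?_⟩
  rw [adjoint_inner_left, lp.inner_single_left]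
  simp [L]

end Orbit

/-- A bounded operator on `ℓ²` is a Hankel matrix if its matrix entries are. -/
theorem isHankelMatrix_of_single {α : ℕ → ℂ} {T : SeqL2 →L[ℂ] SeqL2}
    (h : ∀ j k, T (lp.single 2 j (1 : ℂ)) k = α (j + k)) : IsHankelMatrix α T := by
  intro x k
  have h1 : HasSum (fun j => lp.single 2 j (x j)) x := lp.hasSum_single ENNReal.ofNat_ne_top x
  have h2 := (innerSL ℂ (lp.single 2 k (1 : ℂ) : SeqL2) ∘L T).hasSum h1
  have h3 : ∀ y : SeqL2, (innerSL ℂ (lp.single 2 k (1 : ℂ) : SeqL2) ∘L T) y = T y k := by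
    intro y
    rw [comp_apply, innerSL_apply_apply, lp.inner_single_left]
    simp
  rw [h3] at h2
  refine h2.congr_fun fun j => ?_
  have h4 : (lp.single 2 j (x j) : SeqL2) = x j • lp.single 2 j (1 : ℂ) := by
    rw [← lp.single_smul]; simp
  rw [h4, map_smul, h3, h, smul_eq_mul, mul_comm]

/-! ### Restriction of integral Hankel operators -/

theorem pow_mem_plusSpace {T : LineL2 →L[ℂ] LineL2} (hT : ∀ u ∈ plusSpace, T u ∈ plusSpace)
    {f : LineL2} (hf : f ∈ plusSpace) (j : ℕ) : (T ^ j) f ∈ plusSpace := by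
  induction j with
  | zero => simpa using hf
  | succ j ih => rw [pow_succ', mul_apply_eq_comp]; exact hT _ ih

/-- This links the pointwise convolution `F`, acting on genuine functions, with its `L²` counterpart
`T`, acting on classes. -/
theorem iterate_lineConv {T : LineL2 →L[ℂ] LineL2} {F : (ℝ → ℂ) → ℝ → ℂ}
    (hF : ∀ u v, F (lineConv u v) = lineConv u (T v)) (f g : LineL2) (j : ℕ) :
    F^[j] (lineConv f g) = lineConv f ((T ^ j) g) := by
  induction j with
  | zero => simp
  | succ j ih => rw [Function.iterate_succ_apply', ih, hF, pow_succ', mul_apply_eq_comp]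

section

variable {a : ℝ → ℂ} {A : HalfLineL2 →L[ℂ] HalfLineL2}

theorem isRestriction_halfLineForm (ha : LocallyIntegrableOn a (Ioi 0))
    (hA : IsIntegralHankel a A) {T : LineL2 →L[ℂ] LineL2}
    (hT : ∀ u ∈ plusSpace, T u ∈ plusSpace) {F : (ℝ → ℂ) → ℝ → ℂ}
    (hF : ∀ u v, F (lineConv u v) = lineConv u (T v)) {f g : LineL2} (hf : f ∈ plusSpace)
    (hg : g ∈ plusSpace) {φ : ℝ → ℂ} (hφ : lineConv f g = φ) :
    IsRestriction a (fun j => F^[j] φ) fun j => halfLineForm A f ((T ^ j) g) := by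
  intro j
  have h := hasSmoothIntegral_lineConv ha hA hf (pow_mem_plusSpace hT hg j)
  have hj : F^[j] φ = lineConv f ((T ^ j) g) := by rw [← hφ, iterate_lineConv hF]
  simp only [hj]
  exact ⟨h, fun hi => h.unique (hasSmoothIntegral_of_integrableOn hi)⟩

/-- Here the Hankel structure arises: moving all powers of `T` to the second argument leaves only `j
+ k`. -/
theorem halfLineForm_pow_pow {T : LineL2 →L[ℂ] LineL2}
    (hT : ∀ u ∈ plusSpace, T u ∈ plusSpace)
    (hsymm : ∀ u ∈ plusSpace, ∀ v ∈ plusSpace,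
      halfLineForm A (T u) v = halfLineForm A u (T v))
    {f g : LineL2} (hf : f ∈ plusSpace) (hg : g ∈ plusSpace) (j k : ℕ) :
    halfLineForm A ((T ^ j) f) ((T ^ k) g) = halfLineForm A f ((T ^ (j + k)) g) := by
  induction j generalizing k with
  | zero => simp
  | succ j ih =>
    rw [pow_succ', mul_apply_eq_comp, hsymm _ (pow_mem_plusSpace hT hf j) _
      (pow_mem_plusSpace hT hg k)]
    have := ih (k + 1)
    rw [pow_succ' T k, mul_apply_eq_comp] at this
    rw [this]
    congr 3
    omega

/-- The matrix entry is sesquilinear and the form bilinear, which is why `Φ₂` takes conjugated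
values. -/
theorem adjoint_comp_comp_single {Φ₁ Φ₂ : SeqL2 →L[ℂ] HalfLineL2} {u v : LineL2} {j k : ℕ}
    (h₁ : Φ₁ (lp.single 2 j (1 : ℂ)) = restrictPos u)
    (h₂ : Φ₂ (lp.single 2 k (1 : ℂ)) = restrictPos (star v)) :
    (adjoint Φ₂ ∘L A ∘L Φ₁) (lp.single 2 j (1 : ℂ)) k = halfLineForm A u v := by
  have h3 : inner ℂ (lp.single 2 k (1 : ℂ) : SeqL2)
      ((adjoint Φ₂ ∘L A ∘L Φ₁) (lp.single 2 j (1 : ℂ)))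
      = (adjoint Φ₂ ∘L A ∘L Φ₁) (lp.single 2 j (1 : ℂ)) k := by
    rw [lp.inner_single_left]; simp
  rw [← h3, comp_apply, comp_apply, adjoint_inner_right, h₁, h₂, ← star_restrictPos, inner_star,
    lpPair_comm, halfLineForm_apply]

end

theorem norm_adjoint_comp_comp_le {E F : Type*} [NormedAddCommGroup E] [InnerProductSpace ℂ E]
    [CompleteSpace E] [NormedAddCommGroup F] [InnerProductSpace ℂ F] [CompleteSpace F]
    (Φ₁ Φ₂ : E →L[ℂ] F) (A : F →L[ℂ] F) :
    ‖adjoint Φ₂ ∘L A ∘L Φ₁‖ ≤ ‖Φ₁‖ * ‖Φ₂‖ * ‖A‖ := by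
  calc ‖adjoint Φ₂ ∘L A ∘L Φ₁‖ ≤ ‖adjoint Φ₂‖ * (‖A‖ * ‖Φ₁‖) :=
        (opNorm_comp_le _ _).trans (by gcongr; exact opNorm_comp_le _ _)
    _ = _ := by rw [LinearIsometryEquiv.norm_map]; ring

theorem star_expLp {c : ℂ} (hc : 0 < c.re) (hc' : 0 < (starRingEnd ℂ c).re) :
    star (expLp hc) = expLp hc' := by
  apply Lp.ext
  filter_upwards [Lp.coeFn_star (expLp hc), coeFn_expLp hc, coeFn_expLp hc'] with x h1 h2 h3
  rw [h1, Pi.star_apply, h2, h3, expDecay, expDecay]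
  by_cases hx : x ∈ Ioi (0 : ℝ)
  · rw [indicator_of_mem hx, indicator_of_mem hx]
    simp [← Complex.exp_conj]
  · rw [indicator_of_notMem hx, indicator_of_notMem hx, star_zero]

theorem star_expTwoPi : star expTwoPi = expTwoPi := by
  have h : (starRingEnd ℂ) (2 * Real.pi : ℂ) = 2 * Real.pi := by simp [Complex.conj_ofNat]
  rw [expTwoPi, star_expLp two_pi_re_pos (by rw [h]; exact two_pi_re_pos)]
  congr 1

theorem inner_expTwoPi (u : LineL2) : inner ℂ expTwoPi u = lpPair volume expTwoPi u := by
  rw [← inner_star, star_expTwoPi]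

theorem inner_expTwoPi_convOp (μ : Measure ℝ) [IsFiniteMeasure μ] (hμ : μ (Iio 0) = 0)
    {u : LineL2} (hu : u ∈ plusSpace) :
    inner ℂ expTwoPi (convOp μ u)
      = (∫ s : ℝ, Complex.exp (-(2 * Real.pi) * s) ∂μ) * inner ℂ expTwoPi u := by
  rw [inner_expTwoPi, inner_expTwoPi]
  exact lpPair_expLp_convOp μ hμ two_pi_re_pos hu

theorem measure_univ_le_one {ν : Measure ℝ} (h0 : ν (Iio 0) = 0) (h1 : ν (Ici 0) ≤ 1) :
    ν univ ≤ 1 := by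
  rw [← Iio_union_Ici (a := (0 : ℝ))]
  exact (measure_union_le _ _).trans (by rwa [h0, zero_add])

/-- The Laplace transform of a subprobability measure on `[0, ∞)` other than `δ₀` takes values in
the open unit disk. -/
theorem norm_laplace_lt_one {ν : Measure ℝ} (h0 : ν (Iio 0) = 0) (h1 : ν (Ici 0) ≤ 1)
    (hν : ν ≠ Measure.dirac 0) :
    ‖∫ s : ℝ, Complex.exp (-(2 * Real.pi) * s) ∂ν‖ < 1 := by
  have huniv := measure_univ_le_one h0 h1
  have : IsFiniteMeasure ν := ⟨huniv.trans_lt ENNReal.one_lt_top⟩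
  have hpos : ∀ᵐ s ∂ν, 0 ≤ s := by
    rw [ae_iff]; simpa [Iio] using h0
  have hreal : ∀ s : ℝ, Complex.exp (-(2 * Real.pi) * s)
      = ((Real.exp (-(2 * Real.pi * s)) : ℝ) : ℂ) := by
    intro s; push_cast; congr 1; ring
  simp_rw [hreal]
  rw [integral_complex_ofReal, Complex.norm_real,
    Real.norm_of_nonneg (integral_nonneg fun s => (Real.exp_pos _).le)]
  -- Otherwise the nonnegative function `1 - exp(-2πs)` has zero integral, so `ν` is carried by
  -- `{0}`; its total mass must then be `1`, and `ν = δ₀`.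
  by_contra! hge
  have hpi := Real.pi_pos
  have hint : Integrable (fun s : ℝ => Real.exp (-(2 * Real.pi * s))) ν := by
    refine (integrable_const (1 : ℝ)).mono' (Continuous.aestronglyMeasurable (by fun_prop)) ?_
    filter_upwards [hpos] with s hs
    rw [Real.norm_of_nonneg (Real.exp_pos _).le, Real.exp_le_one_iff]
    have : 0 ≤ 2 * Real.pi * s := by positivity
    linarith
  have hreal1 : ν.real univ ≤ 1 := by
    rw [Measure.real]
    exact ENNReal.toReal_le_of_le_ofReal one_pos.le (by simpa using huniv)
  have hnn : 0 ≤ᵐ[ν] fun s : ℝ => 1 - Real.exp (-(2 * Real.pi * s)) := by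
    filter_upwards [hpos] with s hs
    have : 0 ≤ 2 * Real.pi * s := by positivity
    simpa using this
  have hsum : ∫ s : ℝ, (1 - Real.exp (-(2 * Real.pi * s))) ∂ν
      = ν.real univ - ∫ s : ℝ, Real.exp (-(2 * Real.pi * s)) ∂ν := by
    rw [integral_sub (integrable_const _) hint]; simp
  have hzero : ∫ s : ℝ, (1 - Real.exp (-(2 * Real.pi * s))) ∂ν = 0 :=
    le_antisymm (by rw [hsum]; linarith) (integral_nonneg_of_ae hnn)
  have hae := (integral_eq_zero_iff_of_nonneg_ae hnn ((integrable_const _).sub hint)).1 hzero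
  have hs0 : ∀ᵐ s ∂ν, s ∈ ({0} : Set ℝ) := by
    filter_upwards [hae] with s hs
    have h2 : Real.exp (-(2 * Real.pi * s)) = 1 := by
      simp only [Pi.zero_apply] at hs; linarith
    rw [Real.exp_eq_one_iff] at h2
    have : s = 0 := by
      have := mul_eq_zero.1 (neg_eq_zero.1 h2)
      rcases this with h | h
      · linarith
      · exact h
    simpa using this
  have hres := Measure.restrict_eq_self_of_ae_mem hs0
  rw [Measure.restrict_singleton] at hres
  have hmass : ν univ = 1 := by
    have h3 : ν.real univ = 1 := le_antisymm hreal1 (by linarith)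
    rw [Measure.real] at h3
    rwa [ENNReal.toReal_eq_one_iff] at h3
  have hmass0 : ν {0} = 1 := by
    rw [← hmass]
    conv_rhs => rw [← hres]
    simp
  rw [hmass0, one_smul] at hres
  exact hν hres.symm

theorem pow_convOp_commute {μ : Measure ℝ} [IsFiniteMeasure μ] {M : LineL2 →L[ℂ] LineL2}
    (hM : ∀ s u, M (shift s u) = shift s (M u)) (j : ℕ) (u : LineL2) :
    M ((convOp μ ^ j) u) = (convOp μ ^ j) (M u) := by
  induction j with
  | zero => simp
  | succ j ih => rw [pow_succ', mul_apply_eq_comp, commute_convOp μ hM, ih, mul_apply_eq_comp]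

theorem convMeasure_lineConv (μ : Measure ℝ) [IsFiniteMeasure μ] (u v : LineL2) :
    convMeasure μ (lineConv u v) = lineConv u (convOp μ v) :=
  funext fun x => (lineConv_convOp μ u v x).symm

theorem exists_restriction_operators {ν : Measure ℝ} (h0 : ν (Iio 0) = 0) (h1 : ν (Ici 0) ≤ 1)
    (hν : ν ≠ Measure.dirac 0) {φ : ℝ → ℂ} (hc : Continuous φ) (hs : tsupport φ ⊆ Ici 0)
    (hφ : MemLp φ 2 (volume : Measure ℝ)) {C : ℝ}
    (hC : ∀ᵐ ξ : ℝ, ‖(𝓕⁻ (hφ.toLp φ) : Lp ℂ 2 (volume : Measure ℝ)) ξ‖ ≤ C / (1 + ξ ^ 2)) :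
    ∃ Φ₁ Φ₂ : SeqL2 →L[ℂ] HalfLineL2, ∀ (a : ℝ → ℂ) (A : HalfLineL2 →L[ℂ] HalfLineL2),
      LocallyIntegrableOn a (Ioi 0) → IsIntegralHankel a A → ∃ α : ℕ → ℂ,
        IsRestriction a (fun j => (convMeasure ν)^[j] φ) α ∧
        IsHankelMatrix α (adjoint Φ₂ ∘L A ∘L Φ₁) := by
  have huniv := measure_univ_le_one h0 h1
  have : IsFiniteMeasure ν := ⟨huniv.trans_lt ENNReal.one_lt_top⟩
  have hreal1 : ν.real univ ≤ 1 := by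
    rw [Measure.real]
    exact ENNReal.toReal_le_of_le_ofReal one_pos.le (by simpa using huniv)
  obtain ⟨m, hm, hg, hconv⟩ := exists_factorization hc hs hφ hC
  set f := expTwoPi with hf
  set M := multiplier hm with hM
  set T := convOp ν with hT
  have hTp : ∀ u ∈ plusSpace, T u ∈ plusSpace := fun u hu => convOp_mem_plusSpace ν h0 hu
  have hfp : f ∈ plusSpace := expTwoPi_mem_plusSpace
  obtain ⟨K, hK⟩ := norm_sum_orbit_sq_le (T := T)
    (fun u => (norm_convOp_le ν u).trans (mul_le_of_le_one_left (norm_nonneg u) hreal1))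
    hTp hfp (norm_laplace_lt_one h0 h1 hν) fun u hu => inner_expTwoPi_convOp ν h0 hu
  have hKR : ∀ (R : LineL2 →L[ℂ] HalfLineL2) (N : ℕ) (x : ℕ → ℂ),
      ‖∑ j ∈ Finset.range N, x j • R ((T ^ j) f)‖ ^ 2
        ≤ ‖R‖ ^ 2 * K * ∑ j ∈ Finset.range N, ‖x j‖ ^ 2 := by
    intro R N x
    have e : ∑ j ∈ Finset.range N, x j • R ((T ^ j) f)
        = R (∑ j ∈ Finset.range N, x j • (T ^ j) f) := by simp [map_sum]
    rw [e]
    calc _ ≤ (‖R‖ * ‖∑ j ∈ Finset.range N, x j • (T ^ j) f‖) ^ 2 := by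
          gcongr; exact R.le_opNorm _
      _ = ‖R‖ ^ 2 * ‖∑ j ∈ Finset.range N, x j • (T ^ j) f‖ ^ 2 := by ring
      _ ≤ ‖R‖ ^ 2 * (K * ∑ j ∈ Finset.range N, ‖x j‖ ^ 2) := by gcongr; exact hK N x
      _ = _ := by ring
  obtain ⟨Φ₁, hΦ₁⟩ := exists_synthesis (hKR restrictPos)
  -- Since `T^j M f = M T^j f`, this is `hKR` for `restrictPos ∘L M`, with conjugated coefficients.
  have hK2 : ∀ (N : ℕ) (x : ℕ → ℂ),
      ‖∑ j ∈ Finset.range N, x j • restrictPos (star ((T ^ j) (M f)))‖ ^ 2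
        ≤ ‖restrictPos ∘L M‖ ^ 2 * K * ∑ j ∈ Finset.range N, ‖x j‖ ^ 2 := by
    intro N x
    have e : ∑ j ∈ Finset.range N, x j • restrictPos (star ((T ^ j) (M f)))
        = star (∑ j ∈ Finset.range N, star (x j) • (restrictPos ∘L M) ((T ^ j) f)) := by
      rw [lp_star_sum]
      refine Finset.sum_congr rfl fun j _ => ?_
      rw [lp_star_smul, star_star, comp_apply, pow_convOp_commute (multiplier_shift hm),
        star_restrictPos]
    rw [e, lp_norm_star]
    refine (hKR (restrictPos ∘L M) N fun j => star (x j)).trans ?_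
    simp
  obtain ⟨Φ₂, hΦ₂⟩ := exists_synthesis hK2
  refine ⟨Φ₁, Φ₂, fun a A ha hA => ⟨fun j => halfLineForm A f ((T ^ j) (M f)),
    isRestriction_halfLineForm ha hA hTp (fun u v => convMeasure_lineConv ν u v) hfp hg
      (funext hconv), isHankelMatrix_of_single fun j k => ?_⟩⟩
  rw [adjoint_comp_comp_single (hΦ₁ j) (hΦ₂ k)]
  exact halfLineForm_pow_pow hTp (fun u hu v hv => halfLineForm_convOp ha hA hu hv ν h0) hfp hg j k

/-! ### Laplace transforms -/

theorem integral_exp_neg_mul_mul_pow {c : ℂ} (hc : 0 < c.re) (k : ℕ) :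
    IntegrableOn (fun t : ℝ => (t : ℂ) ^ k * Complex.exp (-c * t)) (Ioi 0) ∧
      ∫ t in Ioi (0 : ℝ), (t : ℂ) ^ k * Complex.exp (-c * t) = k.factorial / c ^ (k + 1) := by
  have hc0 : c ≠ 0 := fun h => by simp [h] at hc
  have hI : ∀ k : ℕ, IntegrableOn (fun t : ℝ => (t : ℂ) ^ k * Complex.exp (-c * t)) (Ioi 0) := by
    intro k
    have h := integrableOn_rpow_mul_exp_neg_mul_rpow (p := 1) (s := k) (b := c.re)
      (by linarith [Nat.cast_nonneg (α := ℝ) k]) one_pos hc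
    refine Integrable.mono' h (Continuous.aestronglyMeasurable (by fun_prop)) ?_
    filter_upwards [ae_restrict_mem measurableSet_Ioi] with t ht
    have ht0 : (0 : ℝ) < t := ht
    rw [norm_mul, norm_pow, Complex.norm_real, Real.norm_of_nonneg ht0.le, Complex.norm_exp,
      Real.rpow_one, Real.rpow_natCast]
    simp
  refine ⟨hI k, ?_⟩
  induction k with
  | zero =>
    have := integral_exp_mul_complex_Ioi (a := -c) (by simpa using hc) 0
    simp only [pow_zero, one_mul]
    rw [this]
    simp
  | succ k ih =>
    have hd : ∀ t ∈ Ici (0 : ℝ), HasDerivAt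
        (fun t : ℝ => (t : ℂ) ^ (k + 1) * Complex.exp (-c * t))
        (((k + 1 : ℕ) : ℂ) * ((t : ℂ) ^ k * Complex.exp (-c * t))
          - c * ((t : ℂ) ^ (k + 1) * Complex.exp (-c * t))) t := by
      intro t _
      have h1 : HasDerivAt (fun z : ℂ => z ^ (k + 1) * Complex.exp (-c * z))
          (((k + 1 : ℕ) : ℂ) * ((t : ℂ) ^ k * Complex.exp (-c * t))
          - c * ((t : ℂ) ^ (k + 1) * Complex.exp (-c * t))) (t : ℂ) := by
        have h2 := (hasDerivAt_pow (k + 1) (t : ℂ)).mul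
          (((hasDerivAt_id (t : ℂ)).const_mul (-c)).cexp)
        refine h2.congr_deriv ?_
        simp
        ring
      exact h1.comp_ofReal
    have hint : IntegrableOn (fun t : ℝ => ((k + 1 : ℕ) : ℂ) * ((t : ℂ) ^ k * Complex.exp (-c * t))
          - c * ((t : ℂ) ^ (k + 1) * Complex.exp (-c * t))) (Ioi 0) :=
      ((hI k).const_mul _).sub ((hI (k + 1)).const_mul _)
    have hinf : Tendsto (fun t : ℝ => (t : ℂ) ^ (k + 1) * Complex.exp (-c * t)) atTop (𝓝 0) := by
      have h := Real.tendsto_pow_mul_exp_neg_atTop_nhds_zero (k + 1)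
      have h2 := (h.comp (tendsto_id.const_mul_atTop hc)).const_mul ((c.re ^ (k + 1))⁻¹)
      rw [mul_zero] at h2
      refine squeeze_zero_norm' ?_ h2
      filter_upwards [eventually_gt_atTop 0] with t ht
      rw [norm_mul, norm_pow, Complex.norm_real, Real.norm_of_nonneg ht.le, Complex.norm_exp]
      simp only [Function.comp_apply, id, mul_pow]
      rw [mul_assoc, inv_mul_cancel_left₀ (by positivity)]
      simp
    have hzero := integral_Ioi_of_hasDerivAt_of_tendsto' hd hint hinf
    rw [integral_sub ((hI k).const_mul _) ((hI (k + 1)).const_mul _), integral_const_mul,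
      integral_const_mul, ih] at hzero
    simp only [Complex.ofReal_zero, ne_eq, Nat.add_eq_zero_iff, one_ne_zero, and_false,
      not_false_eq_true, zero_pow, zero_mul, sub_zero] at hzero
    rw [eq_div_iff (pow_ne_zero _ hc0)]
    have h3 := sub_eq_zero.1 hzero
    rw [pow_succ c (k + 1), ← mul_assoc, mul_right_comm, mul_comm _ c, ← h3, Nat.factorial_succ]
    push_cast
    field_simp

theorem lpPair_expLp {c : ℂ} (hc : 0 < c.re) (u : LineL2) :
    lpPair volume (expLp hc) u = ∫ t in Ioi (0 : ℝ), Complex.exp (-c * t) * u t := by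
  rw [lpPair_apply, ← integral_indicator measurableSet_Ioi]
  refine integral_congr_ae ?_
  filter_upwards [coeFn_expLp hc] with t ht
  rw [ht, expDecay]
  by_cases h : t ∈ Ioi (0 : ℝ)
  · rw [indicator_of_mem h, indicator_of_mem h]
  · rw [indicator_of_notMem h, indicator_of_notMem h, zero_mul]

theorem expDecay_add (c d : ℂ) (t : ℝ) : expDecay (c + d) t = expDecay c t * expDecay d t := by
  unfold expDecay
  by_cases h : t ∈ Ioi (0 : ℝ)
  · rw [indicator_of_mem h, indicator_of_mem h, indicator_of_mem h, ← Complex.exp_add]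
    congr 1; ring
  · rw [indicator_of_notMem h, indicator_of_notMem h, zero_mul]

theorem norm_expDecay_le {c : ℂ} (hc : 0 < c.re) (t : ℝ) : ‖expDecay c t‖ ≤ 1 := by
  unfold expDecay
  by_cases h : t ∈ Ioi (0 : ℝ)
  · have ht : (0 : ℝ) < t := h
    rw [indicator_of_mem h, Complex.norm_exp, Real.exp_le_one_iff]
    have : 0 < c.re * t := by positivity
    simpa using this.le
  · rw [indicator_of_notMem h]; simp

/-- A function in `L²(0, ∞)` is determined by its Laplace transform. -/
theorem eq_zero_of_laplace_eq_zero {u : LineL2} (hu : u ∈ plusSpace)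
    (h : ∀ (c : ℂ) (hc : 0 < c.re), lpPair volume (expLp hc) u = 0) : u = 0 := by
  have hm : MemLp (expDecay (2 * Real.pi)) ⊤ (volume : Measure ℝ) :=
    memLp_top_of_bound (memLp_expDecay two_pi_re_pos).1 1
      (Eventually.of_forall (norm_expDecay_le two_pi_re_pos))
  -- Multiplication by `exp(-2πt)` makes `u` integrable. The transform of `w` is then the Laplace
  -- transform of `u` along the line `Re c = 2π`, and Fourier uniqueness applies.
  set w := mulOp hm u with hw
  have hwint : Integrable w := by
    have h1 : Integrable fun x => expDecay (2 * Real.pi) x * u x :=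
      (memLp_expDecay two_pi_re_pos).integrable_mul (Lp.memLp u)
    exact h1.congr (coeFn_mulOp hm u).symm
  have hF : fourierInvL2 w = 0 := by
    apply Lp.ext
    filter_upwards [coeFn_fourierInvL2 hwint, Lp.coeFn_zero ℂ 2 (volume : Measure ℝ)] with ξ h1 h2
    rw [h1, h2, fourierInv_eq_modulation]
    have hre : 0 < (2 * Real.pi - 2 * Real.pi * ξ * Complex.I : ℂ).re := by
      simpa using Real.pi_pos
    have h3 := h _ hre
    rw [lpPair_expLp, ← integral_indicator measurableSet_Ioi] at h3
    rw [Pi.zero_apply, ← h3]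
    refine integral_congr_ae ?_
    filter_upwards [coeFn_mulOp hm u] with t ht
    rw [hw, ht, expDecay]
    by_cases h : t ∈ Ioi (0 : ℝ)
    · rw [indicator_of_mem h, indicator_of_mem h, modulation, ← mul_assoc, ← Complex.exp_add]
      congr 2; push_cast; ring
    · rw [indicator_of_notMem h, indicator_of_notMem h, zero_mul, mul_zero]
  have hw0 : w = 0 := by simpa using hF
  apply Lp.ext
  have h3 : ∀ᵐ x : ℝ, x ≠ 0 := by simp [ae_iff]
  filter_upwards [coeFn_mulOp hm u, Lp.coeFn_zero ℂ 2 (volume : Measure ℝ), mem_plusSpace.1 hu, h3]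
    with x h1 h2 h3 h4
  rcases lt_or_gt_of_ne h4 with h | h
  · rw [h3 h, h2, Pi.zero_apply]
  · rw [← hw, hw0, h2, Pi.zero_apply, expDecay, indicator_of_mem (mem_Ioi.2 h)] at h1
    rw [h2, Pi.zero_apply]
    exact (mul_eq_zero.1 h1.symm).resolve_left (Complex.exp_ne_zero _)

theorem eq_of_laplace_eq {u v : LineL2} (hu : u ∈ plusSpace) (hv : v ∈ plusSpace)
    (h : ∀ (c : ℂ) (hc : 0 < c.re), lpPair volume (expLp hc) u = lpPair volume (expLp hc) v) :
    u = v :=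
  sub_eq_zero.1 <| eq_zero_of_laplace_eq_zero (sub_mem hu hv) fun c hc => by
    rw [map_sub, h c hc, sub_self]

theorem lpPair_expLp_expLp {c d : ℂ} (hc : 0 < c.re) (hd : 0 < d.re) :
    lpPair volume (expLp hc) (expLp hd) = (c + d)⁻¹ := by
  have hcd : (-(c + d)).re < 0 := by simp; linarith
  rw [lpPair_apply]
  have h : ∫ x, expLp hc x * expLp hd x = ∫ x, expDecay (c + d) x := by
    refine integral_congr_ae ?_
    filter_upwards [coeFn_expLp hc, coeFn_expLp hd] with x h1 h2
    rw [h1, h2, expDecay_add]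
  rw [h]
  unfold expDecay
  rw [integral_indicator measurableSet_Ioi, integral_exp_mul_complex_Ioi hcd]
  rw [Complex.ofReal_zero, mul_zero, Complex.exp_zero, neg_div_neg_eq, one_div]

/-! ### The Laguerre operator -/

/-- The measure `exp(-2πs) ds` on `(0, ∞)`. -/
noncomputable def expMeasure : Measure ℝ :=
  (volume.restrict (Ioi 0)).withDensity fun s => ENNReal.ofReal (Real.exp (-2 * Real.pi * s))

theorem integral_expMeasure (F : ℝ → ℂ) :
    ∫ s, F s ∂expMeasure = ∫ s in Ioi (0 : ℝ), (Real.exp (-2 * Real.pi * s) : ℂ) * F s := by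
  rw [expMeasure, integral_withDensity_eq_integral_toReal_smul (by fun_prop) (by simp)]
  refine integral_congr_ae (Eventually.of_forall fun s => ?_)
  beta_reduce
  rw [ENNReal.toReal_ofReal (Real.exp_pos _).le, Complex.real_smul]

instance : IsFiniteMeasure expMeasure := by
  refine isFiniteMeasure_withDensity_ofReal ?_
  have := integrableOn_exp_mul_Ioi (a := -2 * Real.pi) (by linarith [Real.pi_pos]) 0
  exact this.2

theorem expMeasure_Iio : expMeasure (Iio 0) = 0 := by
  refine withDensity_absolutelyContinuous _ _ ?_
  rw [Measure.restrict_apply measurableSet_Iio, inter_comm, Ioi_inter_Iio, Ioo_self, measure_empty]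

theorem integral_exp_expMeasure {c : ℂ} (hc : 0 < (c + 2 * Real.pi).re) :
    ∫ s : ℝ, Complex.exp (-c * s) ∂expMeasure = (c + 2 * Real.pi)⁻¹ := by
  have h := integral_exp_mul_complex_Ioi (a := -(c + 2 * Real.pi)) (by rw [Complex.neg_re]; linarith) 0
  rw [Complex.ofReal_zero, mul_zero, Complex.exp_zero, neg_div_neg_eq, one_div] at h
  rw [integral_expMeasure, ← h]
  refine integral_congr_ae (Eventually.of_forall fun s => ?_)
  simp only
  rw [Complex.ofReal_exp, ← Complex.exp_add]
  congr 1; push_cast; ring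

/-- Convolution with `δ₀ - 4π exp(-2πs) 1_{s > 0} ds` on `L²(ℝ)`. -/
noncomputable def laguerreOp : LineL2 →L[ℂ] LineL2 :=
  ContinuousLinearMap.id ℂ LineL2 - (4 * Real.pi : ℂ) • convOp expMeasure

theorem laguerreOp_apply (u : LineL2) :
    laguerreOp u = u - (4 * Real.pi : ℂ) • convOp expMeasure u := rfl

attribute [irreducible] laguerreOp

theorem laguerreConv_lineConv (u v : LineL2) :
    laguerreConv (lineConv u v) = lineConv u (laguerreOp v) := by
  funext x
  have h : lineConv u (laguerreOp v) x
      = lineConv u v x - 4 * Real.pi * lineConv u (convOp expMeasure v) x := by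
    rw [laguerreOp_apply, sub_eq_add_neg, ← neg_smul, lineConv_add_right, lineConv_smul_right]
    ring
  rw [h, lineConv_convOp, integral_expMeasure, laguerreConv]

theorem laguerreOp_mem_plusSpace {u : LineL2} (hu : u ∈ plusSpace) : laguerreOp u ∈ plusSpace := by
  rw [laguerreOp_apply]
  exact sub_mem hu (Submodule.smul_mem _ _ (convOp_mem_plusSpace _ expMeasure_Iio hu))

theorem ne_zero_of_re_pos {c : ℂ} (hc : 0 < c.re) : c ≠ 0 := fun h => by simp [h] at hc

theorem re_add_two_pi_pos {c : ℂ} (hc : 0 < c.re) : 0 < (c + 2 * Real.pi).re := by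
  rw [Complex.add_re]; exact add_pos hc two_pi_re_pos

/-- The factor is `1 - 4π / (c + 2π)`, the Blaschke factor of the right half-plane with its zero at
`c = 2π`. -/
theorem lpPair_expLp_laguerreOp {c : ℂ} (hc : 0 < c.re) {u : LineL2} (hu : u ∈ plusSpace) :
    lpPair volume (expLp hc) (laguerreOp u)
      = (c - 2 * Real.pi) / (c + 2 * Real.pi) * lpPair volume (expLp hc) u := by
  have h0 := ne_zero_of_re_pos (re_add_two_pi_pos hc)
  rw [laguerreOp_apply, map_sub, map_smul, lpPair_expLp_convOp _ expMeasure_Iio hc hu,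
    integral_exp_expMeasure (re_add_two_pi_pos hc), smul_eq_mul, div_mul_eq_mul_div,
    eq_div_iff h0, sub_mul, mul_assoc, mul_right_comm (c + 2 * Real.pi)⁻¹, inv_mul_cancel₀ h0]
  ring

theorem lpPair_expLp_laguerreOp_pow {c : ℂ} (hc : 0 < c.re) {u : LineL2} (hu : u ∈ plusSpace)
    (n : ℕ) :
    lpPair volume (expLp hc) ((laguerreOp ^ n) u)
      = ((c - 2 * Real.pi) / (c + 2 * Real.pi)) ^ n * lpPair volume (expLp hc) u := by
  induction n with
  | zero => simp
  | succ n ih =>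
    rw [pow_succ', mul_apply_eq_comp, lpPair_expLp_laguerreOp hc
      (pow_mem_plusSpace (fun _ => laguerreOp_mem_plusSpace) hu n), ih]
    ring

/-- The Blaschke factor vanishes at `2π`, so `exp(-2πt)` is a wandering vector for `laguerreOp`. -/
theorem inner_expTwoPi_laguerreOp {u : LineL2} (hu : u ∈ plusSpace) :
    inner ℂ expTwoPi (laguerreOp u) = 0 := by
  rw [inner_expTwoPi, expTwoPi, lpPair_expLp_laguerreOp two_pi_re_pos hu, sub_self, zero_div,
    zero_mul]

/-- With `w = 2π - 2πiξ`, the Fourier symbol is `1 - 4π / w`, the negative of the conjugate of `w`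
divided by `w`. It has modulus one. -/
theorem norm_laguerreOp (u : LineL2) : ‖laguerreOp u‖ = ‖u‖ := by
  set m : ℝ → ℂ := fun ξ => (2 * Real.pi - 2 * Real.pi * ξ * Complex.I)⁻¹ with hmdef
  have hre : ∀ ξ : ℝ, (2 * Real.pi - 2 * Real.pi * ξ * Complex.I : ℂ) ≠ 0 := fun ξ =>
    ne_zero_of_re_pos (by simpa using Real.pi_pos)
  have hmc : Continuous m := by
    refine Continuous.inv₀ (by fun_prop) hre
  have hn : ∀ ξ : ℝ, ‖1 - 4 * Real.pi * m ξ‖ = 1 := by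
    intro ξ
    have h : 1 - 4 * Real.pi * m ξ
        = -((starRingEnd ℂ) (2 * Real.pi - 2 * Real.pi * ξ * Complex.I))
          / (2 * Real.pi - 2 * Real.pi * ξ * Complex.I) := by
      rw [hmdef, eq_div_iff (hre ξ)]
      rw [sub_mul, mul_assoc (4 * Real.pi : ℂ), inv_mul_cancel₀ (hre ξ)]
      simp [Complex.conj_ofNat]
      ring
    rw [h, norm_div, norm_neg, Complex.norm_conj, div_self (norm_ne_zero_iff.2 (hre ξ))]
  have hm' : MemLp (fun ξ => 1 - 4 * Real.pi * m ξ) ⊤ volume :=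
    memLp_top_of_bound (Continuous.aestronglyMeasurable (by fun_prop)) 1
      (Eventually.of_forall fun ξ => (hn ξ).le)
  have hm : MemLp m ⊤ volume := by
    refine memLp_top_of_bound hmc.aestronglyMeasurable 1 (Eventually.of_forall fun ξ => ?_)
    rw [hmdef, norm_inv]
    refine inv_le_one_of_one_le₀ (le_trans ?_ (Complex.abs_re_le_norm _))
    have : (1 : ℝ) ≤ 2 * Real.pi := by linarith [Real.pi_gt_three]
    simpa [abs_of_pos Real.pi_pos] using this
  have hmμ : ∀ ξ, m ξ = ∫ s, modulation (2 * Real.pi * s) ξ ∂expMeasure := by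
    intro ξ
    have h := integral_exp_expMeasure (c := -(2 * Real.pi * ξ * Complex.I)) (by
      simpa using Real.pi_pos)
    rw [hmdef]
    simp only
    rw [sub_eq_neg_add, ← h]
    refine integral_congr_ae (Eventually.of_forall fun s => ?_)
    simp only [modulation]
    congr 1; push_cast; ring
  have hF : fourierInvL2 (laguerreOp u) = mulOp hm' (fourierInvL2 u) := by
    rw [laguerreOp_apply, map_sub, map_smul, fourierInvL2_convOp _ hm hmμ]
    apply Lp.ext
    filter_upwards [Lp.coeFn_sub (fourierInvL2 u)
      ((4 * Real.pi : ℂ) • mulOp hm (fourierInvL2 u)),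
      Lp.coeFn_smul (4 * Real.pi : ℂ) (mulOp hm (fourierInvL2 u)),
      coeFn_mulOp hm (fourierInvL2 u), coeFn_mulOp hm' (fourierInvL2 u)] with ξ h1 h2 h3 h4
    rw [h1, h4, Pi.sub_apply, h2, Pi.smul_apply, h3, smul_eq_mul]
    ring
  rw [← fourierInvL2.norm_map, hF, norm_mulOp_of_norm_eq_one hm' (Eventually.of_forall hn),
    fourierInvL2.norm_map]

theorem inner_laguerreOp (u v : LineL2) : inner ℂ (laguerreOp u) (laguerreOp v) = inner ℂ u v :=
  LinearIsometry.inner_map_map (⟨laguerreOp.toLinearMap, norm_laguerreOp⟩ : LineL2 →ₗᵢ[ℂ] LineL2) u v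

theorem inner_laguerreOp_pow (n : ℕ) (u v : LineL2) :
    inner ℂ ((laguerreOp ^ n) u) ((laguerreOp ^ n) v) = inner ℂ u v := by
  induction n with
  | zero => simp
  | succ n ih => rw [pow_succ', mul_apply_eq_comp, mul_apply_eq_comp, inner_laguerreOp, ih]

/-- The isometry cancels the common power `m`; what remains pairs `exp(-2πt)` with the range of
`laguerreOp`. -/
theorem inner_laguerreOp_pow_of_lt {m n : ℕ} (h : m < n) :
    inner ℂ ((laguerreOp ^ m) expTwoPi) ((laguerreOp ^ n) expTwoPi) = 0 := by
  obtain ⟨k, rfl⟩ := Nat.exists_eq_add_of_lt h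
  rw [add_assoc, pow_add, mul_apply_eq_comp, inner_laguerreOp_pow, pow_succ', mul_apply_eq_comp]
  exact inner_expTwoPi_laguerreOp
    (pow_mem_plusSpace (fun _ => laguerreOp_mem_plusSpace) expTwoPi_mem_plusSpace k)

theorem inner_expTwoPi_self : inner ℂ expTwoPi expTwoPi = (4 * Real.pi : ℂ)⁻¹ := by
  rw [inner_expTwoPi, expTwoPi, lpPair_expLp_expLp]
  congr 1; ring

/-! ### Laguerre functions -/

/-- The function `t^k exp(-2πt)` on `(0, ∞)`, extended by zero. -/
noncomputable def powExp (k : ℕ) : ℝ → ℂ :=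
  (Ioi (0 : ℝ)).indicator fun t => (t : ℂ) ^ k * Complex.exp (-(2 * Real.pi) * t)

theorem memLp_powExp (k : ℕ) : MemLp (powExp k) 2 volume := by
  have hpi : 0 < (Real.pi : ℂ).re := by simpa using Real.pi_pos
  refine (memLp_expDecay hpi).of_le_mul (c := k.factorial) ?_ (Eventually.of_forall fun t => ?_)
  · exact (Continuous.aestronglyMeasurable (by fun_prop)).indicator measurableSet_Ioi
  · unfold powExp expDecay
    by_cases h : t ∈ Ioi (0 : ℝ)
    · have ht : (0 : ℝ) < t := h
      rw [indicator_of_mem h, indicator_of_mem h, norm_mul, norm_pow, Complex.norm_real,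
        Real.norm_of_nonneg ht.le, Complex.norm_exp, Complex.norm_exp]
      have h1 : (-(2 * Real.pi) * t : ℂ).re = -(2 * Real.pi) * t := by simp
      have h2 : (-(Real.pi : ℂ) * t).re = -Real.pi * t := by simp
      rw [h1, h2]
      have h3 : t ^ k ≤ k.factorial * Real.exp t := by
        have := Real.pow_div_factorial_le_exp t ht.le k
        rwa [div_le_iff₀' (by positivity)] at this
      calc t ^ k * Real.exp (-(2 * Real.pi) * t)
          ≤ k.factorial * Real.exp t * Real.exp (-(2 * Real.pi) * t) := by gcongr
        _ = k.factorial * Real.exp (t + -(2 * Real.pi) * t) := by rw [Real.exp_add, mul_assoc]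
        _ ≤ k.factorial * Real.exp (-Real.pi * t) := by
          gcongr
          nlinarith [Real.pi_gt_three]
    · rw [indicator_of_notMem h, indicator_of_notMem h]; simp

/-- The function `t^k exp(-2πt)` on `(0, ∞)` as an element of `L²(ℝ)`. -/
noncomputable def powExpLp (k : ℕ) : LineL2 := (memLp_powExp k).toLp _

theorem coeFn_powExpLp (k : ℕ) : powExpLp k =ᵐ[volume] powExp k := (memLp_powExp k).coeFn_toLp

theorem powExpLp_mem_plusSpace (k : ℕ) : powExpLp k ∈ plusSpace := by
  rw [mem_plusSpace]
  filter_upwards [coeFn_powExpLp k] with x hx h0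
  rw [hx, powExp, indicator_of_notMem (by simpa using h0.le)]

theorem lpPair_expLp_powExpLp {c : ℂ} (hc : 0 < c.re) (k : ℕ) :
    lpPair volume (expLp hc) (powExpLp k) = k.factorial / (c + 2 * Real.pi) ^ (k + 1) := by
  rw [lpPair_expLp, ← (integral_exp_neg_mul_mul_pow (re_add_two_pi_pos hc) k).2]
  refine integral_congr_ae ?_
  filter_upwards [ae_restrict_of_ae (coeFn_powExpLp k), ae_restrict_mem measurableSet_Ioi]
    with t h1 h2
  rw [h1, powExp, indicator_of_mem h2, mul_left_comm, ← Complex.exp_add]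
  congr 2; ring

/-- Both sides have the Laplace transform `(1 - 4π / (c + 2π))^n / (c + 2π)`, and its binomial
expansion matches the sum term by term. -/
theorem laguerreOp_pow_expTwoPi (n : ℕ) :
    (laguerreOp ^ n) expTwoPi = ∑ k ∈ Finset.range (n + 1),
      ((n.choose k : ℂ) * (-(4 * Real.pi)) ^ k / k.factorial) • powExpLp k := by
  refine eq_of_laplace_eq (pow_mem_plusSpace (fun _ => laguerreOp_mem_plusSpace)
    expTwoPi_mem_plusSpace n) (sum_mem fun k _ => Submodule.smul_mem _ _ (powExpLp_mem_plusSpace k))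
    fun c hc => ?_
  have h0 := ne_zero_of_re_pos (re_add_two_pi_pos hc)
  rw [lpPair_expLp_laguerreOp_pow hc expTwoPi_mem_plusSpace, expTwoPi, lpPair_expLp_expLp, map_sum]
  have h1 : (c - 2 * Real.pi) / (c + 2 * Real.pi) = -(4 * Real.pi) / (c + 2 * Real.pi) + 1 := by
    rw [div_add_one h0]; congr 1; ring
  rw [h1, add_pow, Finset.sum_mul]
  refine Finset.sum_congr rfl fun k _ => ?_
  rw [map_smul, lpPair_expLp_powExpLp, smul_eq_mul, one_pow, mul_one, div_pow, pow_succ]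
  have : (k.factorial : ℂ) ≠ 0 := by exact_mod_cast k.factorial_ne_zero
  field_simp

theorem coeFn_laguerreOp_pow_expTwoPi (n : ℕ) :
    (laguerreOp ^ n) expTwoPi =ᵐ[volume.restrict (Ioi 0)] fun t =>
      ((laguerrePoly n (4 * Real.pi * t) * Real.exp (-2 * Real.pi * t) : ℝ) : ℂ) := by
  rw [laguerreOp_pow_expTwoPi]
  have h1 : ∀ᵐ t : ℝ, ∀ k : ℕ, ((((n.choose k : ℂ) * (-(4 * Real.pi)) ^ k / k.factorial) •
      powExpLp k : LineL2) : ℝ → ℂ) t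
        = ((n.choose k : ℂ) * (-(4 * Real.pi)) ^ k / k.factorial) * powExp k t := by
    refine ae_all_iff.2 fun k => ?_
    filter_upwards [coeFn_powExpLp k, Lp.coeFn_smul
      ((n.choose k : ℂ) * (-(4 * Real.pi)) ^ k / k.factorial) (powExpLp k)] with t h1 h2
    rw [h2, Pi.smul_apply, h1, smul_eq_mul]
  filter_upwards [ae_restrict_of_ae (Lp.coeFn_finsetSum (Finset.range (n + 1)) fun k =>
    ((n.choose k : ℂ) * (-(4 * Real.pi)) ^ k / k.factorial) • powExpLp k),
    ae_restrict_of_ae h1, ae_restrict_mem measurableSet_Ioi] with t h2 h3 h4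
  rw [h2, Finset.sum_apply, laguerrePoly, Finset.sum_mul, Complex.ofReal_sum]
  refine Finset.sum_congr rfl fun k _ => ?_
  rw [h3 k, powExp, indicator_of_mem h4]
  push_cast
  rw [show (-(4 * Real.pi * t) : ℂ) = -(4 * Real.pi) * t by ring, mul_pow, neg_mul, neg_mul, neg_mul]
  ring

theorem norm_sub_two_pi_div_lt_one {d : ℂ} (hd : 0 < d.re) :
    ‖(d - 2 * Real.pi) / (d + 2 * Real.pi)‖ < 1 := by
  have h0 := ne_zero_of_re_pos (re_add_two_pi_pos hd)
  rw [norm_div, div_lt_one (norm_pos_iff.2 h0)]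
  refine lt_of_pow_lt_pow_left₀ 2 (norm_nonneg _) ?_
  rw [← Complex.normSq_eq_norm_sq, ← Complex.normSq_eq_norm_sq, Complex.normSq_apply,
    Complex.normSq_apply]
  have := mul_pos hd Real.pi_pos
  simp
  nlinarith

/-- The exponentials lie in the closed span of the orbit of `exp(-2πt)` under `laguerreOp`. -/
theorem hasSum_laguerreOp_pow {d : ℂ} (hd : 0 < d.re) :
    HasSum (fun n : ℕ => ((d - 2 * Real.pi) / (d + 2 * Real.pi)) ^ n • (laguerreOp ^ n) expTwoPi)
      (((d + 2 * Real.pi) / (4 * Real.pi)) • expLp hd) := by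
  have hpi : (Real.pi : ℂ) ≠ 0 := by exact_mod_cast Real.pi_ne_zero
  have hd0 := ne_zero_of_re_pos (re_add_two_pi_pos hd)
  set z := (d - 2 * Real.pi) / (d + 2 * Real.pi) with hz
  have hz1 : ‖z‖ < 1 := norm_sub_two_pi_div_lt_one hd
  have hmem : ∀ n : ℕ, (laguerreOp ^ n) expTwoPi ∈ plusSpace :=
    pow_mem_plusSpace (fun _ => laguerreOp_mem_plusSpace) expTwoPi_mem_plusSpace
  have hnorm : ∀ n : ℕ, ‖(laguerreOp ^ n) expTwoPi‖ = ‖expTwoPi‖ := by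
    intro n
    induction n with
    | zero => simp
    | succ n ih => rw [pow_succ', mul_apply_eq_comp, norm_laguerreOp, ih]
  have hs : Summable fun n : ℕ => z ^ n • (laguerreOp ^ n) expTwoPi := by
    refine Summable.of_norm ?_
    simp_rw [norm_smul, hnorm, norm_pow]
    exact (summable_geometric_of_lt_one (norm_nonneg z) hz1).mul_right _
  convert hs.hasSum
  -- With `z` and `w` the Blaschke factors at `d` and `c`, the Laplace transform of the series is
  -- geometric with ratio `z * w`. Its sum is a multiple of `1 / (c + d)`, the transform of an
  -- exponential.
  refine eq_of_laplace_eq (Submodule.smul_mem _ _ (expLp_mem_plusSpace hd))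
    (isClosed_plusSpace.mem_of_tendsto hs.hasSum (Eventually.of_forall fun s =>
      sum_mem fun n _ => Submodule.smul_mem _ _ (hmem n))) fun c hc => ?_
  have hc0 := ne_zero_of_re_pos (re_add_two_pi_pos hc)
  have hcd : c + d ≠ 0 := ne_zero_of_re_pos (by rw [Complex.add_re]; exact add_pos hc hd)
  have hw1 := norm_sub_two_pi_div_lt_one hc
  set w := (c - 2 * Real.pi) / (c + 2 * Real.pi) with hw
  have h1 := (lpPair volume (expLp hc)).hasSum hs.hasSum
  have h2 : HasSum (fun n : ℕ => lpPair volume (expLp hc) (z ^ n • (laguerreOp ^ n) expTwoPi))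
      ((1 - z * w)⁻¹ * (c + 2 * Real.pi)⁻¹) := by
    have h3 : ‖z * w‖ < 1 := by
      rw [norm_mul]; exact mul_lt_one_of_nonneg_of_lt_one_left (norm_nonneg _) hz1 hw1.le
    refine ((hasSum_geometric_of_norm_lt_one h3).mul_right (c + 2 * Real.pi)⁻¹).congr_fun fun n => ?_
    rw [map_smul, lpPair_expLp_laguerreOp_pow hc expTwoPi_mem_plusSpace, expTwoPi,
      lpPair_expLp_expLp, smul_eq_mul, mul_pow, mul_assoc]
  rw [h1.unique h2, map_smul, lpPair_expLp_expLp, smul_eq_mul, ← mul_inv]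
  have h4 : (1 - z * w) * (c + 2 * Real.pi) = 4 * Real.pi * (c + d) / (d + 2 * Real.pi) := by
    rw [hz, hw]; field_simp; ring
  rw [h4, inv_div, ← div_eq_mul_inv, div_div]

/-- A vector orthogonal to the orbit is orthogonal to every decaying exponential, so its Laplace
transform vanishes. The exponent is conjugated because the inner product is. -/
theorem eq_zero_of_inner_laguerreOp_pow {u : LineL2} (hu : u ∈ plusSpace)
    (h : ∀ n : ℕ, inner ℂ ((laguerreOp ^ n) expTwoPi) u = 0) : u = 0 := by
  refine eq_zero_of_laplace_eq_zero hu fun c hc => ?_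
  have hd : 0 < (starRingEnd ℂ c).re := by simpa using hc
  have h1 := (hasSum_laguerreOp_pow hd).mapL (innerSL ℂ u)
  have h2 : ∀ n : ℕ, innerSL ℂ u ((laguerreOp ^ n) expTwoPi) = 0 := fun n => by
    rw [innerSL_apply_apply, ← inner_conj_symm, h, map_zero]
  simp only [map_smul, h2, smul_zero] at h1
  have h3 := h1.unique hasSum_zero
  have hpi : (4 * Real.pi : ℂ) ≠ 0 := by simp
  have h4 := (smul_eq_zero.1 h3).resolve_left
    (div_ne_zero (ne_zero_of_re_pos (re_add_two_pi_pos hd)) hpi)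
  rw [innerSL_apply_apply, ← inner_conj_symm, map_eq_zero, ← lpPair_star,
    star_expLp hd (by simpa using hc)] at h4
  simpa only [Complex.conj_conj] using h4

/-- The normalized orbit of `exp(-2πt)` under `laguerreOp`. -/
noncomputable def laguerreVec (n : ℕ) : LineL2 :=
  (-2 * Complex.I * (√Real.pi : ℂ)) • (laguerreOp ^ n) expTwoPi

theorem laguerreVec_mem_plusSpace (n : ℕ) : laguerreVec n ∈ plusSpace :=
  Submodule.smul_mem _ _
    (pow_mem_plusSpace (fun _ => laguerreOp_mem_plusSpace) expTwoPi_mem_plusSpace n)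

theorem coeFn_restrictPos_laguerreVec (n : ℕ) :
    restrictPos (laguerreVec n) =ᵐ[volume.restrict (Ioi 0)] laguerreFun n := by
  filter_upwards [coeFn_restrictPos (laguerreVec n), coeFn_laguerreOp_pow_expTwoPi n,
    ae_restrict_of_ae (Lp.coeFn_smul (-2 * Complex.I * (√Real.pi : ℂ))
      ((laguerreOp ^ n) expTwoPi))] with t h1 h2 h3
  rw [h1, laguerreVec, h3, Pi.smul_apply, h2, laguerreFun, smul_eq_mul]
  push_cast
  ring

/-- The squared modulus `4π` of the constant `-2i√π` cancels `‖exp(-2πt)‖² = 1 / (4π)`. -/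
theorem orthonormal_restrictPos_laguerreVec :
    Orthonormal ℂ fun n => restrictPos (laguerreVec n) := by
  have hin : ∀ m n, inner ℂ (restrictPos (laguerreVec m)) (restrictPos (laguerreVec n))
      = 4 * Real.pi * inner ℂ ((laguerreOp ^ m) expTwoPi) ((laguerreOp ^ n) expTwoPi) := by
    intro m n
    rw [inner_restrictPos (laguerreVec_mem_plusSpace n), laguerreVec, laguerreVec, inner_smul_left,
      inner_smul_right, ← mul_assoc]
    congr 1
    have : (√Real.pi : ℂ) * √Real.pi = Real.pi := by
      rw [← Complex.ofReal_mul, Real.mul_self_sqrt Real.pi_pos.le]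
    simp only [map_mul, map_neg, Complex.conj_I, Complex.conj_ofReal, Complex.conj_ofNat]
    linear_combination (-4 * Complex.I ^ 2) * this - 4 * Real.pi * Complex.I_sq
  have hpi : (4 * Real.pi : ℂ) ≠ 0 := by simp
  rw [orthonormal_iff_ite]
  intro m n
  rw [hin]
  rcases lt_trichotomy m n with h | rfl | h
  · rw [inner_laguerreOp_pow_of_lt h, mul_zero, if_neg h.ne]
  · rw [inner_laguerreOp_pow, inner_expTwoPi_self, mul_inv_cancel₀ hpi, if_pos rfl]
  · rw [← inner_conj_symm, inner_laguerreOp_pow_of_lt h, map_zero, mul_zero, if_neg h.ne']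

theorem orthogonal_span_laguerreVec :
    (Submodule.span ℂ (range fun n => restrictPos (laguerreVec n)))ᗮ = ⊥ := by
  rw [Submodule.eq_bot_iff]
  intro h hh
  obtain ⟨u, hu, rfl⟩ := exists_restrictPos_eq h
  have : u = 0 := by
    refine eq_zero_of_inner_laguerreOp_pow hu fun n => ?_
    have h1 := (Submodule.mem_orthogonal _ _).1 hh _ (Submodule.subset_span (mem_range_self n))
    rw [inner_restrictPos hu, laguerreVec, inner_smul_left] at h1
    refine (mul_eq_zero.1 h1).resolve_left ?_
    have : (√Real.pi : ℂ) ≠ 0 := by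
      exact_mod_cast (Real.sqrt_pos.2 Real.pi_pos).ne'
    simpa using this
  rw [this, map_zero]

/-- The unitary operator taking the standard basis to the Laguerre functions. -/
noncomputable def laguerreUnitary : SeqL2 ≃ₗᵢ[ℂ] HalfLineL2 :=
  (HilbertBasis.mkOfOrthogonalEqBot orthonormal_restrictPos_laguerreVec
    orthogonal_span_laguerreVec).repr.symm

theorem laguerreUnitary_single (n : ℕ) :
    laguerreUnitary (lp.single 2 n (1 : ℂ)) = restrictPos (laguerreVec n) := by
  rw [laguerreUnitary, HilbertBasis.repr_symm_single, HilbertBasis.coe_mkOfOrthogonalEqBot]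

theorem star_restrictPos_laguerreOp_pow (n : ℕ) :
    star (restrictPos ((laguerreOp ^ n) expTwoPi)) = restrictPos ((laguerreOp ^ n) expTwoPi) := by
  apply Lp.ext
  filter_upwards [Lp.coeFn_star (restrictPos ((laguerreOp ^ n) expTwoPi)),
    coeFn_restrictPos ((laguerreOp ^ n) expTwoPi), coeFn_laguerreOp_pow_expTwoPi n] with t h1 h2 h3
  rw [h1, Pi.star_apply, h2, h3, RCLike.star_def, Complex.conj_ofReal]

/-- The explicit counterpart of `exists_factorization`: `f ∗ f` is `x exp(-2πx)` for `x ≥ 0`, so `g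
= -4π f`. -/
theorem lineConv_expTwoPi : lineConv expTwoPi ((-(4 * Real.pi) : ℂ) • expTwoPi) = laguerreWeight := by
  funext x
  rw [lineConv_smul_right, lineConv_eq_integral]
  have h : ∫ t, expTwoPi t * expTwoPi (x - t)
      = ∫ t, (Ioo 0 x).indicator (fun _ => Complex.exp (-(2 * Real.pi) * x)) t := by
    refine integral_congr_ae ?_
    filter_upwards [coeFn_expLp two_pi_re_pos, ae_comp_sub_left (coeFn_expLp two_pi_re_pos) x]
      with t h1 h2
    rw [expTwoPi, h1, h2, expDecay]
    by_cases ht : t ∈ Ioo 0 x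
    · rw [indicator_of_mem ht, indicator_of_mem (mem_Ioi.2 ht.1),
        indicator_of_mem (mem_Ioi.2 (sub_pos.2 ht.2)), ← Complex.exp_add]
      congr 1; push_cast; ring
    · rw [indicator_of_notMem ht]
      by_cases h0 : 0 < t
      · have : x - t ∉ Ioi (0 : ℝ) := fun h => ht ⟨h0, sub_pos.1 h⟩
        rw [indicator_of_notMem this, mul_zero]
      · rw [indicator_of_notMem (s := Ioi (0 : ℝ)) h0, zero_mul]
  rw [h, integral_indicator measurableSet_Ioo, setIntegral_const, laguerreWeight, Real.volume_real_Ioo]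
  split_ifs with hx
  · rw [sub_zero, max_eq_left hx, Complex.real_smul]
    push_cast
    rw [neg_mul (2 : ℂ)]
    ring
  · rw [sub_zero, max_eq_right (not_le.1 hx).le, zero_smul, mul_zero]

theorem halfLineForm_laguerreOp {a : ℝ → ℂ} {A : HalfLineL2 →L[ℂ] HalfLineL2}
    (ha : LocallyIntegrableOn a (Ioi 0)) (hA : IsIntegralHankel a A) {u v : LineL2}
    (hu : u ∈ plusSpace) (hv : v ∈ plusSpace) :
    halfLineForm A (laguerreOp u) v = halfLineForm A u (laguerreOp v) := by
  rw [laguerreOp_apply, laguerreOp_apply, map_sub, map_sub, map_smul, map_smul, sub_apply,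
    smul_apply, halfLineForm_convOp ha hA hu hv expMeasure expMeasure_Iio]

theorem exists_laguerre_restriction {a : ℝ → ℂ} {A : HalfLineL2 →L[ℂ] HalfLineL2}
    (ha : LocallyIntegrableOn a (Ioi 0)) (hA : IsIntegralHankel a A) :
    ∃ α : ℕ → ℂ, IsRestriction a (fun j => laguerreConv^[j] laguerreWeight) α ∧
      IsHankelMatrix α (adjoint (-(laguerreUnitary : SeqL2 →L[ℂ] HalfLineL2)) ∘L A ∘L
        (laguerreUnitary : SeqL2 →L[ℂ] HalfLineL2)) := by
  have hT : ∀ u ∈ plusSpace, laguerreOp u ∈ plusSpace := fun u => laguerreOp_mem_plusSpace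
  have hg : (-(4 * Real.pi) : ℂ) • expTwoPi ∈ plusSpace :=
    Submodule.smul_mem _ _ expTwoPi_mem_plusSpace
  refine ⟨_, isRestriction_halfLineForm ha hA hT laguerreConv_lineConv expTwoPi_mem_plusSpace hg
    lineConv_expTwoPi, isHankelMatrix_of_single fun j k => ?_⟩
  -- As `κ` is purely imaginary and the Laguerre functions are real, conjugation changes the sign of
  -- `κ`; this explains `Φ₂ = -U`. Moreover `κ² = -4π` is precisely the constant in `g`.
  set κ : ℂ := -2 * Complex.I * (√Real.pi : ℂ) with hκ
  have h₂ : (-(laguerreUnitary : SeqL2 →L[ℂ] HalfLineL2)) (lp.single 2 k (1 : ℂ))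
      = restrictPos (star (κ • (laguerreOp ^ k) expTwoPi)) := by
    have h3 : star κ = -κ := by
      simp [hκ, Complex.conj_ofReal]
    rw [lp_star_smul, h3, map_smul, ← star_restrictPos, star_restrictPos_laguerreOp_pow, neg_apply,
      neg_smul, ← map_smul]
    exact congrArg Neg.neg (laguerreUnitary_single k)
  rw [adjoint_comp_comp_single (u := κ • (laguerreOp ^ j) expTwoPi) (laguerreUnitary_single j) h₂]
  have hκ2 : κ * κ = -(4 * Real.pi) := by
    have : (√Real.pi : ℂ) * √Real.pi = Real.pi := by
      rw [← Complex.ofReal_mul, Real.mul_self_sqrt Real.pi_pos.le]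
    rw [hκ]
    linear_combination (4 * Complex.I ^ 2) * this + 4 * Real.pi * Complex.I_sq
  rw [map_smul, map_smul, smul_apply, smul_smul, hκ2, map_smul, map_smul,
    ← halfLineForm_pow_pow hT (fun u hu v hv => halfLineForm_laguerreOp ha hA hu hv)
      expTwoPi_mem_plusSpace expTwoPi_mem_plusSpace]

theorem theorem5p3 :
    (∀ (ν : Measure ℝ), ν (Iio 0) = 0 → ν (Ici 0) ≤ 1 → ν ≠ Measure.dirac 0 →
      ∀ (φ : ℝ → ℂ) (_ : Continuous φ) (_ : tsupport φ ⊆ Ici 0)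
        (hφ : MemLp φ 2 (volume : Measure ℝ)) (C : ℝ)
        (_ : ∀ᵐ ξ : ℝ, ‖(𝓕⁻ (hφ.toLp φ) : Lp ℂ 2 (volume : Measure ℝ)) ξ‖ ≤ C / (1 + ξ ^ 2)),
      ∃ Φ₁ Φ₂ : SeqL2 →L[ℂ] HalfLineL2,
        ∀ (a : ℝ → ℂ) (A : HalfLineL2 →L[ℂ] HalfLineL2),
          LocallyIntegrableOn a (Ioi 0) → IsIntegralHankel a A →
          ∃ (α : ℕ → ℂ) (T : SeqL2 →L[ℂ] SeqL2),
            IsRestriction a (fun j => (convMeasure ν)^[j] φ) α ∧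
            IsHankelMatrix α T ∧
            adjoint Φ₂ ∘L A ∘L Φ₁ = T ∧
            ‖T‖ ≤ ‖Φ₁‖ * ‖Φ₂‖ * ‖A‖ ∧
            ∀ p : ℝ, 0 < p → MemSchatten p A →
              MemSchatten p T ∧ schattenNorm p T ≤ ‖Φ₁‖ * ‖Φ₂‖ * schattenNorm p A) ∧
    (∃ U : SeqL2 ≃ₗᵢ[ℂ] HalfLineL2,
      (∀ n : ℕ, U (lp.single 2 n (1 : ℂ)) =ᵐ[volume.restrict (Ioi 0)] laguerreFun n) ∧
      ∀ (a : ℝ → ℂ) (A : HalfLineL2 →L[ℂ] HalfLineL2),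
        LocallyIntegrableOn a (Ioi 0) → IsIntegralHankel a A →
        ∃ (α : ℕ → ℂ) (T : SeqL2 →L[ℂ] SeqL2),
          IsRestriction a (fun j => laguerreConv^[j] laguerreWeight) α ∧
          IsHankelMatrix α T ∧
          adjoint (-(U : SeqL2 →L[ℂ] HalfLineL2)) ∘L A ∘L (U : SeqL2 →L[ℂ] HalfLineL2) = T) := by
  refine ⟨fun ν h0 h1 hν φ hc hs hφ C hC => ?_, laguerreUnitary, fun n => ?_, fun a A ha hA => ?_⟩
  · obtain ⟨Φ₁, Φ₂, h⟩ := exists_restriction_operators h0 h1 hν hc hs hφ hC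
    refine ⟨Φ₁, Φ₂, fun a A ha hA => ?_⟩
    obtain ⟨α, hα, hT⟩ := h a A ha hA
    refine ⟨α, _, hα, hT, rfl, norm_adjoint_comp_comp_le Φ₁ Φ₂ A, fun p hp hAp => ?_⟩
    have hS := hAp.comp hp (adjoint Φ₂) Φ₁
    rw [LinearIsometryEquiv.norm_map, mul_comm ‖Φ₂‖] at hS
    exact hS
  · rw [laguerreUnitary_single]
    exact coeFn_restrictPos_laguerreVec n
  · obtain ⟨α, hα, hT⟩ := exists_laguerre_restriction ha hA
    exact ⟨α, _, hα, hT, rfl⟩
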